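/- Let $n\ge 1$. Let $\mathscr P_0$ be the class of $(1+n)$-dimensional nonlinear Schrödinger equations $$\mathcal L_{\delta,V}:\qquad i\psi_t+\psi_{aa}+\delta\,\psi\ln\rho+V(t,x)\psi=0,\qquad \rho=|\psi|\neq 0,$$ for a complex-valued function $\psi$ of $t\in\mathbb R$ and $x=(x_1,\dots,x_n)\in\mathbb R^n$, where the arbitrary elements are a constant $\delta\in\mathbb C\setminus\{0\}$ and a smooth complex-valued function $V$ of $(t,x)$. Indices $a,b$ run from $1$ to $n$, repeated indices are summed over, and subscripts denote derivatives. Point transformations are local: a point transformation is a diffeomorphism of an open set of points $(t,x,\psi)$ with $\psi\ne0$ onto another such set (its components being smooth functions of $(t,x,\psi,\psi^*)$), and equations are considered over such sets, with $V$ defined on the corresponding set of $(t,x)$. An admissible transformation of $\mathscr P_0$ is a triple $((\delta,V),\varphi,(\tilde\delta,\tilde V))$, where $\varphi$ is a point transformation whose prolongation to second-order jets maps $\mathcal L_{\delta,V}$ to $\mathcal L_{\tilde\delta,\tilde V}$. The equivalence group $G^\sim_{\mathscr P_0}$ consists of the point transformations $\Phi$ of the space with coordinates $(t,x,\psi,\psi^*,\delta,\delta^*,V,V^*)$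 (with $\delta\neq0$ and $V$ unrestricted) whose $(t,x,\psi)$-components depend only on $(t,x,\psi,\psi^*)$, thus defining a point transformation $\varphi$ of the variables, and which map each pair $(\delta,V)$ of arbitrary elements to a pair $(\tilde\delta,\tilde V)$ of arbitrary elements such that $((\delta,V),\varphi,(\tilde\delta,\tilde V))$ is an admissible transformation. Call a domain of $(t,x,\psi)$ a patch if it is open, is contained in $\{\psi\neq0\}$, its projection to the $t$-axis is an interval $I$ and its sections $t=\mathrm{const}$ are connected (every point of an open set in $\{\psi\ne0\}$ has a neighbourhood in this set that is a patch). Then the following holds. 1. The class $\mathscr P_0$ is normalized: for every admissible transformation $((\delta,V),\varphi,(\tilde\delta,\tilde V))$ and every patch in the domain of $\varphi$, there is an equivalence transformation $\Phi\in G^\sim_{\mathscr P_0}$ over this patch whose $(t,x,\psi)$-components coincide with $\varphi$ on the patch and which maps $(\delta,V)$ to $(\tilde\delta,\tilde V)$. 2. Over every patch, the equivalence group $G^\sim_{\mathscr P_0}$ consists precisely of the transformations $$\tilde t=T,\qquad \tilde x_a=|T_t|^{1/2}O^{ab}x_b+\mathcal X^a,$$ $$\tilde\psi=\exp\Big(\frac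 i8\frac{T_{tt}}{|T_t|}x_ax_a+\frac i2\frac{\varepsilon'\mathcal X^b_t}{|T_t|^{1/2}}O^{ba}x_a+i\Sigma+Z\Big)\hat\psi,$$ $$\tilde\delta=\frac{\hat\delta}{|T_t|},\qquad \tilde V=\frac{\hat V}{|T_t|}+\frac{\mathcal X^b_{tt}}{2|T_t|^{3/2}}O^{ba}x_a-\hat\delta\frac{Z}{|T_t|}-\frac14\frac{\mathcal X^a_t\mathcal X^a_t}{T_t^2}+\frac{\Sigma_t-iZ_t}{T_t},$$ where $T$, $\mathcal X^a$, $Z$, $\Sigma$ are arbitrary smooth real-valued functions of $t\in I$ with $T_t\neq0$ and $T_{tt}=0$ (so that the first term in the exponent vanishes), $\varepsilon'=\operatorname{sgn}T_t$, $O=(O^{ab})$ is an arbitrary constant orthogonal $n\times n$ matrix, and $\hat\beta=\beta$ if $T_t>0$, $\hat\beta=\beta^*$ (complex conjugate) if $T_t<0$. -/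

import Mathlib

open scoped ContDiff Topology

noncomputable section

namespace LogNLS

/-- The space of the independent variables `(t, x)`, `x = (x₁, …, xₙ)`. -/
abbrev Base (n : ℕ) : Type := ℝ × (Fin n → ℝ)

/-- The space of the variables `((t, x), ψ)`. A real-smooth function on it is a smooth function
of `(t, x, ψ, ψ*)`. -/
abbrev Vars (n : ℕ) : Type := Base n × ℂ

/-- The joint space of the variables and of the values of the arbitrary elements,
with coordinates `(((t, x), ψ), (δ, V))`. -/
abbrev Ext (n : ℕ) : Type := Vars n × (ℂ × ℂ)

variable {n : ℕ}

/-- The derivative `ψ_t` at the point `p`. -/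
def dt (ψ : Base n → ℂ) (p : Base n) : ℂ := fderiv ℝ ψ p (1, 0)

/-- The derivative `∂ψ/∂x_a` at the point `p`. -/
def dx (a : Fin n) (ψ : Base n → ℂ) (p : Base n) : ℂ := fderiv ℝ ψ p (0, Pi.single a 1)

/-- At the point `p`, the function `ψ` satisfies
`i ψ_t + ψ_aa + δ ψ ln |ψ| + V ψ = 0` (summation over `a`). -/
def SatisfiesAt (δ : ℂ) (V ψ : Base n → ℂ) (p : Base n) : Prop :=
  Complex.I * dt ψ p + ∑ a, dx a (dx a ψ) p
    + δ * ψ p * (Real.log ‖ψ p‖ : ℂ) + V p * ψ p = 0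

/-- The pair `(δ, V)` is a value of the arbitrary elements of the class `𝒫₀` over
the set `D` of values of `(t, x)`. -/
def InClass (D : Set (Base n)) (δ : ℂ) (V : Base n → ℂ) : Prop :=
  δ ≠ 0 ∧ ContDiffOn ℝ ∞ V D

/-- The part `ψ ≠ 0` of the space of variables, on which the equations are smooth. -/
def regular (n : ℕ) : Set (Vars n) := {z | z.2 ≠ 0}

/-- `f` is a smooth map on `U`, injective and with an invertible differential at every point:
a diffeomorphism of the open set `U` onto its image. -/
def IsDiffeoOn {E : Type*} [NormedAddCommGroup E] [NormedSpace ℝ E] (f : E → E) (U : Set E) :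
    Prop :=
  IsOpen U ∧ ContDiffOn ℝ ∞ f U ∧ Set.InjOn f U ∧ ∀ z ∈ U, (fderiv ℝ f z).IsInvertible

/-- A (local) point transformation of the variables `(t, x, ψ, ψ*)` with domain `U`. -/
def IsPointTransformation (φ : Vars n → Vars n) (U : Set (Vars n)) : Prop :=
  IsDiffeoOn φ U ∧ U ⊆ regular n ∧ Set.MapsTo φ U (regular n)

/-- The point transformation `φ` with domain `U` maps the equation with `(δ, V)` to the equation
with `(δ', V')`, as submanifolds of the second-order jet space. Jets are represented by germs of
functions: whenever `φ` maps the germ of the graph of `ψ` at `p` into the graph of `ψ'`,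
the 2-jet of `ψ` at `p` lies in the first equation if and only if the 2-jet of `ψ'` at the
corresponding point, which is the image of the former under the prolongation of `φ`,
lies in the second one. -/
def MapsEquation (φ : Vars n → Vars n) (U : Set (Vars n)) (δ : ℂ) (V : Base n → ℂ)
    (δ' : ℂ) (V' : Base n → ℂ) : Prop :=
  ∀ (p : Base n) (ψ ψ' : Base n → ℂ), (p, ψ p) ∈ U → ContDiffAt ℝ ∞ ψ p →
    ContDiffAt ℝ ∞ ψ' (φ (p, ψ p)).1 →
    (∀ᶠ q in 𝓝 p, ψ' (φ (q, ψ q)).1 = (φ (q, ψ q)).2) →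
    (SatisfiesAt δ V ψ p ↔ SatisfiesAt δ' V' ψ' (φ (p, ψ p)).1)

/-- The triple `((δ, V), φ, (δ', V'))`, where `φ` has domain `U`, is an admissible transformation
of the class `𝒫₀`, i.e., an element of its equivalence groupoid. -/
def IsAdmissible (U : Set (Vars n)) (δ : ℂ) (V : Base n → ℂ) (φ : Vars n → Vars n)
    (δ' : ℂ) (V' : Base n → ℂ) : Prop :=
  IsPointTransformation φ U ∧ InClass (Prod.fst '' U) δ V ∧
    InClass (Prod.fst '' (φ '' U)) δ' V' ∧ MapsEquation φ U δ V δ' V'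

/-- The point transformation `Φ` of the joint space, with `φ` as its action on the variables,
maps the arbitrary elements `(δ, V)` over `U` to `(δ', V')`. -/
def MapsElements (Φ : Ext n → Ext n) (φ : Vars n → Vars n) (U : Set (Vars n))
    (δ : ℂ) (V : Base n → ℂ) (δ' : ℂ) (V' : Base n → ℂ) : Prop :=
  ∀ z ∈ U, Φ (z, (δ, V z.1)) = (φ z, (δ', V' (φ z).1))

/-- `Φ` belongs to the (usual) equivalence group of the class `𝒫₀`, where `U` is the domain of
its action on the variables: `Φ` is a point transformation of the joint space of variables and
arbitrary elements, it is projectable to the space of variables, and its projection `φ` maps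
every equation of the class to the equation of the class whose arbitrary elements are the images
of the original ones under `Φ`. -/
def IsEquivalenceTransformation (U : Set (Vars n)) (Φ : Ext n → Ext n) : Prop :=
  IsDiffeoOn Φ (U ×ˢ ({0}ᶜ ×ˢ Set.univ)) ∧
  ∃ φ : Vars n → Vars n, IsPointTransformation φ U ∧
    (∀ e ∈ U ×ˢ (({0}ᶜ : Set ℂ) ×ˢ (Set.univ : Set ℂ)), (Φ e).1 = φ e.1) ∧
    ∀ (δ : ℂ) (V : Base n → ℂ), InClass (Prod.fst '' U) δ V →
      ∃ (δ' : ℂ) (V' : Base n → ℂ), MapsElements Φ φ U δ V δ' V' ∧ IsAdmissible U δ V φ δ' V'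

/-- The set of values of `t` on `U`. -/
def times (U : Set (Vars n)) : Set ℝ := (fun z : Vars n => z.1.1) '' U

/-- Domains of the local setting: open sets of points `(t, x, ψ)` with `ψ ≠ 0` on which `t` runs
through an interval and all sections `t = const` are connected. All boxes
`I × B × D` with an interval `I` and with connected `B` and `D` are such, and so is the whole
space. -/
structure IsPatch (U : Set (Vars n)) : Prop where
  isOpen : IsOpen U
  subset_regular : U ⊆ regular n
  times_conn : IsPreconnected (times U)
  section_conn : ∀ t : ℝ, IsPreconnected {w : (Fin n → ℝ) × ℂ | ((t, w.1), w.2) ∈ U}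

/-- Normalization of the class `𝒫₀`: its equivalence groupoid is generated by its equivalence
group, i.e., every admissible transformation is, on each patch of its domain, induced
by an equivalence transformation. -/
def IsNormalized (n : ℕ) : Prop :=
  ∀ (U : Set (Vars n)) (δ : ℂ) (V : Base n → ℂ) (φ : Vars n → Vars n) (δ' : ℂ)
    (V' : Base n → ℂ), IsAdmissible U δ V φ δ' V' →
    ∀ W ⊆ U, IsPatch W →
      ∃ Φ : Ext n → Ext n, IsEquivalenceTransformation W Φ ∧ MapsElements Φ φ W δ V δ' V'

/-- `β` if `s > 0` and the complex conjugate of `β` otherwise; used with `s = T_t`. -/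
def hat (s : ℝ) (β : ℂ) : ℂ := if 0 < s then β else starRingEnd ℂ β

/-- The `x`-components `|T_t|^{1/2} O^{ab} x_b + 𝒳^a`. -/
def newX (T : ℝ → ℝ) (X : Fin n → ℝ → ℝ) (O : Matrix (Fin n) (Fin n) ℝ)
    (t : ℝ) (x : Fin n → ℝ) (a : Fin n) : ℝ :=
  |deriv T t| ^ (1 / 2 : ℝ) * ∑ b, O a b * x b + X a t

/-- The `ψ`-component
`exp((i/8) (T_tt/|T_t|) x_a x_a + (i/2) (ε' 𝒳^b_t/|T_t|^{1/2}) O^{ba} x_a + iΣ + Z) ψ̂`. -/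
def newPsi (T : ℝ → ℝ) (X : Fin n → ℝ → ℝ) (O : Matrix (Fin n) (Fin n) ℝ) (S Z : ℝ → ℝ)
    (t : ℝ) (x : Fin n → ℝ) (ψ : ℂ) : ℂ :=
  Complex.exp
    (Complex.I * ((1 / 8 * (deriv (deriv T) t / |deriv T t|) * ∑ a, x a * x a
        + 1 / 2 * ∑ b, ∑ a, Real.sign (deriv T t) * deriv (X b) t / |deriv T t| ^ (1 / 2 : ℝ)
            * O b a * x a
        + S t : ℝ) : ℂ) + (Z t : ℂ))
    * hat (deriv T t) ψ

/-- The `δ`-component `δ̂ / |T_t|`. -/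
def newDelta (T : ℝ → ℝ) (t : ℝ) (δ : ℂ) : ℂ := hat (deriv T t) δ / ((|deriv T t| : ℝ) : ℂ)

/-- The `V`-component
`V̂/|T_t| + 𝒳^b_tt O^{ba} x_a/(2|T_t|^{3/2}) - δ̂ Z/|T_t| - 𝒳^a_t 𝒳^a_t/(4 T_t²)
  + (Σ_t - i Z_t)/T_t`. -/
def newV (T : ℝ → ℝ) (X : Fin n → ℝ → ℝ) (O : Matrix (Fin n) (Fin n) ℝ) (S Z : ℝ → ℝ)
    (t : ℝ) (x : Fin n → ℝ) (δ v : ℂ) : ℂ :=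
  hat (deriv T t) v / ((|deriv T t| : ℝ) : ℂ)
    + ((∑ b, ∑ a, deriv (deriv (X b)) t / (2 * |deriv T t| ^ (3 / 2 : ℝ)) * O b a * x a : ℝ) : ℂ)
    - hat (deriv T t) δ * ((Z t / |deriv T t| : ℝ) : ℂ)
    - ((1 / 4 * ∑ a, deriv (X a) t * deriv (X a) t / deriv T t ^ 2 : ℝ) : ℂ)
    + (((deriv S t : ℝ) : ℂ) - Complex.I * ((deriv Z t : ℝ) : ℂ)) / ((deriv T t : ℝ) : ℂ)

end LogNLS

end

/-!
A point transformation acts on 2-jets, and the jets admitted by an equation of the class are those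
subject to the single relation `i ψ_t + ψ_aa + δ ψ ln |ψ| + V ψ = 0`; the transformation has to
carry this relation to its counterpart. Varying the second derivatives of the jet shows that `t̃`
depends on `t` only, that the prolonged action on the spatial directions is conformal with factor
`|T_t|`, and that `ψ̃` is complex linear or antilinear to first order in `ψ`, according to the sign
of `T_t`. As the factor cannot depend on the slope of the jet, `x̃` does not involve `ψ`.

What remains are determining equations for `ψ̃`. Along a line in the fibre they compare the
logarithms of `|ψ|` and `|ψ̃|`, whose singularities must cancel: this makes `ψ̃` homogeneous
in `ψ̂` and gives `δ̂ = |T_t| δ̃`. Since `δ` and `δ̃` are constants, so is `T_t`; hence the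
spatial part is a similitude with constant linear part, the first-order terms fix the gradient
of the phase, and the zeroth-order terms fix the potential. On a patch these local conclusions
integrate over the connected sections `t = const` and over the interval of times.
-/

open scoped ContDiff Topology

noncomputable section

namespace LogNLS

/-! ### Second derivatives along graphs -/

section SecondDerivative

variable {E F G : Type*} [NormedAddCommGroup E] [NormedSpace ℝ E] [NormedAddCommGroup F]
  [NormedSpace ℝ F] [NormedAddCommGroup G] [NormedSpace ℝ G]

/-- The second derivative of `f` at `p`, as a bilinear map. -/
abbrev D2 (f : E → F) (p : E) : E →L[ℝ] E →L[ℝ] F := fderiv ℝ (fderiv ℝ f) p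

theorem contDiffAt_two {f : E → F} {p : E} (hf : ContDiffAt ℝ ∞ f p) : ContDiffAt ℝ 2 f p :=
  hf.of_le (by norm_cast)

theorem eventually_differentiableAt {f : E → F} {p : E} (hf : ContDiffAt ℝ 1 f p) :
    ∀ᶠ q in 𝓝 p, DifferentiableAt ℝ f q :=
  (hf.eventually (by simp)).mono fun _ hq => hq.differentiableAt one_ne_zero

theorem hasFDerivAt_fderiv {f : E → F} {p : E} (hf : ContDiffAt ℝ 2 f p) :
    HasFDerivAt (fderiv ℝ f) (D2 f p) p :=
  ((hf.fderiv_right (m := 1) le_rfl).differentiableAt one_ne_zero).hasFDerivAt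

theorem hasFDerivAt_fderiv_apply {f : E → F} {p : E} (hf : ContDiffAt ℝ 2 f p) (v : E) :
    HasFDerivAt (fun q => fderiv ℝ f q v) ((D2 f p).flip v) p := by
  convert (hasFDerivAt_fderiv hf).clm_apply (hasFDerivAt_const v p) using 1
  ext
  simp

theorem D2_comm {f : E → F} {p : E} (hf : ContDiffAt ℝ 2 f p) (u v : E) :
    D2 f p u v = D2 f p v u :=
  hf.isSymmSndFDerivAt (by simp) u v

theorem D2_comp {f : E → F} {g : F → G} {p : E} (hf : ContDiffAt ℝ 2 f p)
    (hg : ContDiffAt ℝ 2 g (f p)) (u v : E) :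
    D2 (g ∘ f) p u v = D2 g (f p) (fderiv ℝ f p u) (fderiv ℝ f p v)
      + fderiv ℝ g (f p) (D2 f p u v) := by
  have hchain : fderiv ℝ (g ∘ f) =ᶠ[𝓝 p] fun q => (fderiv ℝ g (f q)).comp (fderiv ℝ f q) := by
    filter_upwards [eventually_differentiableAt (hf.of_le one_le_two),
      hf.continuousAt.eventually (eventually_differentiableAt (hg.of_le one_le_two))]
      with q hfq hgq using fderiv_comp q hgq hfq
  have houter : HasFDerivAt (fun q => fderiv ℝ g (f q)) ((D2 g (f p)).comp (fderiv ℝ f p)) p :=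
    (hasFDerivAt_fderiv hg).comp p (hf.differentiableAt two_ne_zero).hasFDerivAt
  rw [D2, hchain.fderiv_eq, (houter.clm_comp (hasFDerivAt_fderiv hf)).fderiv]
  simp [add_comm]

theorem D2_clm_apply (l : F →L[ℝ] G) {f : E → F} {p : E} (hf : ContDiffAt ℝ 2 f p) (u v : E) :
    D2 (fun q => l (f q)) p u v = l (D2 f p u v) := by
  have hl : fderiv ℝ l = fun _ => l := funext fun _ => l.fderiv
  have hD2l : D2 l (f p) = 0 := by rw [D2, hl, fderiv_const_apply]
  have hcomp := D2_comp hf (g := l) l.contDiff.contDiffAt u v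
  rwa [hD2l, l.fderiv, zero_apply, zero_apply, zero_add] at hcomp

theorem D2_prodMk {f : E → F} {g : E → G} {p : E} (hf : ContDiffAt ℝ 2 f p)
    (hg : ContDiffAt ℝ 2 g p) (u v : E) :
    D2 (fun q => (f q, g q)) p u v = (D2 f p u v, D2 g p u v) :=
  Prod.ext (D2_clm_apply (ContinuousLinearMap.fst ℝ F G) (hf.prodMk hg) u v).symm
    (D2_clm_apply (ContinuousLinearMap.snd ℝ F G) (hf.prodMk hg) u v).symm

theorem D2_id (p : E) : D2 (fun q : E => q) p = 0 := by
  have hid : fderiv ℝ (fun q : E => q) = fun _ => ContinuousLinearMap.id ℝ E :=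
    funext fun _ => fderiv_fun_id
  rw [D2, hid, fderiv_const_apply]

end SecondDerivative

section Graph

variable {E F G : Type*} [NormedAddCommGroup E] [NormedSpace ℝ E] [NormedAddCommGroup F]
  [NormedSpace ℝ F] [NormedAddCommGroup G] [NormedSpace ℝ G]
  {φ : E × F → G} {ψ : E → F} {p : E}

theorem fderiv_comp_graph (hφ : DifferentiableAt ℝ φ (p, ψ p)) (hψ : DifferentiableAt ℝ ψ p)
    (v : E) :
    fderiv ℝ (fun q => φ (q, ψ q)) p v = fderiv ℝ φ (p, ψ p) (v, fderiv ℝ ψ p v) := by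
  have hgraph : HasFDerivAt (fun q => (q, ψ q)) _ p := (hasFDerivAt_id p).prodMk hψ.hasFDerivAt
  exact DFunLike.congr_fun (hφ.hasFDerivAt.comp p hgraph).fderiv v

theorem D2_comp_graph (hφ : ContDiffAt ℝ 2 φ (p, ψ p)) (hψ : ContDiffAt ℝ 2 ψ p) (v : E) :
    D2 (fun q => φ (q, ψ q)) p v v
      = D2 φ (p, ψ p) (v, fderiv ℝ ψ p v) (v, fderiv ℝ ψ p v)
        + fderiv ℝ φ (p, ψ p) (0, D2 ψ p v v) := by
  have hgraph : fderiv ℝ (fun q => (q, ψ q)) p v = (v, fderiv ℝ ψ p v) :=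
    DFunLike.congr_fun
      ((hasFDerivAt_id p).prodMk (hψ.differentiableAt two_ne_zero).hasFDerivAt).fderiv v
  have hcomp := D2_comp (f := fun q => (q, ψ q)) (g := φ) (contDiffAt_id.prodMk hψ) hφ v v
  rwa [hgraph, D2_prodMk (f := fun q => q) contDiffAt_id hψ, D2_id] at hcomp

end Graph

section Prolongation

variable {E F : Type*} [NormedAddCommGroup E] [NormedSpace ℝ E] [NormedAddCommGroup F]
  [NormedSpace ℝ F] {φ : E × F → E × F} {ψ ψ' : E → F} {p : E}

theorem fderiv_transformed (hφ : DifferentiableAt ℝ φ (p, ψ p)) (hψ : DifferentiableAt ℝ ψ p)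
    (hψ' : DifferentiableAt ℝ ψ' (φ (p, ψ p)).1)
    (h : ∀ᶠ q in 𝓝 p, ψ' (φ (q, ψ q)).1 = (φ (q, ψ q)).2) (v : E) :
    fderiv ℝ ψ' (φ (p, ψ p)).1 (fderiv ℝ φ (p, ψ p) (v, fderiv ℝ ψ p v)).1
      = (fderiv ℝ φ (p, ψ p) (v, fderiv ℝ ψ p v)).2 := by
  have hgraph : HasFDerivAt (fun q => φ (q, ψ q)) _ p :=
    hφ.hasFDerivAt.comp p ((hasFDerivAt_id p).prodMk hψ.hasFDerivAt)
  have hleft : HasFDerivAt (fun q => ψ' (φ (q, ψ q)).1) _ p :=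
    hψ'.hasFDerivAt.comp p hgraph.fst
  exact DFunLike.congr_fun (hleft.fderiv.symm.trans
    ((Filter.EventuallyEq.fderiv_eq h).trans hgraph.snd.fderiv)) v

theorem D2_transformed (hφ : ContDiffAt ℝ 2 φ (p, ψ p)) (hψ : ContDiffAt ℝ 2 ψ p)
    (hψ' : ContDiffAt ℝ 2 ψ' (φ (p, ψ p)).1)
    (h : ∀ᶠ q in 𝓝 p, ψ' (φ (q, ψ q)).1 = (φ (q, ψ q)).2) (v : E) :
    D2 ψ' (φ (p, ψ p)).1 (fderiv ℝ φ (p, ψ p) (v, fderiv ℝ ψ p v)).1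
        (fderiv ℝ φ (p, ψ p) (v, fderiv ℝ ψ p v)).1
      + fderiv ℝ ψ' (φ (p, ψ p)).1
        (D2 φ (p, ψ p) (v, fderiv ℝ ψ p v) (v, fderiv ℝ ψ p v)
          + fderiv ℝ φ (p, ψ p) (0, D2 ψ p v v)).1
      = (D2 φ (p, ψ p) (v, fderiv ℝ ψ p v) (v, fderiv ℝ ψ p v)
          + fderiv ℝ φ (p, ψ p) (0, D2 ψ p v v)).2 := by
  have hgraph : ContDiffAt ℝ 2 (fun q => φ (q, ψ q)) p := hφ.comp p (contDiffAt_id.prodMk hψ)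
  have hfst : fderiv ℝ (fun q => (φ (q, ψ q)).1) p v
      = (fderiv ℝ φ (p, ψ p) (v, fderiv ℝ ψ p v)).1 := by
    rw [← fderiv_comp_graph (hφ.differentiableAt two_ne_zero) (hψ.differentiableAt two_ne_zero),
      (hgraph.differentiableAt two_ne_zero).hasFDerivAt.fst.fderiv]
    rfl
  have hD2fst := D2_clm_apply (ContinuousLinearMap.fst ℝ E F) hgraph v v
  have hD2snd := D2_clm_apply (ContinuousLinearMap.snd ℝ E F) hgraph v v
  have hcomp := D2_comp (f := fun q => (φ (q, ψ q)).1) (g := ψ') hgraph.fst hψ' v v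
  have heq : D2 (fun q => ψ' (φ (q, ψ q)).1) p = D2 (fun q => (φ (q, ψ q)).2) p :=
    (Filter.EventuallyEq.fderiv h).fderiv_eq
  simp only [ContinuousLinearMap.coe_fst', ContinuousLinearMap.coe_snd', Function.comp_def]
    at hD2fst hD2snd hcomp
  rw [heq, hD2snd, hD2fst, hfst, D2_comp_graph hφ hψ] at hcomp
  exact hcomp.symm

theorem exists_transformed [CompleteSpace E] {m : ℕ∞ω} (hm : m ≠ 0)
    (hφ : ContDiffAt ℝ m φ (p, ψ p)) (hψ : ContDiffAt ℝ m ψ p)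
    (hA : (fderiv ℝ (fun q => (φ (q, ψ q)).1) p).IsInvertible) :
    ∃ ψ' : E → F, ContDiffAt ℝ m ψ' (φ (p, ψ p)).1 ∧
      ∀ᶠ q in 𝓝 p, ψ' (φ (q, ψ q)).1 = (φ (q, ψ q)).2 := by
  have hgraph : ContDiffAt ℝ m (fun q => φ (q, ψ q)) p := hφ.comp p (contDiffAt_id.prodMk hψ)
  obtain ⟨e, he⟩ := hA
  have hderiv : HasFDerivAt (fun q => (φ (q, ψ q)).1) (e : E →L[ℝ] E) p :=
    he ▸ (hgraph.fst.differentiableAt hm).hasFDerivAt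
  set β := hgraph.fst.localInverse hderiv hm
  have hβp : β (φ (p, ψ p)).1 = p := hgraph.fst.localInverse_apply_image hderiv hm
  refine ⟨fun y => (φ (β y, ψ (β y))).2, ?_, ?_⟩
  · have hsnd : ContDiffAt ℝ m (fun q => (φ (q, ψ q)).2) (β (φ (p, ψ p)).1) := by
      rw [hβp]
      exact hgraph.snd
    exact hsnd.comp _ (hgraph.fst.to_localInverse hderiv hm)
  · filter_upwards [(hgraph.fst.hasStrictFDerivAt' hderiv hm).eventually_left_inverse] with q hq
    have hβq : β (φ (q, ψ q)).1 = q := hq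
    rw [hβq]

end Prolongation

section Quadratic

variable {E F : Type*} [NormedAddCommGroup E] [NormedSpace ℝ E] [NormedAddCommGroup F]
  [NormedSpace ℝ F]

/-- The quadratic polynomial with value `w` at `p`, first derivative `k` there and second
derivative the symmetrization of `H`; it realizes a prescribed 2-jet by a function. -/
def quad (p : E) (w : F) (k : E →L[ℝ] F) (H : E →L[ℝ] E →L[ℝ] F) (q : E) : F :=
  w + k (q - p) + (1 / 2 : ℝ) • H (q - p) (q - p)

variable (p : E) (w : F) (k : E →L[ℝ] F) (H : E →L[ℝ] E →L[ℝ] F)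

theorem quad_self : quad p w k H p = w := by
  simp [quad]

theorem contDiff_quad : ContDiff ℝ ∞ (quad p w k H) := by
  unfold quad
  fun_prop

theorem hasFDerivAt_quad (q : E) :
    HasFDerivAt (quad p w k H) (k + (1 / 2 : ℝ) • (H (q - p) + H.flip (q - p))) q := by
  have hsub : HasFDerivAt (fun q : E => q - p) (ContinuousLinearMap.id ℝ E) q :=
    (hasFDerivAt_id q).sub_const p
  refine (((k.hasFDerivAt.comp q hsub).const_add w).add
    (((H.hasFDerivAt.comp q hsub).clm_apply hsub).const_smul (1 / 2 : ℝ))).congr_fderiv ?_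
  ext v
  simp

theorem fderiv_quad : fderiv ℝ (quad p w k H) p = k := by
  rw [(hasFDerivAt_quad p w k H p).fderiv]
  simp

theorem D2_quad (v : E) : D2 (quad p w k H) p v v = H v v := by
  set B : E →L[ℝ] E →L[ℝ] F := (1 / 2 : ℝ) • (H + H.flip) with hB
  have hquad : fderiv ℝ (quad p w k H) = fun q => k + B (q - p) :=
    funext fun q => (hasFDerivAt_quad p w k H q).fderiv
  have hderiv : HasFDerivAt (fun q => k + B (q - p)) B p :=
    (B.hasFDerivAt.comp p ((hasFDerivAt_id p).sub_const p)).const_add k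
  rw [D2, hquad, hderiv.fderiv, hB]
  simp only [smul_apply, add_apply, ContinuousLinearMap.flip_apply, ← two_smul ℝ (H v v),
    smul_smul]
  norm_num

end Quadratic

section GeneralJets

theorem exists_bijective_add_comp {K E F : Type*} [Field K] [AddCommGroup E] [Module K E]
    [FiniteDimensional K E] [AddCommGroup F] [Module K F] {A : E →ₗ[K] E} {B : F →ₗ[K] E}
    (h : ∀ y, ∃ v w, A v + B w = y) : ∃ k : E →ₗ[K] F, Function.Bijective (A + B ∘ₗ k) := by
  set q := A.range.mkQ
  have hqA : ∀ v, q (A v) = 0 := by simp [q]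
  have hqB : Function.Surjective (q ∘ₗ B) := by
    intro y
    obtain ⟨y, rfl⟩ := Submodule.mkQ_surjective _ y
    obtain ⟨v, w, rfl⟩ := h y
    exact ⟨w, by rw [map_add, hqA, zero_add]; rfl⟩
  obtain ⟨s, hs⟩ := LinearMap.exists_rightInverse_of_surjective _ (LinearMap.range_eq_top.2 hqB)
  have hdim : Module.finrank K A.ker = Module.finrank K (E ⧸ A.range) := by
    have hrank := A.finrank_range_add_finrank_ker
    have hquot := A.range.finrank_quotient_add_finrank
    omega
  let e := LinearEquiv.ofFinrankEq A.ker (E ⧸ A.range) hdim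
  obtain ⟨π, hπ⟩ := LinearMap.exists_leftInverse_of_injective A.ker.subtype (by simp)
  set k : E →ₗ[K] F := s ∘ₗ e.toLinearMap ∘ₗ π with hk
  have hinj : Function.Injective (A + B ∘ₗ k) := by
    rw [injective_iff_map_eq_zero]
    intro v hv
    have hv' : A v + B (k v) = 0 := hv
    have hπv : π v = 0 := by
      have hqBk : q (B (k v)) = e (π v) := DFunLike.congr_fun hs (e (π v))
      have hqv := congrArg q hv'
      rwa [map_add, hqA, zero_add, map_zero, hqBk, map_eq_zero_iff e e.injective] at hqv
    have hAv : A v = 0 := by simpa [hk, hπv] using hv'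
    have hv0 := DFunLike.congr_fun hπ ⟨v, hAv⟩
    exact (congrArg Subtype.val (hv0.symm.trans hπv))
  exact ⟨k, hinj, LinearMap.injective_iff_surjective.1 hinj⟩

variable {E F : Type*} [NormedAddCommGroup E] [NormedSpace ℝ E] [NormedAddCommGroup F]
  [NormedSpace ℝ F]

/-- The derivative of the transformed independent variables along a graph of slope `k`, where `L`
is the differential of the point transformation. -/
def slopeMap (L : E × F →L[ℝ] E × F) (k : E →L[ℝ] F) : E →L[ℝ] E :=
  (ContinuousLinearMap.fst ℝ E F).comp (L.comp ((ContinuousLinearMap.id ℝ E).prod k))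

/-- The effect of a variation of the dependent variable on the transformed dependent variable, at
fixed transformed independent variables, when the transformed graph has slope `k'`. -/
def fiberMap (L : E × F →L[ℝ] E × F) (k' : E →L[ℝ] F) : F →L[ℝ] F :=
  (ContinuousLinearMap.snd ℝ E F - k'.comp (ContinuousLinearMap.fst ℝ E F)).comp
    (L.comp (ContinuousLinearMap.inr ℝ E F))

/-- The prolongation of a point transformation with first derivative `L` and second derivative `Q`
takes the jet with first derivative `k` and second derivative `H` to the jet with first derivative
`k'` and second derivative `H'`. -/
structure Prolongs (L : E × F →L[ℝ] E × F) (Q : E × F →L[ℝ] E × F →L[ℝ] E × F)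
    (k : E →L[ℝ] F) (H : E →L[ℝ] E →L[ℝ] F) (k' : E →L[ℝ] F) (H' : E →L[ℝ] E →L[ℝ] F) :
    Prop where
  first : ∀ v, k' (slopeMap L k v) = (L (v, k v)).2
  second : ∀ v, H' (slopeMap L k v) (slopeMap L k v)
      + k' (Q (v, k v) (v, k v) + L (0, H v v)).1 = (Q (v, k v) (v, k v) + L (0, H v v)).2

variable {L : E × F →L[ℝ] E × F} {Q : E × F →L[ℝ] E × F →L[ℝ] E × F} {k k' k₁ k₁' : E →L[ℝ] F}
  {H H' H₁ H₁' : E →L[ℝ] E →L[ℝ] F}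

@[simp] theorem slopeMap_apply (v : E) : slopeMap L k v = (L (v, k v)).1 := rfl

@[simp] theorem fiberMap_apply (w : F) :
    fiberMap L k' w = (L (0, w)).2 - k' (L (0, w)).1 := rfl

theorem slopeMap_add (l : E →L[ℝ] F) (v : E) :
    slopeMap L (k + l) v = slopeMap L k v + (L (0, l v)).1 := by
  have hgraph : (v, (k + l) v) = (v, k v) + ((0 : E), l v) := by simp
  rw [slopeMap_apply, hgraph, map_add]
  rfl

theorem slopeMap_add_smul (l : E →L[ℝ] F) (ε : ℝ) (v : E) :
    slopeMap L (k + ε • l) v = slopeMap L k v + ε • (L (0, l v)).1 := by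
  have hfiber : ((0 : E), (ε • l) v) = ε • ((0 : E), l v) := by simp
  rw [slopeMap_add, hfiber, map_smul, Prod.smul_fst]

theorem fst_eq_slopeMap_add (k : E →L[ℝ] F) (u : E × F) :
    (L u).1 = slopeMap L k u.1 + (L (0, u.2 - k u.1)).1 := by
  have hsplit : u = (u.1, k u.1) + (0, u.2 - k u.1) := by simp
  conv_lhs => rw [hsplit, map_add]
  rfl

theorem exists_bijective_slopeMap [FiniteDimensional ℝ E] (hL : Function.Surjective L) :
    ∃ k : E →L[ℝ] F, Function.Bijective (slopeMap L k) := by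
  obtain ⟨k, hk⟩ := exists_bijective_add_comp (A := (slopeMap L 0 : E →ₗ[ℝ] E))
    (B := LinearMap.fst ℝ E F ∘ₗ (L : E × F →ₗ[ℝ] E × F) ∘ₗ LinearMap.inr ℝ E F)
    fun y => by
      obtain ⟨u, hu⟩ := hL (y, 0)
      refine ⟨u.1, u.2, ?_⟩
      simpa [hu] using (fst_eq_slopeMap_add (L := L) 0 u).symm
  refine ⟨k.toContinuousLinearMap, ?_⟩
  convert hk using 1
  ext v
  simpa using fst_eq_slopeMap_add (L := L) 0 (v, k v)

theorem eventually_bijective_slopeMap [CompleteSpace E] (hk : Function.Bijective (slopeMap L k))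
    (l : E →L[ℝ] F) : ∀ᶠ ε in 𝓝 (0 : ℝ), Function.Bijective (slopeMap L (k + ε • l)) := by
  set B : E →L[ℝ] E := (ContinuousLinearMap.fst ℝ E F).comp
    (L.comp ((ContinuousLinearMap.inr ℝ E F).comp l))
  have hslope : ∀ ε : ℝ, slopeMap L (k + ε • l) = slopeMap L k + ε • B := fun ε =>
    ContinuousLinearMap.ext (slopeMap_add_smul l ε)
  have hcont : Continuous fun ε : ℝ => slopeMap L k + ε • B := by fun_prop
  simp only [hslope, ← ContinuousLinearMap.isUnit_iff_bijective]
  exact hcont.continuousAt.eventually (Units.isOpen.mem_nhds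
    (by simpa [ContinuousLinearMap.isUnit_iff_bijective] using hk))

theorem fiberMap_injective (hL : Function.Injective L)
    (hk : Function.Surjective (slopeMap L k)) (hP : ∀ v, k' (slopeMap L k v) = (L (v, k v)).2) :
    Function.Injective (fiberMap L k') := by
  rw [injective_iff_map_eq_zero]
  intro w hw
  obtain ⟨v, hv⟩ := hk (L (0, w)).1
  have hLv : L (v, k v) = L (0, w) := by
    refine Prod.ext hv ?_
    rw [← hP, hv]
    exact (sub_eq_zero.1 hw).symm
  obtain ⟨hv0, hkv⟩ := Prod.mk.inj (hL hLv)
  rw [← hkv, hv0, map_zero]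

theorem Prolongs.first_unique (h : Prolongs L Q k H k' H') (h₁ : Prolongs L Q k H₁ k₁' H₁')
    (hk : Function.Surjective (slopeMap L k)) : k₁' = k' := by
  refine ContinuousLinearMap.ext fun u => ?_
  obtain ⟨v, rfl⟩ := hk u
  rw [h₁.first, h.first]

theorem Prolongs.second_sub (h : Prolongs L Q k H k' H') (h₁ : Prolongs L Q k₁ H₁ k₁' H₁') {v : E}
    (hv : k₁ v = k v) (hbase : k₁' (Q (v, k v) (v, k v) + L (0, H₁ v v)).1
      = k' (Q (v, k v) (v, k v) + L (0, H₁ v v)).1) :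
    H₁' (slopeMap L k v) (slopeMap L k v)
      = H' (slopeMap L k v) (slopeMap L k v) + fiberMap L k' (H₁ v v - H v v) := by
  have hsecond := h.second v
  have hsecond₁ := h₁.second v
  have hsub : L (0, H₁ v v - H v v) = L (0, H₁ v v) - L (0, H v v) := by
    rw [← map_sub, Prod.mk_sub_mk, sub_zero]
  simp only [slopeMap_apply] at hsecond hsecond₁ ⊢
  rw [hv, hbase] at hsecond₁
  rw [fiberMap_apply, hsub, eq_sub_of_add_eq hsecond, eq_sub_of_add_eq hsecond₁]
  simp only [Prod.fst_add, Prod.snd_add, Prod.fst_sub, Prod.snd_sub, map_add, map_sub]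
  abel

theorem eq_zero_of_eventually_sum_sq_eq {ι : Type*} [Fintype ι] {x y : ι → ℝ} {c : ℝ}
    (h : ∀ᶠ ε in 𝓝 (0 : ℝ), ∑ i, (x i + ε * y i) ^ 2 = c) (i : ι) : y i = 0 := by
  have hneg : ∀ᶠ ε in 𝓝 (0 : ℝ), ∑ i, (x i + -ε * y i) ^ 2 = c :=
    (continuous_neg.tendsto' (0 : ℝ) 0 neg_zero).eventually h
  obtain ⟨ε, ⟨hplus, hminus⟩, hε⟩ := (((h.and hneg).filter_mono nhdsWithin_le_nhds).and
    (self_mem_nhdsWithin (s := {0}ᶜ))).exists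
  have hzero : ∑ i, x i ^ 2 = c := by simpa using h.self_of_nhds
  have hparallelogram : ∑ i, (ε * y i) ^ 2 = 0 := by
    have hsum : ∑ i, (x i + ε * y i) ^ 2 + ∑ i, (x i + -ε * y i) ^ 2
        = 2 * ∑ i, x i ^ 2 + 2 * ∑ i, (ε * y i) ^ 2 := by
      simp only [Finset.mul_sum, ← Finset.sum_add_distrib]
      exact Finset.sum_congr rfl fun _ _ => by ring
    linarith
  have hterm := (Finset.sum_eq_zero_iff_of_nonneg fun _ _ => sq_nonneg _).1 hparallelogram i
    (Finset.mem_univ i)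
  exact (mul_eq_zero.1 (pow_eq_zero_iff two_ne_zero |>.1 hterm)).resolve_left hε

end GeneralJets

/-! ### Jets of the Schrödinger equation -/

section EquationJets

variable {n : ℕ}

/-- The unit vector of the `t`-axis. -/
def et : Base n := (1, 0)

/-- The unit vector of the `x_a`-axis. -/
def ex (a : Fin n) : Base n := (0, Pi.single a 1)

/-- The coordinate `t`. -/
def timeCoord : Base n →L[ℝ] ℝ := ContinuousLinearMap.fst ℝ ℝ (Fin n → ℝ)

/-- The coordinate `x_b`. -/
def spaceCoord (b : Fin n) : Base n →L[ℝ] ℝ :=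
  (ContinuousLinearMap.proj b).comp (ContinuousLinearMap.snd ℝ ℝ (Fin n → ℝ))

@[simp] theorem timeCoord_apply (v : Base n) : timeCoord v = v.1 := rfl

@[simp] theorem spaceCoord_apply (b : Fin n) (v : Base n) : spaceCoord b v = v.2 b := rfl

theorem base_eq_sum (v : Base n) : v = v.1 • et + ∑ a, v.2 a • ex a := by
  refine Prod.ext ?_ ?_
  · simp [et, ex, Prod.fst_sum]
  · ext b
    simp [et, ex, Prod.snd_sum, Pi.single_apply]

theorem spatial_eq_sum {v : Base n} (hv : v.1 = 0) : v = ∑ a, v.2 a • ex a := by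
  conv_lhs => rw [base_eq_sum v, hv, zero_smul, zero_add]

/-- The trace of a bilinear form on the space-time over the spatial directions. -/
def spatialTrace {F : Type*} [NormedAddCommGroup F] [NormedSpace ℝ F]
    (H : Base n →L[ℝ] Base n →L[ℝ] F) : F :=
  ∑ a, H (ex a) (ex a)

theorem spatialTrace_add {F : Type*} [NormedAddCommGroup F] [NormedSpace ℝ F]
    (H H' : Base n →L[ℝ] Base n →L[ℝ] F) :
    spatialTrace (H + H') = spatialTrace H + spatialTrace H' :=
  Finset.sum_add_distrib

/-- The value of the linear operator `i ∂_t + ∂_a ∂_a` on a jet with first derivative `k` and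
second derivative `H`. -/
def jetOp (k : Base n →L[ℝ] ℂ) (H : Base n →L[ℝ] Base n →L[ℝ] ℂ) : ℂ :=
  Complex.I * k et + spatialTrace H

/-- The derivative-free part `δ w ln |w| + v w` of the equation. -/
def zeroOrder (δ v w : ℂ) : ℂ := δ * w * (Real.log ‖w‖ : ℂ) + v * w

theorem satisfiesAt_iff {δ : ℂ} {V ψ : Base n → ℂ} {p : Base n} (h : ContDiffAt ℝ 2 ψ p) :
    SatisfiesAt δ V ψ p ↔ jetOp (fderiv ℝ ψ p) (D2 ψ p) + zeroOrder δ (V p) (ψ p) = 0 := by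
  have hdx : ∀ a, dx a (dx a ψ) p = D2 ψ p (ex a) (ex a) := fun a =>
    DFunLike.congr_fun (hasFDerivAt_fderiv_apply h (ex a)).fderiv (ex a)
  simp only [SatisfiesAt, hdx, dt, jetOp, spatialTrace, zeroOrder, et, add_assoc]

/-- The complex-valued bilinear form `(u, v) ↦ h(u, v) c`. -/
def complexForm (h : Base n →L[ℝ] Base n →L[ℝ] ℝ) (c : ℂ) : Base n →L[ℝ] Base n →L[ℝ] ℂ :=
  (ContinuousLinearMap.compL ℝ (Base n) ℝ ℂ (ContinuousLinearMap.toSpanSingleton ℝ c)).comp h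

@[simp] theorem complexForm_apply (h : Base n →L[ℝ] Base n →L[ℝ] ℝ) (c : ℂ) (u v : Base n) :
    complexForm h c u v = h u v * c := by
  simp [complexForm]

theorem spatialTrace_complexForm (h : Base n →L[ℝ] Base n →L[ℝ] ℝ) (c : ℂ) :
    spatialTrace (complexForm h c) = spatialTrace h * c := by
  simp [spatialTrace, Finset.sum_mul]

theorem spatialTrace_coord_smulRight (b c : Fin n) :
    spatialTrace ((spaceCoord b).smulRight (spaceCoord c)) = if b = c then 1 else 0 := by
  simp only [spatialTrace, ContinuousLinearMap.smulRight_apply, smul_apply, spaceCoord_apply, ex,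
    Pi.single_apply, smul_eq_mul, ite_mul, one_mul, zero_mul]
  simp [eq_comm]

theorem exists_spatialTrace_eq [NeZero n] (c : ℂ) :
    ∃ H : Base n →L[ℝ] Base n →L[ℝ] ℂ, spatialTrace H = c :=
  ⟨complexForm ((spaceCoord 0).smulRight (spaceCoord 0)) c, by
    rw [spatialTrace_complexForm, spatialTrace_coord_smulRight]
    simp⟩

/-- The prolongation of a point transformation with first derivative `L` and second derivative `Q`
at a point takes the jets annihilated by `i ∂_t + ∂_a ∂_a + f` exactly to the jets annihilated by
`i ∂_t + ∂_a ∂_a + f'`: the restriction of `MapsEquation` to the fibre of the jet space over the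
point, where the derivative-free parts of the equations are constants `f` and `f'`. -/
def JetTransfer (L : Vars n →L[ℝ] Vars n) (Q : Vars n →L[ℝ] Vars n →L[ℝ] Vars n) (f f' : ℂ) :
    Prop :=
  ∀ (k : Base n →L[ℝ] ℂ) (H : Base n →L[ℝ] Base n →L[ℝ] ℂ),
    Function.Bijective (slopeMap L k) →
    ∃ (k' : Base n →L[ℝ] ℂ) (H' : Base n →L[ℝ] Base n →L[ℝ] ℂ), Prolongs L Q k H k' H' ∧
      (jetOp k H + f = 0 ↔ jetOp k' H' + f' = 0)

theorem isInvertible_of_bijective {E : Type*} [NormedAddCommGroup E] [NormedSpace ℝ E]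
    [CompleteSpace E] {A : E →L[ℝ] E} (hA : Function.Bijective A) : A.IsInvertible :=
  ⟨ContinuousLinearEquiv.ofBijective A (LinearMap.ker_eq_bot.2 hA.1)
    (LinearMap.range_eq_top.2 hA.2), ContinuousLinearEquiv.coe_ofBijective A _ _⟩

theorem MapsEquation.jetTransfer {φ : Vars n → Vars n} {U : Set (Vars n)} {δ δ' : ℂ}
    {V V' : Base n → ℂ} (h : MapsEquation φ U δ V δ' V') {z : Vars n} (hz : z ∈ U)
    (hφ : ContDiffAt ℝ ∞ φ z) :
    JetTransfer (fderiv ℝ φ z) (D2 φ z) (zeroOrder δ (V z.1) z.2)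
      (zeroOrder δ' (V' (φ z).1) (φ z).2) := by
  obtain ⟨p, w⟩ := z
  intro k H hA
  have hψ : ContDiffAt ℝ ∞ (quad p w k H) p := (contDiff_quad p w k H).contDiffAt
  have hw : quad p w k H p = w := quad_self p w k H
  have hk : fderiv ℝ (quad p w k H) p = k := fderiv_quad p w k H
  have hφ' : ContDiffAt ℝ ∞ φ (p, quad p w k H p) := by rwa [hw]
  have hdφ := hφ'.differentiableAt (by simp)
  have hdψ := hψ.differentiableAt (by simp)
  have hslope : fderiv ℝ (fun q => (φ (q, quad p w k H q)).1) p
      = slopeMap (fderiv ℝ φ (p, w)) k := by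
    refine ContinuousLinearMap.ext fun v => ?_
    rw [fderiv_comp_graph (φ := fun z => (φ z).1) hdφ.fst hdψ, hdφ.hasFDerivAt.fst.fderiv, hw, hk]
    rfl
  obtain ⟨ψ', hψ', hgraph⟩ := exists_transformed (by simp) hφ' hψ
    (hslope ▸ isInvertible_of_bijective hA)
  have hfirst := fderiv_transformed hdφ hdψ (hψ'.differentiableAt (by simp)) hgraph
  have hsecond := D2_transformed (contDiffAt_two hφ') (contDiffAt_two hψ) (contDiffAt_two hψ')
    hgraph
  have hiff := h p (quad p w k H) ψ' (by rwa [hw]) hψ hψ' hgraph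
  rw [satisfiesAt_iff (contDiffAt_two hψ), satisfiesAt_iff (contDiffAt_two hψ'),
    hgraph.self_of_nhds] at hiff
  simp only [D2_quad, hk, hw] at hfirst hsecond hiff
  refine ⟨fderiv ℝ ψ' (φ (p, w)).1, D2 ψ' (φ (p, w)).1, ⟨hfirst, hsecond⟩, ?_⟩
  simpa only [jetOp, spatialTrace, D2_quad] using hiff

variable {L : Vars n →L[ℝ] Vars n} {Q : Vars n →L[ℝ] Vars n →L[ℝ] Vars n} {f f' : ℂ}
  {k : Base n →L[ℝ] ℂ}

theorem JetTransfer.exists_solution [NeZero n] (hJ : JetTransfer L Q f f')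
    (hk : Function.Bijective (slopeMap L k)) :
    ∃ H k' H', Prolongs L Q k H k' H' ∧ jetOp k H + f = 0 ∧ jetOp k' H' + f' = 0 := by
  obtain ⟨H, hH⟩ := exists_spatialTrace_eq (n := n) (-(Complex.I * k et) - f)
  have hsol : jetOp k H + f = 0 := by
    rw [jetOp, hH]
    ring
  obtain ⟨k', H', hP, hiff⟩ := hJ k H hk
  exact ⟨H, k', H', hP, hsol, hiff.1 hsol⟩

theorem JetTransfer.spatialTrace_pullback [NeZero n] (hJ : JetTransfer L Q f f')
    (hk : Function.Bijective (slopeMap L k)) {h : Base n →L[ℝ] Base n →L[ℝ] ℝ}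
    (hh : spatialTrace h = 0) :
    spatialTrace (h.bilinearComp (slopeMap L k) (slopeMap L k)) = 0 := by
  obtain ⟨H, k', H', hP, hsol, hsol'⟩ := hJ.exists_solution hk
  set g := h.bilinearComp (slopeMap L k) (slopeMap L k) with hg
  obtain ⟨k₁', H₁', hP₁, hiff⟩ := hJ k (H + complexForm g 1) hk
  obtain rfl := hP.first_unique hP₁ hk.2
  have hH₁' : ∀ u, H₁' u u = H' u u + complexForm h (fiberMap L k₁' 1) u u := by
    intro u
    obtain ⟨v, rfl⟩ := hk.2 u
    have hvar : (H + complexForm g 1) v v - H v v = g v v • (1 : ℂ) := by simp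
    rw [hP.second_sub hP₁ rfl rfl, hvar, map_smul, complexForm_apply, Complex.real_smul]
    rfl
  have htrace' : spatialTrace H₁' = spatialTrace H' := by
    have hsum : spatialTrace H₁' = spatialTrace (H' + complexForm h (fiberMap L k₁' 1)) :=
      Finset.sum_congr rfl fun a _ => hH₁' (ex a)
    rw [hsum, spatialTrace_add, spatialTrace_complexForm, hh, Complex.ofReal_zero, zero_mul,
      add_zero]
  have hsol₁ := hiff.2 (by rwa [jetOp, htrace'])
  rw [jetOp, spatialTrace_add, spatialTrace_complexForm, mul_one] at hsol₁
  rw [jetOp] at hsol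
  exact Complex.ofReal_eq_zero.1 (by linear_combination hsol₁ - hsol)

/-- The transformed time depends on time only, to first and second order at a point. -/
structure TimeFibred (L : Vars n →L[ℝ] Vars n) (Q : Vars n →L[ℝ] Vars n →L[ℝ] Vars n) :
    Prop where
  map : ∀ u, u.1.1 = 0 → (L u).1.1 = 0
  second : ∀ u v, u.1.1 = 0 → v.1.1 = 0 → (Q u v).1.1 = 0

/- Pulling back `dt ⊗ dt`, whose spatial trace vanishes, gives a sum of squares. -/
theorem JetTransfer.slopeMap_ex_time [NeZero n] (hJ : JetTransfer L Q f f')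
    (hk : Function.Bijective (slopeMap L k)) (a : Fin n) : (slopeMap L k (ex a)).1 = 0 := by
  have htrace : spatialTrace (timeCoord.smulRight timeCoord : Base n →L[ℝ] Base n →L[ℝ] ℝ) = 0 := by
    simp [spatialTrace, ex]
  have hsum : ∑ b, (slopeMap L k (ex b)).1 * (slopeMap L k (ex b)).1 = 0 :=
    hJ.spatialTrace_pullback hk htrace
  exact mul_self_eq_zero.1 ((Finset.sum_eq_zero_iff_of_nonneg fun _ _ => mul_self_nonneg _).1
    hsum a (Finset.mem_univ a))

theorem JetTransfer.fst_time_eq_zero [NeZero n] (hJ : JetTransfer L Q f f')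
    (hL : Function.Surjective L) {u : Vars n} (hu : u.1.1 = 0) : (L u).1.1 = 0 := by
  obtain ⟨k, hk⟩ := exists_bijective_slopeMap hL
  have hfiber : ∀ w, (L (0, w)).1.1 = 0 := by
    intro w
    have hpert := (eventually_bijective_slopeMap hk ((spaceCoord 0).smulRight w)).mono
      fun ε hε => hJ.slopeMap_ex_time hε 0
    simp only [slopeMap_add_smul, Prod.fst_add, hJ.slopeMap_ex_time hk] at hpert
    refine eq_zero_of_eventually_sum_sq_eq (ι := Unit) (x := 0) (y := fun _ => (L (0, w)).1.1)
      (c := 0) (hpert.mono fun ε hε => ?_) ()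
    simpa [ex] using hε
  have hslope : (slopeMap L k u.1).1 = 0 := by
    rw [spatial_eq_sum hu, map_sum, Prod.fst_sum]
    exact Finset.sum_eq_zero fun a _ => by
      rw [map_smul, Prod.smul_fst, hJ.slopeMap_ex_time hk, smul_zero]
  rw [fst_eq_slopeMap_add k, Prod.fst_add, hslope, hfiber, add_zero]

/-- The derivative of the transformed time with respect to time. -/
def timeRate (L : Vars n →L[ℝ] Vars n) : ℝ := (L (et, 0)).1.1

theorem fst_time_eq (hL : ∀ u, u.1.1 = 0 → (L u).1.1 = 0) (u : Vars n) :
    (L u).1.1 = timeRate L * u.1.1 := by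
  have hsplit : u = u.1.1 • (et, 0) + ((0, u.1.2), u.2) := by simp [et]
  conv_lhs => rw [hsplit, map_add, map_smul]
  simp [hL, timeRate, mul_comm]

theorem timeRate_ne_zero (hL : ∀ u, u.1.1 = 0 → (L u).1.1 = 0)
    (hsurj : Function.Surjective L) : timeRate L ≠ 0 := by
  intro hzero
  obtain ⟨u, hu⟩ := hsurj (et, 0)
  have htime := fst_time_eq hL u
  rw [hu, hzero, zero_mul] at htime
  exact one_ne_zero htime

theorem exists_spatial_slopeMap_eq (hL : ∀ u, u.1.1 = 0 → (L u).1.1 = 0) (hθ : timeRate L ≠ 0)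
    (hk : Function.Surjective (slopeMap L k)) {u : Base n} (hu : u.1 = 0) :
    ∃ v : Base n, v.1 = 0 ∧ slopeMap L k v = u := by
  obtain ⟨v, rfl⟩ := hk u
  rw [slopeMap_apply, fst_time_eq hL] at hu
  exact ⟨v, (mul_eq_zero.1 hu).resolve_left hθ, rfl⟩

end EquationJets

section TimeFibredJets

variable {n : ℕ} {L : Vars n →L[ℝ] Vars n} {Q : Vars n →L[ℝ] Vars n →L[ℝ] Vars n} {f f' : ℂ}
  {k k' k₁' : Base n →L[ℝ] ℂ} {H H' H₁ H₁' : Base n →L[ℝ] Base n →L[ℝ] ℂ} {s : ℂ}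

theorem slopeMap_add_time_of_spatial {v : Base n} (hv : v.1 = 0) :
    slopeMap L (k + timeCoord.smulRight s) v = slopeMap L k v := by
  rw [slopeMap_add, ContinuousLinearMap.smulRight_apply, timeCoord_apply, hv, zero_smul,
    Prod.mk_zero_zero, map_zero, Prod.fst_zero, add_zero]

theorem bijective_slopeMap_add_time (hL : ∀ u, u.1.1 = 0 → (L u).1.1 = 0) (hθ : timeRate L ≠ 0)
    (hk : Function.Injective (slopeMap L k)) (s : ℂ) :
    Function.Bijective (slopeMap L (k + timeCoord.smulRight s)) := by
  have hinj : Function.Injective (slopeMap L (k + timeCoord.smulRight s)) := by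
    rw [injective_iff_map_eq_zero]
    intro v hv
    have hv1 : v.1 = 0 := by
      have htime := fst_time_eq hL (v, (k + timeCoord.smulRight s : Base n →L[ℝ] ℂ) v)
      rw [← slopeMap_apply, hv] at htime
      exact (mul_eq_zero.1 htime.symm).resolve_left hθ
    rw [slopeMap_add_time_of_spatial hv1] at hv
    exact (injective_iff_map_eq_zero _).1 hk v hv
  exact ⟨hinj, LinearMap.injective_iff_surjective.1 hinj⟩

theorem Prolongs.first_spatial_of_add_time (hP : Prolongs L Q k H k' H')
    (hP₁ : Prolongs L Q (k + timeCoord.smulRight s) H₁ k₁' H₁')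
    (hL : ∀ u, u.1.1 = 0 → (L u).1.1 = 0) (hθ : timeRate L ≠ 0)
    (hk : Function.Surjective (slopeMap L k)) {u : Base n} (hu : u.1 = 0) : k₁' u = k' u := by
  obtain ⟨v, hv, rfl⟩ := exists_spatial_slopeMap_eq hL hθ hk hu
  have hfirst₁ := hP₁.first v
  rw [slopeMap_add_time_of_spatial hv] at hfirst₁
  rw [hfirst₁, hP.first]
  simp [hv]

theorem Prolongs.first_et_of_add_time (hP : Prolongs L Q k H k' H')
    (hP₁ : Prolongs L Q (k + timeCoord.smulRight s) H₁ k₁' H₁')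
    (hL : ∀ u, u.1.1 = 0 → (L u).1.1 = 0) (hθ : timeRate L ≠ 0)
    (hk : Function.Surjective (slopeMap L k)) :
    k₁' et = k' et + fiberMap L k' s / timeRate L := by
  have hspatial : ∀ u : Base n, u.1 = 0 → k₁' u = k' u := fun u hu =>
    hP.first_spatial_of_add_time hP₁ hL hθ hk hu
  have hgraph : ((et, (k + timeCoord.smulRight s : Base n →L[ℝ] ℂ) et) : Vars n)
      = (et, k et) + (0, s) := by
    simp [et]
  have hslope : (L (et, k et)).1 = timeRate L • et + (0, (L (et, k et)).1.2) :=
    Prod.ext (by simpa [et] using fst_time_eq hL (et, k et)) (by simp [et])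
  have hfirst := hP.first et
  have hfirst₁ := hP₁.first et
  rw [slopeMap_apply, hgraph, map_add, Prod.fst_add, map_add, hspatial (L (0, s)).1 (hL _ rfl),
    hslope, map_add, map_smul, hspatial (0, _) rfl, Complex.real_smul, Prod.snd_add] at hfirst₁
  rw [slopeMap_apply, hslope, map_add, map_smul, Complex.real_smul] at hfirst
  have hθ' : (timeRate L : ℂ) ≠ 0 := Complex.ofReal_ne_zero.2 hθ
  rw [fiberMap_apply]
  field_simp
  linear_combination hfirst₁ - hfirst

theorem Prolongs.second_spatial_of_add_time (hP : Prolongs L Q k H k' H')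
    (hP₁ : Prolongs L Q (k + timeCoord.smulRight s) H₁ k₁' H₁') (hT : TimeFibred L Q)
    (hθ : timeRate L ≠ 0) (hk : Function.Surjective (slopeMap L k)) {v : Base n} (hv : v.1 = 0) :
    H₁' (slopeMap L k v) (slopeMap L k v)
      = H' (slopeMap L k v) (slopeMap L k v) + fiberMap L k' (H₁ v v - H v v) :=
  hP.second_sub hP₁ (by simp [hv]) (hP.first_spatial_of_add_time hP₁ hT.map hθ hk
    (by simp [hT.second (v, k v) (v, k v) hv hv, hT.map]))

/- Compare the given jet with the jet obtained by adding `s` to its time derivative and the pullback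
of `h` times `d` to its second derivative. -/
theorem JetTransfer.variation_iff [NeZero n] (hJ : JetTransfer L Q f f')
    (hL : Function.Bijective L) (hT : TimeFibred L Q) (hk : Function.Bijective (slopeMap L k)) :
    ∃ k' : Base n →L[ℝ] ℂ, Function.Injective (fiberMap L k') ∧
      ∀ (h : Base n →L[ℝ] Base n →L[ℝ] ℝ) (s d : ℂ),
        Complex.I * s + spatialTrace (h.bilinearComp (slopeMap L k) (slopeMap L k)) * d = 0 ↔
          Complex.I * (fiberMap L k' s / timeRate L) + spatialTrace h * fiberMap L k' d = 0 := by
  have hθ := timeRate_ne_zero hT.map hL.2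
  obtain ⟨H, k', H', hP, hsol, hsol'⟩ := hJ.exists_solution hk
  refine ⟨k', fiberMap_injective hL.1 hk.2 hP.first, fun h s d => ?_⟩
  set g := h.bilinearComp (slopeMap L k) (slopeMap L k) with hg
  obtain ⟨k₁', H₁', hP₁, hiff⟩ := hJ (k + timeCoord.smulRight s) (H + complexForm g d)
    (bijective_slopeMap_add_time hT.map hθ hk.1 s)
  have hH₁' : ∀ u : Base n, u.1 = 0 → H₁' u u = (H' + complexForm h (fiberMap L k' d)) u u := by
    intro u hu
    obtain ⟨v, hv, rfl⟩ := exists_spatial_slopeMap_eq hT.map hθ hk.2 hu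
    have hvar : (H + complexForm g d) v v - H v v = g v v • d := by simp
    rw [hP.second_spatial_of_add_time hP₁ hT hθ hk.2 hv, hvar, map_smul, add_apply, add_apply,
      complexForm_apply, Complex.real_smul]
    rfl
  have htrace' : spatialTrace H₁' = spatialTrace H' + spatialTrace h * fiberMap L k' d := by
    rw [← spatialTrace_complexForm, ← spatialTrace_add]
    exact Finset.sum_congr rfl fun a _ => hH₁' (ex a) rfl
  have hsource : jetOp (k + timeCoord.smulRight s) (H + complexForm g d) + f
      = Complex.I * s + spatialTrace g * d := by
    have hk₁ : (k + timeCoord.smulRight s : Base n →L[ℝ] ℂ) et = k et + s := by simp [et]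
    rw [jetOp] at hsol
    rw [jetOp, hk₁, spatialTrace_add, spatialTrace_complexForm]
    linear_combination hsol
  have htarget : jetOp k₁' H₁' + f'
      = Complex.I * (fiberMap L k' s / timeRate L) + spatialTrace h * fiberMap L k' d := by
    rw [jetOp] at hsol'
    rw [jetOp, htrace', hP.first_et_of_add_time hP₁ hT.map hθ hk.2]
    linear_combination hsol'
  rwa [hsource, htarget] at hiff

theorem spatialTrace_coord_pullback (A : Base n →L[ℝ] Base n) (b c : Fin n) :
    spatialTrace (((spaceCoord b).smulRight (spaceCoord c)).bilinearComp A A)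
      = ∑ a, (A (ex a)).2 b * (A (ex a)).2 c := by
  simp [spatialTrace]

/- Applying the hypothesis twice gives `θ² = μ²`. -/
theorem eq_abs_of_map_I_mul {M : ℂ →L[ℝ] ℂ} {θ μ : ℝ} (hM : M 1 ≠ 0) (hμ : 0 ≤ μ)
    (h : ∀ d, θ * (Complex.I * M d) = μ * M (Complex.I * d)) : μ = |θ| := by
  have hsq : ((θ : ℂ) ^ 2 - (μ : ℂ) ^ 2) * M 1 = 0 := by
    have honce := h 1
    have htwice := h (Complex.I * 1)
    rw [← mul_assoc Complex.I Complex.I 1, Complex.I_mul_I, neg_one_mul, map_neg] at htwice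
    linear_combination -μ * htwice - θ * Complex.I * honce + θ ^ 2 * M 1 * Complex.I_sq
  have hsq' : θ ^ 2 = μ ^ 2 := by
    exact_mod_cast sub_eq_zero.1 ((mul_eq_zero.1 hsq).resolve_right hM)
  rw [← abs_of_nonneg hμ]
  exact ((sq_eq_sq_iff_abs_eq_abs _ _).1 hsq').symm

theorem JetTransfer.slopeMap_orthogonal_and_fiberMap_I_mul [NeZero n] (hJ : JetTransfer L Q f f')
    (hL : Function.Bijective L) (hT : TimeFibred L Q) (hk : Function.Bijective (slopeMap L k)) :
    (∀ b c, ∑ a, (slopeMap L k (ex a)).2 b * (slopeMap L k (ex a)).2 c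
      = if b = c then |timeRate L| else 0) ∧
    ∃ k' : Base n →L[ℝ] ℂ, ∀ s, fiberMap L k' (Complex.I * s)
      = (SignType.sign (timeRate L) : ℝ) * (Complex.I * fiberMap L k' s) := by
  have hθ := timeRate_ne_zero hT.map hL.2
  have hθ' : (timeRate L : ℂ) ≠ 0 := Complex.ofReal_ne_zero.2 hθ
  obtain ⟨k', hM, hiff⟩ := hJ.variation_iff hL hT hk
  set A := slopeMap L k
  set M := fiberMap L k'
  set μ : Fin n → Fin n → ℝ := fun b c => ∑ a, (A (ex a)).2 b * (A (ex a)).2 c with hμ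
  have hcoord : ∀ b c s d, Complex.I * s + μ b c * d = 0 ↔
      Complex.I * (M s / timeRate L) + (if b = c then 1 else 0 : ℝ) * M d = 0 := by
    intro b c s d
    simp only [hμ]
    rw [← spatialTrace_coord_pullback, hiff, spatialTrace_coord_smulRight]
  have hM1 : M 1 ≠ 0 := fun hzero => one_ne_zero (hM (hzero.trans (map_zero M).symm))
  have hscale : ∀ b d, timeRate L * (Complex.I * M d) = μ b b * M (Complex.I * d) := by
    intro b d
    have hvar := (hcoord b b (Complex.I * (μ b b * d)) d).1 (by
      linear_combination μ b b * d * Complex.I_sq)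
    have hreal : M (Complex.I * (μ b b * d)) = μ b b * M (Complex.I * d) := by
      rw [← Complex.real_smul, ← Complex.real_smul, ← map_smul, mul_smul_comm]
    rw [hreal, if_pos rfl, Complex.ofReal_one, one_mul] at hvar
    field_simp at hvar
    linear_combination Complex.I * hvar - μ b b * M (Complex.I * d) * Complex.I_sq
  have hdiag : ∀ b, μ b b = |timeRate L| := fun b =>
    eq_abs_of_map_I_mul hM1 (Finset.sum_nonneg fun _ _ => mul_self_nonneg _) (hscale b)
  refine ⟨fun b c => ?_, k', fun s => ?_⟩
  · split_ifs with hbc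
    · rw [← hbc]
      exact hdiag b
    · have hoff := (hcoord b c 0 1).2 (by simp [hbc])
      exact_mod_cast show (μ b c : ℂ) = 0 by simpa using hoff
  · refine mul_left_cancel₀ (Complex.ofReal_ne_zero.2 (abs_ne_zero.2 hθ)) ?_
    have hsign : ((SignType.sign (timeRate L) : ℝ) : ℂ) * |timeRate L| = timeRate L := by
      exact_mod_cast sign_mul_abs (timeRate L)
    rw [← hdiag 0, ← hscale, hdiag]
    linear_combination -(Complex.I * M s) * hsign

/- The spatial block of the slope map has Hilbert–Schmidt norm independent of the slope, while a
dependence on `w` would make it quadratic in the slope. -/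
theorem JetTransfer.fst_fiber_eq_zero [NeZero n] (hJ : JetTransfer L Q f f')
    (hL : Function.Bijective L) (hT : TimeFibred L Q) (w : ℂ) : (L (0, w)).1 = 0 := by
  obtain ⟨k, hk⟩ := exists_bijective_slopeMap hL.2
  refine Prod.ext (hT.map _ rfl) (funext fun b => ?_)
  set l : Base n →L[ℝ] ℂ := (spaceCoord 0).smulRight w
  have hnorm : ∀ᶠ ε in 𝓝 (0 : ℝ),
      ∑ a, ((slopeMap L k (ex a)).2 b + ε * (L (0, l (ex a))).1.2 b) ^ 2 = |timeRate L| := by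
    filter_upwards [eventually_bijective_slopeMap hk l] with ε hε
    have horth := (hJ.slopeMap_orthogonal_and_fiberMap_I_mul hL hT hε).1 b b
    simp only [slopeMap_add_smul, if_true, ← sq] at horth
    simpa using horth
  simpa [l, ex] using eq_zero_of_eventually_sum_sq_eq hnorm 0

end TimeFibredJets

section ReducedJets

variable {n : ℕ} {L : Vars n →L[ℝ] Vars n} {Q : Vars n →L[ℝ] Vars n →L[ℝ] Vars n} {f f' : ℂ}
  {k k' : Base n →L[ℝ] ℂ} {H H' : Base n →L[ℝ] Base n →L[ℝ] ℂ}

/-- The 2-jet `(L, Q)` of a point transformation is fibre-preserving, with transformed time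
depending on time only, spatial part a multiple of an orthogonal matrix, and complex linear or
antilinear in the dependent variable according to the sign of the time rate. -/
structure Reduced (L : Vars n →L[ℝ] Vars n) (Q : Vars n →L[ℝ] Vars n →L[ℝ] Vars n) : Prop
    extends TimeFibred L Q where
  base : ∀ w, (L (0, w)).1 = 0
  rate : timeRate L ≠ 0
  orth : ∀ b c, ∑ a, (L (ex a, 0)).1.2 b * (L (ex a, 0)).1.2 c = if b = c then |timeRate L| else 0
  conj : ∀ s, (L (0, Complex.I * s)).2
    = (SignType.sign (timeRate L) : ℝ) * (Complex.I * (L (0, s)).2)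
  base_second : ∀ u w, (Q u (0, w)).1 = 0
  symm : ∀ u v, Q u v = Q v u

/-- The coefficients of the first-order terms that arise in the transformed equation. -/
def drift (L : Vars n →L[ℝ] Vars n) (Q : Vars n →L[ℝ] Vars n →L[ℝ] Vars n) (a : Fin n) : ℂ :=
  (∑ b, ((L (ex a, 0)).1.2 b : ℂ) * (Complex.I * (SignType.sign (timeRate L) : ℝ)
    * ((L (et, 0)).1.2 b : ℂ) + ((∑ c, Q (ex c, 0) (ex c, 0)).1.2 b : ℂ))) / (|timeRate L| : ℝ)

/-- The difference between the transformed equation and the image of the original one, as a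
function of the values `κ` of the derivatives `ψ_a`. -/
def defect (L : Vars n →L[ℝ] Vars n) (Q : Vars n →L[ℝ] Vars n →L[ℝ] Vars n) (f f' : ℂ)
    (κ : Fin n → ℂ) : ℂ :=
  Complex.I * (SignType.sign (timeRate L) : ℝ) * (L (et, 0)).2
    - ∑ a, drift L Q a * ((L (ex a, 0)).2 + (L (0, κ a)).2) - (L (0, f)).2
    + ∑ a, (Q (ex a, κ a) (ex a, κ a)).2 + (|timeRate L| : ℝ) * f'

theorem map_eq_add_fiber (L : Vars n →L[ℝ] Vars n) (v : Base n) (w : ℂ) :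
    L (v, w) = L (v, 0) + L (0, w) := by
  rw [← map_add]
  simp

theorem map_fiber_add (L : Vars n →L[ℝ] Vars n) (w w' : ℂ) :
    L (0, w + w') = L (0, w) + L (0, w') := by
  rw [← map_add]
  simp

theorem map_fiber_sum (L : Vars n →L[ℝ] Vars n) {ι : Type*} (s : Finset ι) (w : ι → ℂ) :
    L (0, ∑ i ∈ s, w i) = ∑ i ∈ s, L (0, w i) :=
  map_sum (L.comp (ContinuousLinearMap.inr ℝ (Base n) ℂ)) w s

theorem map_fiber_zero (L : Vars n →L[ℝ] Vars n) : L (0, 0) = 0 := map_zero L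

theorem Reduced.fst_apply (h : Reduced L Q) (v : Base n) (w : ℂ) :
    (L (v, w)).1 = (L (v, 0)).1 := by
  rw [map_eq_add_fiber, Prod.fst_add, h.base, add_zero]

theorem Reduced.second_fst (h : Reduced L Q) (a : Fin n) (w : ℂ) :
    (Q (ex a, w) (ex a, w)).1 = (Q (ex a, 0) (ex a, 0)).1 := by
  have hsplit : ((ex a, w) : Vars n) = (ex a, 0) + (0, w) := by simp
  rw [hsplit]
  simp only [map_add, add_apply, Prod.fst_add, h.base_second, h.symm (0, w) (ex a, 0), add_zero]

theorem Reduced.slopeMap_bijective (h : Reduced L Q) (hL : Function.Surjective L)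
    (k : Base n →L[ℝ] ℂ) : Function.Bijective (slopeMap L k) := by
  obtain ⟨k₀, hk₀⟩ := exists_bijective_slopeMap hL
  have hslope : slopeMap L k = slopeMap L k₀ := ContinuousLinearMap.ext fun v => by
    rw [slopeMap_apply, slopeMap_apply, h.fst_apply, h.fst_apply _ (k₀ v)]
  rwa [hslope]

theorem Reduced.rate_smul_spatial (h : Reduced L Q) (y : Fin n → ℝ) :
    |timeRate L| • ((0, y) : Base n)
      = ∑ a, (∑ b, (L (ex a, 0)).1.2 b * y b) • (L (ex a, 0)).1 := by
  refine Prod.ext ?_ (funext fun c => ?_)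
  · simpa [Prod.fst_sum] using (Finset.sum_eq_zero fun a _ => by
      rw [h.map (ex a, 0) rfl, mul_zero]).symm
  · have horth : ∀ b, ∑ a, (L (ex a, 0)).1.2 b * y b * (L (ex a, 0)).1.2 c
        = y b * if b = c then |timeRate L| else 0 := by
      intro b
      rw [← h.orth, Finset.mul_sum]
      exact Finset.sum_congr rfl fun a _ => by ring
    simp only [Prod.snd_sum, Prod.smul_snd, Finset.sum_apply, Pi.smul_apply, smul_eq_mul,
      Finset.sum_mul]
    rw [Finset.sum_comm, Finset.sum_congr rfl fun b _ => horth b]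
    simp [mul_comm]

theorem Reduced.first_spatial (h : Reduced L Q) (hP : Prolongs L Q k H k' H') (y : Fin n → ℝ) :
    (|timeRate L| : ℝ) * k' (0, y) = ∑ a, (∑ b, (L (ex a, 0)).1.2 b * y b : ℝ)
      * ((L (ex a, 0)).2 + (L (0, k (ex a))).2) := by
  rw [← Complex.real_smul, ← map_smul, h.rate_smul_spatial, map_sum]
  refine Finset.sum_congr rfl fun a _ => ?_
  rw [map_smul, Complex.real_smul, ← h.fst_apply _ (k (ex a)), ← slopeMap_apply, hP.first,
    ← Prod.snd_add, ← map_eq_add_fiber]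

theorem Reduced.first_et (h : Reduced L Q) (hP : Prolongs L Q k H k' H') :
    timeRate L * k' et + k' (0, (L (et, 0)).1.2) = (L (et, 0)).2 + (L (0, k et)).2 := by
  have hslope : slopeMap L k et = timeRate L • et + (0, (L (et, 0)).1.2) := by
    rw [slopeMap_apply, h.fst_apply]
    exact Prod.ext (by simp [timeRate, et]) (by simp [et])
  have hfirst := hP.first et
  rwa [hslope, map_add, map_smul, Complex.real_smul, map_eq_add_fiber L et (k et),
    Prod.snd_add] at hfirst

theorem Reduced.spatialTrace_pullback (h : Reduced L Q) (H : Base n →L[ℝ] Base n →L[ℝ] ℂ) :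
    ∑ a, H (L (ex a, 0)).1 (L (ex a, 0)).1 = (|timeRate L| : ℝ) * spatialTrace H := by
  have hexpand : ∀ a, H (L (ex a, 0)).1 (L (ex a, 0)).1 = ∑ b, ∑ c,
      ((L (ex a, 0)).1.2 b * (L (ex a, 0)).1.2 c : ℝ) * H (ex b) (ex c) := by
    intro a
    conv_lhs => rw [spatial_eq_sum (h.map (ex a, 0) rfl)]
    simp only [map_sum, map_smul, sum_apply, smul_apply, Complex.real_smul, Finset.mul_sum,
      Complex.ofReal_mul, mul_assoc]
    rw [Finset.sum_comm]
    exact Finset.sum_congr rfl fun b _ => Finset.sum_congr rfl fun c _ => by ring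
  simp only [hexpand]
  rw [Finset.sum_comm, spatialTrace, Finset.mul_sum]
  refine Finset.sum_congr rfl fun b _ => ?_
  rw [Finset.sum_comm]
  simp only [← Finset.sum_mul, ← Complex.ofReal_sum, h.orth]
  simp [apply_ite ((↑) : ℝ → ℂ)]

theorem Reduced.spatialTrace_second (h : Reduced L Q) (hP : Prolongs L Q k H k' H') :
    (|timeRate L| : ℝ) * spatialTrace H' + k' (0, (∑ c, Q (ex c, 0) (ex c, 0)).1.2)
      = ∑ a, (Q (ex a, k (ex a)) (ex a, k (ex a))).2 + (L (0, spatialTrace H)).2 := by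
  have hdir : ∀ a, H' (L (ex a, 0)).1 (L (ex a, 0)).1 + k' (Q (ex a, 0) (ex a, 0)).1
      = (Q (ex a, k (ex a)) (ex a, k (ex a))).2 + (L (0, H (ex a) (ex a))).2 := by
    intro a
    have hsecond := hP.second (ex a)
    rwa [slopeMap_apply, h.fst_apply, Prod.fst_add, Prod.snd_add, h.second_fst, h.base,
      add_zero] at hsecond
  have hspatial : ((0, (∑ c, Q (ex c, 0) (ex c, 0)).1.2) : Base n)
      = ∑ c, (Q (ex c, 0) (ex c, 0)).1 := by
    rw [← Prod.fst_sum]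
    refine Prod.ext ?_ rfl
    rw [Prod.fst_sum, Prod.fst_sum]
    exact (Finset.sum_eq_zero fun c _ => h.second _ _ rfl rfl).symm
  rw [hspatial, map_sum, ← h.spatialTrace_pullback, ← Finset.sum_add_distrib,
    Finset.sum_congr rfl fun a _ => hdir a, Finset.sum_add_distrib, spatialTrace, map_fiber_sum,
    Prod.snd_sum]

theorem Reduced.sum_drift (h : Reduced L Q) (hP : Prolongs L Q k H k' H') :
    ∑ a, drift L Q a * ((L (ex a, 0)).2 + (L (0, k (ex a))).2)
      = Complex.I * (SignType.sign (timeRate L) : ℝ) * k' (0, (L (et, 0)).1.2)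
        + k' (0, (∑ c, Q (ex c, 0) (ex c, 0)).1.2) := by
  have hρ : ((|timeRate L| : ℝ) : ℂ) ≠ 0 := Complex.ofReal_ne_zero.2 (abs_ne_zero.2 h.rate)
  refine mul_left_cancel₀ hρ ?_
  rw [mul_add, mul_left_comm, h.first_spatial hP, h.first_spatial hP, Finset.mul_sum,
    Finset.mul_sum, ← Finset.sum_add_distrib]
  refine Finset.sum_congr rfl fun a _ => ?_
  rw [← mul_assoc, drift, mul_div_cancel₀ _ hρ, ← mul_assoc, ← add_mul]
  congr 1
  push_cast
  rw [Finset.mul_sum, ← Finset.sum_add_distrib]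
  exact Finset.sum_congr rfl fun b _ => by ring

theorem Reduced.jetOp_eq (h : Reduced L Q) (hP : Prolongs L Q k H k' H') (f f' : ℂ) :
    (|timeRate L| : ℝ) * (jetOp k' H' + f')
      = (L (0, jetOp k H + f)).2 + defect L Q f f' fun a => k (ex a) := by
  have hsign : ((|timeRate L| : ℝ) : ℂ) = (SignType.sign (timeRate L) : ℝ) * (timeRate L : ℂ) := by
    exact_mod_cast (sign_mul_self (timeRate L)).symm
  simp only [jetOp, map_fiber_add, Prod.snd_add, defect, h.sum_drift hP, h.conj]
  linear_combination Complex.I * k' et * hsign + h.spatialTrace_second hP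
    + Complex.I * (SignType.sign (timeRate L) : ℝ) * h.first_et hP

theorem JetTransfer.defect_eq_zero [NeZero n] (hJ : JetTransfer L Q f f')
    (hL : Function.Surjective L) (h : Reduced L Q) (κ : Fin n → ℂ) : defect L Q f f' κ = 0 := by
  set k : Base n →L[ℝ] ℂ := ∑ a, (spaceCoord a).smulRight (κ a) with hk
  have hκ : (fun a => k (ex a)) = κ := funext fun a => by simp [hk, ex, Pi.single_apply]
  obtain ⟨H, k', H', hP, hsol, hsol'⟩ := hJ.exists_solution (h.slopeMap_bijective hL k)
  have hjet := h.jetOp_eq hP f f'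
  rwa [hsol, hsol', map_fiber_zero, mul_zero, Prod.snd_zero, zero_add, hκ, eq_comm] at hjet

theorem Reduced.defect_expand (h : Reduced L Q) (κ : Fin n → ℂ) :
    defect L Q f f' κ = defect L Q f f' 0
      + ∑ a, (2 * (Q (ex a, 0) (0, κ a)).2 - drift L Q a * (L (0, κ a)).2)
      + ∑ a, (Q (0, κ a) (0, κ a)).2 := by
  have hexpand : ∀ a, (Q (ex a, κ a) (ex a, κ a)).2 = (Q (ex a, 0) (ex a, 0)).2
      + 2 * (Q (ex a, 0) (0, κ a)).2 + (Q (0, κ a) (0, κ a)).2 := by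
    intro a
    have hsplit : ((ex a, κ a) : Vars n) = (ex a, 0) + (0, κ a) := by simp
    rw [hsplit]
    simp only [map_add, add_apply, Prod.snd_add, h.symm (0, κ a) (ex a, 0)]
    ring
  simp only [defect, hexpand, Pi.zero_apply, map_fiber_zero, Prod.snd_zero, mul_add, add_zero,
    Finset.sum_add_distrib, Finset.sum_sub_distrib]
  ring

/-- The determining equations for the transformed dependent variable: the coefficients of the
powers of `ψ_a` in the transformed equation. -/
structure Determining (L : Vars n →L[ℝ] Vars n) (Q : Vars n →L[ℝ] Vars n →L[ℝ] Vars n)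
    (f f' : ℂ) : Prop where
  quadratic : ∀ w, (Q (0, w) (0, w)).2 = 0
  linear : ∀ a w, 2 * (Q (ex a, 0) (0, w)).2 = drift L Q a * (L (0, w)).2
  free : defect L Q f f' 0 = 0

theorem Reduced.defect_eq_zero (h : Reduced L Q) (hd : Determining L Q f f') (κ : Fin n → ℂ) :
    defect L Q f f' κ = 0 := by
  rw [h.defect_expand, hd.free]
  simp [hd.linear, hd.quadratic]

/- Even and odd parts of the defect in `κ` vanish separately. -/
theorem Reduced.determining [NeZero n] (h : Reduced L Q) (hd : ∀ κ, defect L Q f f' κ = 0) :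
    Determining L Q f f' := by
  have hsingle : ∀ (b : Fin n) (w : ℂ),
      (2 * (Q (ex b, 0) (0, w)).2 - drift L Q b * (L (0, w)).2) + (Q (0, w) (0, w)).2 = 0 := by
    intro b w
    have hexpand := h.defect_expand (f := f) (f' := f') (Pi.single b w)
    rw [hd, hd, zero_add, Finset.sum_eq_single b, Finset.sum_eq_single b] at hexpand
    · simpa using hexpand.symm
    all_goals simp +contextual [← Prod.zero_eq_mk]
  have hquadratic : ∀ w : ℂ, (Q (0, w) (0, w)).2 = 0 := by
    intro w
    have hneg : ((0, -w) : Vars n) = -(0, w) := by simp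
    have hodd := hsingle 0 (-w)
    rw [hneg] at hodd
    simp only [map_neg, neg_apply, Prod.snd_neg, neg_neg] at hodd
    linear_combination (hsingle 0 w + hodd) / 2
  exact ⟨hquadratic, fun a w => by linear_combination hsingle a w - hquadratic w, hd 0⟩

end ReducedJets

/-! ### Fibrewise behaviour in `ψ` -/

section Fibers

variable {F G : Type*} [NormedAddCommGroup F] [NormedSpace ℝ F] [NormedAddCommGroup G]
  [NormedSpace ℝ G]

theorem tendsto_fiber_line {E : Type*} [TopologicalSpace E] (z : E × F) (h : F) :
    Filter.Tendsto (fun s : ℝ => ((z.1, z.2 + s • h) : E × F)) (𝓝 0) (𝓝 z) :=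
  (by fun_prop : Continuous _).tendsto' _ _ (by simp)

theorem eventually_eq_of_hasFDerivAt_fiber_zero {E : Type*} [PseudoMetricSpace E] {φ : E × F → G}
    {z : E × F}
    (h : ∀ᶠ y in 𝓝 z, HasFDerivAt (fun w => φ (y.1, w)) (0 : F →L[ℝ] G) y.2) :
    ∀ᶠ y in 𝓝 z, φ y = φ (y.1, z.2) := by
  obtain ⟨r, hr, hball⟩ := Metric.eventually_nhds_iff_ball.1 h
  filter_upwards [Metric.ball_mem_nhds z hr] with y hy
  rw [← ball_prod_same] at hball hy
  have hderiv : ∀ w ∈ Metric.ball z.2 r, HasFDerivAt (fun w => φ (y.1, w)) (0 : F →L[ℝ] G) w :=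
    fun w hw => hball (y.1, w) ⟨hy.1, hw⟩
  exact Metric.isOpen_ball.is_const_of_fderiv_eq_zero (convex_ball z.2 r).isPreconnected
    (fun w hw => (hderiv w hw).differentiableAt.differentiableWithinAt)
    (fun w hw => (hderiv w hw).fderiv) hy.2 (Metric.mem_ball_self hr)
variable {E : Type*} [NormedAddCommGroup E] [NormedSpace ℝ E] {φ : E × F → G} {z : E × F}

theorem hasFDerivAt_fiber {q : E} {w : F} (hφ : DifferentiableAt ℝ φ (q, w)) :
    HasFDerivAt (fun w' => φ (q, w'))
      ((fderiv ℝ φ (q, w)).comp (ContinuousLinearMap.inr ℝ E F)) w :=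
  hφ.hasFDerivAt.comp w (hasFDerivAt_prodMk_right q w)

theorem fderiv_base {q : E} {w : F} (hφ : DifferentiableAt ℝ φ (q, w)) (v : E) :
    fderiv ℝ (fun q' => φ (q', w)) q v = fderiv ℝ φ (q, w) (v, 0) := by
  simpa using fderiv_comp_graph (ψ := fun _ => w) hφ (differentiableAt_const w) v

theorem D2_base {q : E} {w : F} (hφ : ContDiffAt ℝ 2 φ (q, w)) (v : E) :
    D2 (fun q' => φ (q', w)) q v v = D2 φ (q, w) (v, 0) (v, 0) := by
  have hzero : fderiv ℝ (fun _ : E => w) = fun _ => 0 := funext fun _ => fderiv_const_apply w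
  simpa [D2, hzero, ← Prod.zero_eq_mk]
    using D2_comp_graph (ψ := fun _ => w) hφ contDiffAt_const v

theorem D2_add_smul {f g : E → G} {p : E} (hf : ContDiffAt ℝ 2 f p) (hg : ContDiffAt ℝ 2 g p)
    (s : ℝ) (u v : E) :
    D2 (fun q => f q + s • g q) p u v = D2 f p u v + s • D2 g p u v := by
  have hsum := D2_clm_apply
    (ContinuousLinearMap.fst ℝ G G + s • ContinuousLinearMap.snd ℝ G G) (hf.prodMk hg) u v
  rwa [D2_prodMk hf hg] at hsum

theorem eventually_fderiv_fiber_eq (hφ : ContDiffAt ℝ 2 φ z)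
    (h : ∀ᶠ y in 𝓝 z, ∀ u v, D2 φ y (0, u) (0, v) = 0) :
    ∀ᶠ y in 𝓝 z, ∀ u, fderiv ℝ φ y (0, u) = fderiv ℝ φ (y.1, z.2) (0, u) := by
  refine (eventually_eq_of_hasFDerivAt_fiber_zero
    (φ := fun y => (fderiv ℝ φ y).comp (ContinuousLinearMap.inr ℝ E F)) ?_).mono
    fun y hy u => DFunLike.congr_fun hy u
  filter_upwards [h, hφ.eventually (by simp)] with y hy hφy
  have hderiv := hasFDerivAt_fiber (hasFDerivAt_fderiv hφy).differentiableAt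
  refine (hderiv.clm_comp (hasFDerivAt_const (ContinuousLinearMap.inr ℝ E F) y.2)).congr_fderiv ?_
  ext u v
  simpa using hy u v

theorem eventually_eq_add_fderiv_fiber (hφ : ContDiffAt ℝ 2 φ z)
    (h : ∀ᶠ y in 𝓝 z, ∀ u v, D2 φ y (0, u) (0, v) = 0) :
    ∀ᶠ y in 𝓝 z, φ y = φ (y.1, z.2) + fderiv ℝ φ (y.1, z.2) (0, y.2 - z.2) := by
  have hconst := eventually_eq_of_hasFDerivAt_fiber_zero (z := z)
    (φ := fun y => φ y - fderiv ℝ φ (y.1, z.2) (0, y.2)) <| by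
      filter_upwards [eventually_fderiv_fiber_eq hφ h,
        eventually_differentiableAt (hφ.of_le one_le_two)] with y hy hφy
      refine ((hasFDerivAt_fiber hφy).sub
        ((fderiv ℝ φ (y.1, z.2)).comp (ContinuousLinearMap.inr ℝ E F)).hasFDerivAt).congr_fderiv ?_
      ext u
      simpa [sub_eq_zero] using hy u
  filter_upwards [hconst] with y hy
  have hsub : ((0, y.2 - z.2) : E × F) = (0, y.2) - (0, z.2) := by simp
  rw [hsub, map_sub]
  rw [sub_eq_iff_eq_add.1 hy]
  abel

/-- The derivative of `φ` in the direction `h` of the fibre, along the section with value `w`. -/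
def fiberSlope (φ : E × F → G) (w h : F) (q : E) : G := fderiv ℝ φ (q, w) (0, h)

theorem contDiffAt_fiberSlope (hφ : ContDiffAt ℝ ∞ φ z) (h : F) :
    ContDiffAt ℝ ∞ (fiberSlope φ z.2 h) z.1 :=
  ((hφ.fderiv_right (m := ∞) le_rfl).comp z.1 (contDiffAt_id.prodMk contDiffAt_const)).clm_apply
    contDiffAt_const

theorem eventually_eq_add_smul_fiberSlope (hφ : ContDiffAt ℝ 2 φ z)
    (hquad : ∀ᶠ y in 𝓝 z, ∀ u v, D2 φ y (0, u) (0, v) = 0) (h : F) :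
    ∀ᶠ s : ℝ in 𝓝 0, (fun q => φ (q, z.2 + s • h))
      =ᶠ[𝓝 z.1] fun q => φ (q, z.2) + s • fiberSlope φ z.2 h q := by
  filter_upwards [(tendsto_fiber_line z h).eventually
    (eventually_eq_add_fderiv_fiber hφ hquad).eventually_nhds]
    with s hs
  have hslice : Filter.Tendsto (fun q => ((q, z.2 + s • h) : E × F)) (𝓝 z.1)
      (𝓝 (z.1, z.2 + s • h)) := (by fun_prop : Continuous _).tendsto' _ _ rfl
  filter_upwards [hslice.eventually hs] with q hq
  have hsmul : ((0, z.2 + s • h - z.2) : E × F) = s • (0, h) := by simp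
  rw [hq, hsmul, map_smul, fiberSlope]

theorem eventually_fderiv_base_eq (hφ : ContDiffAt ℝ ∞ φ z)
    (hquad : ∀ᶠ y in 𝓝 z, ∀ u v, D2 φ y (0, u) (0, v) = 0) (h : F) :
    ∀ᶠ s : ℝ in 𝓝 0, ∀ v, fderiv ℝ φ (z.1, z.2 + s • h) (v, 0)
      = fderiv ℝ φ z (v, 0) + s • fderiv ℝ (fiberSlope φ z.2 h) z.1 v := by
  filter_upwards [eventually_eq_add_smul_fiberSlope (contDiffAt_two hφ) hquad h,
    (tendsto_fiber_line z h).eventually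
      (eventually_differentiableAt ((contDiffAt_two hφ).of_le one_le_two))] with s hs hφs v
  have hbase : HasFDerivAt (fun q => φ (q, z.2)) _ z.1 :=
    (hφ.differentiableAt (by simp)).hasFDerivAt.comp z.1 (hasFDerivAt_prodMk_left z.1 z.2)
  have hslope := ((contDiffAt_fiberSlope hφ h).differentiableAt (by simp)).hasFDerivAt
  rw [← fderiv_base hφs, hs.fderiv_eq, (hbase.fun_add (hslope.fun_const_smul s)).fderiv]
  simp

theorem eventually_D2_base_eq (hφ : ContDiffAt ℝ ∞ φ z)
    (hquad : ∀ᶠ y in 𝓝 z, ∀ u v, D2 φ y (0, u) (0, v) = 0) (h : F) :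
    ∀ᶠ s : ℝ in 𝓝 0, ∀ v, D2 φ (z.1, z.2 + s • h) (v, 0) (v, 0)
      = D2 φ z (v, 0) (v, 0) + s • D2 (fiberSlope φ z.2 h) z.1 v v := by
  filter_upwards [eventually_eq_add_smul_fiberSlope (contDiffAt_two hφ) hquad h,
    (tendsto_fiber_line z h).eventually ((contDiffAt_two hφ).eventually (by simp))] with s hs hφs v
  have hbase : ContDiffAt ℝ 2 (fun q => φ (q, z.2)) z.1 :=
    (contDiffAt_two hφ).comp z.1 (contDiffAt_id.prodMk contDiffAt_const)
  rw [← D2_base hφs, D2, hs.fderiv.fderiv_eq]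
  exact (D2_add_smul hbase (contDiffAt_two (contDiffAt_fiberSlope hφ h)) s v v).trans
    (by rw [D2_base (contDiffAt_two hφ)])

end Fibers

section PointTransformations

variable {n : ℕ} {φ : Vars n → Vars n} {U : Set (Vars n)} {δ δ' : ℂ} {V V' : Base n → ℂ}
  {z : Vars n}

theorem IsDiffeoOn.bijective {E : Type*} [NormedAddCommGroup E] [NormedSpace ℝ E] {f : E → E}
    {U : Set E} (hf : IsDiffeoOn f U) {z : E} (hz : z ∈ U) :
    Function.Bijective (fderiv ℝ f z) := by
  obtain ⟨e, he⟩ := hf.2.2.2 z hz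
  exact he ▸ e.bijective

theorem IsDiffeoOn.contDiffAt {E : Type*} [NormedAddCommGroup E] [NormedSpace ℝ E] {f : E → E}
    {U : Set E} (hf : IsDiffeoOn f U) {z : E} (hz : z ∈ U) : ContDiffAt ℝ ∞ f z :=
  hf.2.1.contDiffAt (hf.1.mem_nhds hz)

theorem clm_D2_apply_eq_zero {E F G : Type*} [NormedAddCommGroup E] [NormedSpace ℝ E]
    [NormedAddCommGroup F] [NormedSpace ℝ F] [NormedAddCommGroup G] [NormedSpace ℝ G]
    {f : E → F} {p : E} (hf : ContDiffAt ℝ 2 f p) (l : F →L[ℝ] G) (k : G) {c : E}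
    (h : ∀ᶠ q in 𝓝 p, l (fderiv ℝ f q c) = k) (u : E) : l (D2 f p u c) = 0 := by
  have hderiv : HasFDerivAt (fun q => l (fderiv ℝ f q c)) _ p :=
    l.hasFDerivAt.comp p (hasFDerivAt_fderiv_apply hf c)
  exact DFunLike.congr_fun (hderiv.unique ((hasFDerivAt_const k p).congr_of_eventuallyEq h)) u

theorem MapsEquation.timeFibred [NeZero n] (h : MapsEquation φ U δ V δ' V')
    (hφ : IsDiffeoOn φ U) (hz : z ∈ U) : TimeFibred (fderiv ℝ φ z) (D2 φ z) where
  map _ hu := (h.jetTransfer hz (hφ.contDiffAt hz)).fst_time_eq_zero (hφ.bijective hz).2 hu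
  second u v _ hv := clm_D2_apply_eq_zero (contDiffAt_two (hφ.contDiffAt hz))
    (timeCoord.comp (ContinuousLinearMap.fst ℝ (Base n) ℂ)) 0 (by
      filter_upwards [hφ.1.mem_nhds hz] with y hy
      exact (h.jetTransfer hy (hφ.contDiffAt hy)).fst_time_eq_zero (hφ.bijective hy).2 hv) u

theorem MapsEquation.fst_fiber_eq_zero [NeZero n] (h : MapsEquation φ U δ V δ' V')
    (hφ : IsDiffeoOn φ U) (hz : z ∈ U) (w : ℂ) : (fderiv ℝ φ z (0, w)).1 = 0 :=
  (h.jetTransfer hz (hφ.contDiffAt hz)).fst_fiber_eq_zero (hφ.bijective hz)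
    (h.timeFibred hφ hz) w

theorem MapsEquation.reduced [NeZero n] (h : MapsEquation φ U δ V δ' V')
    (hφ : IsDiffeoOn φ U) (hz : z ∈ U) : Reduced (fderiv ℝ φ z) (D2 φ z) := by
  have hT := h.timeFibred hφ hz
  have hbase := h.fst_fiber_eq_zero hφ hz
  obtain ⟨k, hk⟩ := exists_bijective_slopeMap (hφ.bijective hz).2
  obtain ⟨horth, k', hconj⟩ := (h.jetTransfer hz
    (hφ.contDiffAt hz)).slopeMap_orthogonal_and_fiberMap_I_mul (hφ.bijective hz) hT hk
  have hslope : ∀ v, slopeMap (fderiv ℝ φ z) k v = (fderiv ℝ φ z (v, 0)).1 := fun v => by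
    rw [slopeMap_apply, map_eq_add_fiber, Prod.fst_add, hbase, add_zero]
  have hfiber : ∀ w, fiberMap (fderiv ℝ φ z) k' w = (fderiv ℝ φ z (0, w)).2 := fun w => by
    rw [fiberMap_apply, hbase, map_zero, sub_zero]
  simp only [hslope] at horth
  simp only [hfiber] at hconj
  exact {
    toTimeFibred := hT
    base := hbase
    rate := timeRate_ne_zero hT.map (hφ.bijective hz).2
    orth := horth
    conj := hconj
    base_second := fun u w => clm_D2_apply_eq_zero (contDiffAt_two (hφ.contDiffAt hz))
      (ContinuousLinearMap.fst ℝ (Base n) ℂ) 0 (by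
        filter_upwards [hφ.1.mem_nhds hz] with y hy using h.fst_fiber_eq_zero hφ hy w) u
    symm := D2_comm (contDiffAt_two (hφ.contDiffAt hz)) }

theorem MapsEquation.determining [NeZero n] (h : MapsEquation φ U δ V δ' V')
    (hφ : IsDiffeoOn φ U) (hz : z ∈ U) :
    Determining (fderiv ℝ φ z) (D2 φ z) (zeroOrder δ (V z.1) z.2)
      (zeroOrder δ' (V' (φ z).1) (φ z).2) :=
  (h.reduced hφ hz).determining ((h.jetTransfer hz (hφ.contDiffAt hz)).defect_eq_zero
    (hφ.bijective hz).2 (h.reduced hφ hz))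

theorem MapsEquation.second_fiber_eq_zero [NeZero n] (h : MapsEquation φ U δ V δ' V')
    (hφ : IsDiffeoOn φ U) (hz : z ∈ U) (u v : ℂ) : D2 φ z (0, u) (0, v) = 0 := by
  have hsq : ∀ w, D2 φ z (0, w) (0, w) = 0 := fun w =>
    Prod.ext ((h.reduced hφ hz).base_second _ w) ((h.determining hφ hz).quadratic w)
  have hsplit : ((0, u + v) : Vars n) = (0, u) + (0, v) := by simp
  have hpolar := hsq (u + v)
  rw [hsplit] at hpolar
  simp only [map_add, add_apply, hsq, zero_add, add_zero,
    (h.reduced hφ hz).symm (0, v) (0, u)] at hpolar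
  exact self_eq_neg.1 (eq_neg_of_add_eq_zero_left hpolar)

end PointTransformations

section LogarithmOnLines

theorem hasDerivAt_add_smul (u h : ℂ) (s : ℝ) : HasDerivAt (fun s : ℝ => u + s • h) h s := by
  simpa using ((hasDerivAt_id s).smul_const h).const_add u

theorem hasDerivAt_log_norm_add_smul {u h : ℂ} {s : ℝ} (hs : u + s • h ≠ 0) :
    HasDerivAt (fun s : ℝ => Real.log ‖u + s • h‖) (h / (u + s • h)).re s := by
  have hlog : (fun s : ℝ => Real.log ‖u + s • h‖) = fun s : ℝ => Real.log (‖u + s • h‖ ^ 2) / 2 :=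
    funext fun s => by simp
  have hinner : inner ℝ (u + s • h) h / ‖u + s • h‖ ^ 2 = (h / (u + s • h)).re := by
    rw [Complex.inner, Complex.div_re, ← Complex.normSq_eq_norm_sq, ← add_div]
    simp only [Complex.mul_re, Complex.conj_re, Complex.conj_im]
    ring
  rw [hlog, ← hinner]
  exact (((hasDerivAt_add_smul u h s).norm_sq.log (by simpa using hs)).div_const 2).congr_deriv
    (by ring)

theorem hasDerivAt_mul_log_norm_add_smul {u h : ℂ} {s : ℝ} (hs : u + s • h ≠ 0) :
    HasDerivAt (fun s : ℝ => (u + s • h) * (Real.log ‖u + s • h‖ : ℂ))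
      (h * (Real.log ‖u + s • h‖ : ℂ) + (u + s • h) * ((h / (u + s • h)).re : ℂ)) s :=
  (hasDerivAt_add_smul u h s).mul (hasDerivAt_log_norm_add_smul hs).ofReal_comp

/-- The second derivative of `w ↦ w ln |w|` at `u` in the direction `h`. -/
def logSecond (u h : ℂ) : ℂ := 2 * h * ((h / u).re : ℂ) - u * (((h / u) ^ 2).re : ℂ)

theorem hasDerivAt_deriv_mul_log_norm {u : ℂ} (hu : u ≠ 0) (h : ℂ) :
    HasDerivAt (fun s : ℝ => h * (Real.log ‖u + s • h‖ : ℂ)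
      + (u + s • h) * ((h / (u + s • h)).re : ℂ)) (logSecond u h) 0 := by
  have hu0 : u + (0 : ℝ) • h ≠ 0 := by simpa using hu
  have hline := hasDerivAt_add_smul u h 0
  have hratio : HasDerivAt (fun s : ℝ => (h / (u + s • h)).re) (-((h / u) ^ 2)).re 0 := by
    refine (Complex.reCLM.hasFDerivAt.comp_hasDerivAt (0 : ℝ)
      ((hasDerivAt_const (0 : ℝ) h).div hline hu0)).congr_deriv ?_
    have hneg : (0 * (u + (0 : ℝ) • h) - h * h) / (u + (0 : ℝ) • h) ^ 2 = -((h / u) ^ 2) := by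
      simp [sq, neg_div, div_mul_div_comm]
    rw [hneg, Complex.reCLM_apply]
  refine (((hasDerivAt_log_norm_add_smul hu0).ofReal_comp.const_mul h).add
    (hline.mul hratio.ofReal_comp)).congr_deriv ?_
  simp only [logSecond, zero_smul, add_zero, Complex.neg_re, Complex.ofReal_neg]
  ring

theorem logSecond_add_logSecond_I_mul {u : ℂ} (hu : u ≠ 0) (h : ℂ) {ε : ℝ} (hε : ε * ε = 1) :
    logSecond u h + logSecond u (ε * (Complex.I * h)) = 2 * h * (starRingEnd ℂ) (h / u) := by
  obtain ⟨c, rfl⟩ : ∃ c, h = c * u := ⟨h / u, (div_mul_cancel₀ h hu).symm⟩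
  have hdiv : ε * (Complex.I * (c * u)) / u = ε * (Complex.I * c) := by field_simp
  have hre : (ε * (Complex.I * c)).re = -(ε * c.im) := by simp
  have hsq : (ε * (Complex.I * c)) ^ 2 = -c ^ 2 := by
    rw [mul_pow, mul_pow, Complex.I_sq, sq (ε : ℂ), ← Complex.ofReal_mul, hε]
    simp
  have hconj : (starRingEnd ℂ) c = c.re - c.im * Complex.I := by
    apply Complex.ext <;> simp
  have hεc : (ε * ε : ℂ) = 1 := by exact_mod_cast hε
  rw [logSecond, logSecond, hdiv, mul_div_cancel_right₀ c hu, hre, hsq, hconj,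
    Complex.neg_re]
  push_cast
  linear_combination (-2 * Complex.I * c * u * c.im) * hεc

theorem eq_zero_of_eventually_affine {E : Type*} [NormedAddCommGroup E] [NormedSpace ℝ E]
    {F F' : ℝ → E} {c c₀ c₁ : E} (hF : ∀ᶠ s in 𝓝 0, HasDerivAt F (F' s) s)
    (hF' : HasDerivAt F' c 0) (h : ∀ᶠ s in 𝓝 0, F s = c₀ + s • c₁) : c = 0 := by
  refine hF'.unique ((hasDerivAt_const (0 : ℝ) c₁).congr_of_eventuallyEq ?_)
  filter_upwards [hF, h.eventually_nhds] with s hs haffine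
  have hderiv : HasDerivAt (fun s : ℝ => c₀ + s • c₁) c₁ s := by
    simpa using ((hasDerivAt_id s).smul_const c₁).const_add c₀
  exact hs.unique (hderiv.congr_of_eventuallyEq haffine)

/- The second derivative along the line of the function assumed affine is computed termwise. -/
theorem logSecond_of_eventually_affine {ℓ : ℂ →L[ℝ] ℂ} {u h u' h' m c₀ c₁ : ℂ} (hu : u ≠ 0)
    (hu' : u' ≠ 0)
    (haff : ∀ᶠ s : ℝ in 𝓝 0, ℓ ((u + s • h) * (Real.log ‖u + s • h‖ : ℂ))
      - m * ((u' + s • h') * (Real.log ‖u' + s • h'‖ : ℂ)) = c₀ + s • c₁) :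
    ℓ (logSecond u h) = m * logSecond u' h' := by
  have hne : ∀ {a b : ℂ}, a ≠ 0 → ∀ᶠ s : ℝ in 𝓝 0, a + s • b ≠ 0 := fun {a b} ha =>
    (hasDerivAt_add_smul a b 0).continuousAt.eventually_ne (by simpa using ha)
  refine sub_eq_zero.1 (eq_zero_of_eventually_affine ?_
    ((ℓ.hasFDerivAt.comp_hasDerivAt _ (hasDerivAt_deriv_mul_log_norm hu _)).sub
      ((hasDerivAt_deriv_mul_log_norm hu' _).const_mul m)) haff)
  filter_upwards [hne hu, hne hu'] with s hs hs'
  exact (ℓ.hasFDerivAt.comp_hasDerivAt s (hasDerivAt_mul_log_norm_add_smul hs)).sub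
    ((hasDerivAt_mul_log_norm_add_smul hs').const_mul m)

end LogarithmOnLines

section FiberVariation

variable {n : ℕ} {L L' : Vars n →L[ℝ] Vars n} {Q Q' : Vars n →L[ℝ] Vars n →L[ℝ] Vars n}
  {φ : Vars n → Vars n} {U : Set (Vars n)} {δ δ' : ℂ} {V V' : Base n → ℂ} {z : Vars n}

theorem drift_congr (hL : ∀ v, (L' (v, 0)).1 = (L (v, 0)).1)
    (hQ : ∀ v, (Q' (v, 0) (v, 0)).1 = (Q (v, 0) (v, 0)).1) (a : Fin n) :
    drift L' Q' a = drift L Q a := by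
  simp only [drift, timeRate, hL, Prod.fst_sum, hQ]

theorem defect_zero_of_variation {M N : Base n → Vars n} {s : ℝ} (hM : ∀ v, (M v).1 = 0)
    (hN : ∀ v, (N v).1 = 0) (hL : ∀ v, L' (v, 0) = L (v, 0) + s • M v)
    (hfiber : ∀ w, L' (0, w) = L (0, w))
    (hQ : ∀ v, Q' (v, 0) (v, 0) = Q (v, 0) (v, 0) + s • N v) (f f' : ℂ) :
    defect L' Q' f f' 0 = defect L Q 0 0 0
      + s • (Complex.I * (SignType.sign (timeRate L) : ℝ) * (M et).2
        - ∑ a, drift L Q a * (M (ex a)).2 + ∑ a, (N (ex a)).2)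
      - ((L (0, f)).2 - (|timeRate L| : ℝ) * f') := by
  have hLfst : ∀ v, (L' (v, 0)).1 = (L (v, 0)).1 := fun v => by simp [hL, hM]
  have hQfst : ∀ v, (Q' (v, 0) (v, 0)).1 = (Q (v, 0) (v, 0)).1 := fun v => by simp [hQ, hN]
  have hrate : timeRate L' = timeRate L := by rw [timeRate, hLfst, timeRate]
  simp only [defect, Pi.zero_apply, map_fiber_zero]
  simp only [drift_congr hLfst hQfst, hrate, hL, hfiber, hQ, Prod.snd_add,
    Prod.smul_snd, Prod.snd_zero, add_zero, mul_add, mul_zero,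
    Finset.sum_add_distrib, smul_add, smul_sub, Finset.smul_sum, sub_zero, mul_smul_comm]
  ring

theorem MapsEquation.eventually_fst_fiberSlope_eq_zero [NeZero n] (h : MapsEquation φ U δ V δ' V')
    (hφ : IsDiffeoOn φ U) (hz : z ∈ U) (c : ℂ) :
    (fun q => (fiberSlope φ z.2 c q).1) =ᶠ[𝓝 z.1] fun _ => 0 := by
  have hslice : Filter.Tendsto (fun q => ((q, z.2) : Vars n)) (𝓝 z.1) (𝓝 z) :=
    (by fun_prop : Continuous _).tendsto' _ _ rfl
  filter_upwards [hslice.eventually (hφ.1.mem_nhds hz)] with q hq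
    using h.fst_fiber_eq_zero hφ hq c

theorem MapsEquation.fst_fderiv_fiberSlope [NeZero n] (h : MapsEquation φ U δ V δ' V')
    (hφ : IsDiffeoOn φ U) (hz : z ∈ U) (c : ℂ) (v : Base n) :
    (fderiv ℝ (fiberSlope φ z.2 c) z.1 v).1 = 0 := by
  have hslope := ((contDiffAt_fiberSlope (hφ.contDiffAt hz) c).differentiableAt
    (by simp)).hasFDerivAt.fst
  have hconst := (hasFDerivAt_const (𝕜 := ℝ) (0 : Base n) z.1).congr_of_eventuallyEq
    (h.eventually_fst_fiberSlope_eq_zero hφ hz c)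
  exact DFunLike.congr_fun (hslope.unique hconst) v

theorem MapsEquation.fst_D2_fiberSlope [NeZero n] (h : MapsEquation φ U δ V δ' V')
    (hφ : IsDiffeoOn φ U) (hz : z ∈ U) (c : ℂ) (v : Base n) :
    (D2 (fiberSlope φ z.2 c) z.1 v v).1 = 0 := by
  have hfst := D2_clm_apply (ContinuousLinearMap.fst ℝ (Base n) ℂ)
    (contDiffAt_two (contDiffAt_fiberSlope (hφ.contDiffAt hz) c)) v v
  have hzero : fderiv ℝ (fun _ : Base n => (0 : Base n)) = fun _ => 0 :=
    funext fun _ => fderiv_const_apply 0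
  rw [ContinuousLinearMap.coe_fst'] at hfst
  rw [← hfst, D2, (h.eventually_fst_fiberSlope_eq_zero hφ hz c).fderiv.fderiv_eq, hzero,
    fderiv_const_apply]
  rfl

theorem MapsEquation.eventually_second_fiber_eq_zero [NeZero n] (h : MapsEquation φ U δ V δ' V')
    (hφ : IsDiffeoOn φ U) (hz : z ∈ U) :
    ∀ᶠ y in 𝓝 z, ∀ u v, D2 φ y (0, u) (0, v) = 0 := by
  filter_upwards [hφ.1.mem_nhds hz] with y hy using h.second_fiber_eq_zero hφ hy

theorem MapsEquation.eventually_eq_fiber_line [NeZero n] (h : MapsEquation φ U δ V δ' V')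
    (hφ : IsDiffeoOn φ U) (hz : z ∈ U) (c : ℂ) :
    ∀ᶠ s : ℝ in 𝓝 0, φ (z.1, z.2 + s • c) = φ z + s • (0, (fderiv ℝ φ z (0, c)).2) := by
  filter_upwards [eventually_eq_add_smul_fiberSlope (contDiffAt_two (hφ.contDiffAt hz))
    (h.eventually_second_fiber_eq_zero hφ hz) c] with s hs
  refine hs.self_of_nhds.trans (congrArg (φ z + s • ·) ?_)
  exact Prod.ext (h.fst_fiber_eq_zero hφ hz c) rfl

theorem MapsEquation.eventually_fderiv_fiber_line [NeZero n] (h : MapsEquation φ U δ V δ' V')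
    (hφ : IsDiffeoOn φ U) (hz : z ∈ U) (c : ℂ) :
    ∀ᶠ s : ℝ in 𝓝 0, ∀ w, fderiv ℝ φ (z.1, z.2 + s • c) (0, w) = fderiv ℝ φ z (0, w) :=
  (tendsto_fiber_line z c).eventually (eventually_fderiv_fiber_eq
    (contDiffAt_two (hφ.contDiffAt hz)) (h.eventually_second_fiber_eq_zero hφ hz))

/- Along a line in the fibre the free determining equation is affine up to its logarithmic terms. -/
theorem MapsEquation.eventually_log_affine [NeZero n] (h : MapsEquation φ U δ V δ' V')
    (hφ : IsDiffeoOn φ U) (hz : z ∈ U) (c : ℂ) : ∃ c₀ c₁ : ℂ, ∀ᶠ s : ℝ in 𝓝 0,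
      (fderiv ℝ φ z (0, δ * ((z.2 + s • c) * (Real.log ‖z.2 + s • c‖ : ℂ)))).2
        - (|timeRate (fderiv ℝ φ z)| : ℝ) * δ' * (((φ z).2 + s • (fderiv ℝ φ z (0, c)).2)
          * (Real.log ‖(φ z).2 + s • (fderiv ℝ φ z (0, c)).2‖ : ℂ)) = c₀ + s • c₁ := by
  have hquad := h.eventually_second_fiber_eq_zero hφ hz
  set L := fderiv ℝ φ z with hL
  set b := Complex.I * (SignType.sign (timeRate L) : ℝ)
      * (fderiv ℝ (fiberSlope φ z.2 c) z.1 et).2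
    - ∑ a, drift L (D2 φ z) a * (fderiv ℝ (fiberSlope φ z.2 c) z.1 (ex a)).2
    + ∑ a, (D2 (fiberSlope φ z.2 c) z.1 (ex a) (ex a)).2 with hb
  refine ⟨defect L (D2 φ z) 0 0 0 - (L (0, V z.1 * z.2)).2
      + (|timeRate L| : ℝ) * V' (φ z).1 * (φ z).2,
    b - (L (0, V z.1 * c)).2 + (|timeRate L| : ℝ) * V' (φ z).1 * (L (0, c)).2, ?_⟩
  filter_upwards [h.eventually_eq_fiber_line hφ hz c, h.eventually_fderiv_fiber_line hφ hz c,
    eventually_fderiv_base_eq (hφ.contDiffAt hz) hquad c,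
    eventually_D2_base_eq (hφ.contDiffAt hz) hquad c,
    (tendsto_fiber_line z c).eventually (hφ.1.mem_nhds hz)] with s hvalue hfiber hbase hsecond hmem
  have hfree := (h.determining hφ hmem).free
  rw [defect_zero_of_variation (h.fst_fderiv_fiberSlope hφ hz c) (h.fst_D2_fiberSlope hφ hz c)
    hbase hfiber hsecond, hvalue, ← hL, ← hb] at hfree
  have hsmul : L (0, s • (V z.1 * c)) = s • L (0, V z.1 * c) := by
    rw [← map_smul]
    simp
  simp only [zeroOrder, Prod.fst_add, Prod.snd_add, Prod.smul_fst, Prod.smul_snd, smul_zero,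
    add_zero, mul_add (V z.1), mul_smul_comm, map_fiber_add, hsmul] at hfree ⊢
  simp only [Complex.real_smul, mul_assoc] at hfree ⊢
  linear_combination -hfree

end FiberVariation

section Conjugation

/-- The map `β ↦ β̂` as an automorphism of the real algebra of complex numbers. -/
def hatAlg (s : ℝ) : ℂ ≃ₐ[ℝ] ℂ := if 0 < s then AlgEquiv.refl else Complex.conjAe

/-- The map `β ↦ β̂` as a continuous real-linear automorphism. -/
def hatCLE (s : ℝ) : ℂ ≃L[ℝ] ℂ := (hatAlg s).toLinearEquiv.toContinuousLinearEquiv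

theorem hatAlg_apply (s : ℝ) (β : ℂ) : hatAlg s β = hat s β := by
  unfold hatAlg hat
  split_ifs <;> rfl

@[simp] theorem hatCLE_apply (s : ℝ) (β : ℂ) : hatCLE s β = hat s β := hatAlg_apply s β

theorem hat_add (s : ℝ) (β γ : ℂ) : hat s (β + γ) = hat s β + hat s γ := by
  simp only [← hatAlg_apply, map_add]

theorem hat_zero (s : ℝ) : hat s 0 = 0 := by
  rw [← hatCLE_apply, map_zero]

theorem hat_mul (s : ℝ) (β γ : ℂ) : hat s (β * γ) = hat s β * hat s γ := by
  simp only [← hatAlg_apply, map_mul]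

theorem hat_ofReal (s r : ℝ) : hat s (r : ℂ) = r := by
  rw [← hatAlg_apply]
  exact (hatAlg s).commutes r

theorem hat_ne_zero {s : ℝ} {β : ℂ} (hβ : β ≠ 0) : hat s β ≠ 0 := by
  rw [← hatAlg_apply]
  exact (map_ne_zero (hatAlg s)).2 hβ

theorem hat_I {s : ℝ} (hs : s ≠ 0) :
    hat s Complex.I = (SignType.sign s : ℝ) * Complex.I := by
  rcases lt_or_gt_of_ne hs with hneg | hpos
  · simp [hat, hneg.not_gt, sign_neg hneg]
  · simp [hat, hpos, sign_pos hpos]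

end Conjugation

section Homogeneity

variable {n : ℕ} {L : Vars n →L[ℝ] Vars n} {Q : Vars n →L[ℝ] Vars n →L[ℝ] Vars n}
  {φ : Vars n → Vars n} {U : Set (Vars n)} {δ δ' : ℂ} {V V' : Base n → ℂ} {z : Vars n}

theorem sign_mul_sign {s : ℝ} (hs : s ≠ 0) :
    (SignType.sign s : ℝ) * (SignType.sign s : ℝ) = 1 := by
  rcases lt_or_gt_of_ne hs with hneg | hpos
  · simp [sign_neg hneg]
  · simp [sign_pos hpos]

theorem Reduced.fiber_apply (h : Reduced L Q) (c : ℂ) :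
    (L (0, c)).2 = (L (0, 1)).2 * hat (timeRate L) c := by
  have hreal : ∀ r : ℝ, (L (0, (r : ℂ))).2 = r * (L (0, 1)).2 := fun r => by
    have hsmul : ((0, (r : ℂ)) : Vars n) = r • (0, 1) := by simp
    rw [hsmul, map_smul, Prod.smul_snd, Complex.real_smul]
  have hsplit : c = c.re + Complex.I * c.im := by rw [mul_comm, Complex.re_add_im]
  conv_lhs => rw [hsplit, map_fiber_add, Prod.snd_add, h.conj, hreal, hreal]
  conv_rhs => rw [hsplit, hat_add, hat_mul, hat_ofReal, hat_ofReal, hat_I h.rate]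
  ring

theorem Reduced.fiber_mul (h : Reduced L Q) (c w : ℂ) :
    (L (0, c * w)).2 = hat (timeRate L) c * (L (0, w)).2 := by
  rw [h.fiber_apply, hat_mul, h.fiber_apply w]
  ring

theorem Reduced.fiber_ne_zero (h : Reduced L Q) (hL : Function.Injective L) {w : ℂ}
    (hw : w ≠ 0) : (L (0, w)).2 ≠ 0 := fun hzero =>
  hw (congrArg Prod.snd (hL ((Prod.ext (h.base w) hzero).trans (map_zero L).symm)))

theorem MapsEquation.fiber_logSecond [NeZero n] (h : MapsEquation φ U δ V δ' V')
    (hφ : IsPointTransformation φ U) (hz : z ∈ U) (c : ℂ) :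
    hat (timeRate (fderiv ℝ φ z)) δ * (fderiv ℝ φ z (0, logSecond z.2 c)).2
      = (|timeRate (fderiv ℝ φ z)| : ℝ) * δ'
        * logSecond (φ z).2 (fderiv ℝ φ z (0, c)).2 := by
  obtain ⟨c₀, c₁, haff⟩ := h.eventually_log_affine hφ.1 hz c
  rw [← (h.reduced hφ.1 hz).fiber_mul]
  exact logSecond_of_eventually_affine (ℓ := (ContinuousLinearMap.snd ℝ (Base n) ℂ).comp
      ((fderiv ℝ φ z).comp ((ContinuousLinearMap.inr ℝ (Base n) ℂ).comp
        (ContinuousLinearMap.mul ℝ ℂ δ))))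
    (hφ.2.1 hz) (hφ.2.2 hz) haff

theorem MapsEquation.hat_delta_eq_mul_conj [NeZero n] (h : MapsEquation φ U δ V δ' V')
    (hφ : IsPointTransformation φ U) (hz : z ∈ U) :
    hat (timeRate (fderiv ℝ φ z)) δ = (|timeRate (fderiv ℝ φ z)| : ℝ) * δ'
      * (starRingEnd ℂ) ((fderiv ℝ φ z (0, z.2)).2 / (φ z).2) := by
  have hL := h.reduced hφ.1 hz
  have hne := hL.fiber_ne_zero (hφ.1.bijective hz).1 (hφ.2.1 hz)
  have hw := h.fiber_logSecond hφ hz z.2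
  have hIw := h.fiber_logSecond hφ hz (Complex.I * z.2)
  rw [hL.conj] at hIw
  have hsource := logSecond_add_logSecond_I_mul (hφ.2.1 hz) z.2 (one_mul 1)
  have htarget := logSecond_add_logSecond_I_mul (hφ.2.2 hz) (fderiv ℝ φ z (0, z.2)).2
    (sign_mul_sign hL.rate)
  rw [div_self (hφ.2.1 hz), map_one, mul_one, Complex.ofReal_one, one_mul, two_mul] at hsource
  have hsum := congrArg (fun c => (fderiv ℝ φ z (0, c)).2) hsource
  simp only [map_fiber_add, Prod.snd_add] at hsum
  refine mul_right_cancel₀ hne ?_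
  linear_combination (hw + hIw + (|timeRate (fderiv ℝ φ z)| : ℝ) * δ' * htarget
    - hat (timeRate (fderiv ℝ φ z)) δ * hsum) / 2

/- The logarithmic derivative of `φ` along the fibre is constant along the fibre, while `φ` is
affine there, hence linear. -/
theorem MapsEquation.snd_eq_fiber [NeZero n] (h : MapsEquation φ U δ V δ' V')
    (hφ : IsPointTransformation φ U) (hδ : δ ≠ 0) (hz : z ∈ U) :
    (φ z).2 = (fderiv ℝ φ z (0, z.2)).2 := by
  have hnear := (h.eventually_eq_fiber_line hφ.1 hz z.2).and
    ((h.eventually_fderiv_fiber_line hφ.1 hz z.2).and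
      ((eventually_fderiv_base_eq (hφ.1.contDiffAt hz)
        (h.eventually_second_fiber_eq_zero hφ.1 hz) z.2).and
        ((tendsto_fiber_line z z.2).eventually (hφ.1.1.mem_nhds hz))))
  obtain ⟨s, ⟨hvalue, hfiber, hbase, hmem⟩, hs⟩ :=
    ((hnear.filter_mono nhdsWithin_le_nhds).and (self_mem_nhdsWithin (s := {(0 : ℝ)}ᶜ))).exists
  have hrate : timeRate (fderiv ℝ φ (z.1, z.2 + s • z.2)) = timeRate (fderiv ℝ φ z) := by
    rw [timeRate, hbase, timeRate, Prod.fst_add, Prod.smul_fst, h.fst_fderiv_fiberSlope hφ.1 hz,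
      smul_zero, add_zero]
  have hsource := h.hat_delta_eq_mul_conj hφ hz
  have hshift := h.hat_delta_eq_mul_conj hφ hmem
  have hΨ := hφ.2.2 hz
  have hΨs := hφ.2.2 hmem
  have hη := (h.reduced hφ.1 hz).fiber_ne_zero (hφ.1.bijective hz).1 (hφ.2.1 hz)
  have hsmul : ((0, z.2 + s • z.2) : Vars n) = (1 + s) • (0, z.2) := by simp [add_smul]
  rw [hrate, hfiber, hsmul, map_smul, hvalue, hsource] at hshift
  have hcoeff := left_ne_zero_of_mul (hsource ▸ hat_ne_zero hδ)
  have hratio := (starRingEnd ℂ).injective (mul_left_cancel₀ hcoeff hshift)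
  rw [hvalue] at hΨs
  simp only [regular, Set.mem_ofPred_eq, Prod.snd_add, Prod.smul_snd, Complex.real_smul]
    at hratio hΨ hΨs
  rw [div_eq_div_iff hΨ hΨs] at hratio
  have hsη : (s : ℂ) * (fderiv ℝ φ z (0, z.2)).2 ≠ 0 :=
    mul_ne_zero (Complex.ofReal_ne_zero.2 hs) hη
  refine mul_left_cancel₀ hsη ?_
  push_cast at hratio
  linear_combination -hratio

theorem MapsEquation.hat_delta_eq [NeZero n] (h : MapsEquation φ U δ V δ' V')
    (hφ : IsPointTransformation φ U) (hδ : δ ≠ 0) (hz : z ∈ U) :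
    hat (timeRate (fderiv ℝ φ z)) δ = (|timeRate (fderiv ℝ φ z)| : ℝ) * δ' := by
  rw [h.hat_delta_eq_mul_conj hφ hz, ← h.snd_eq_fiber hφ hδ hz, div_self (hφ.2.2 hz), map_one,
    mul_one]

end Homogeneity

/-! ### Rigidity of the spatial part -/

open scoped Matrix

section DotProductCalculus

/-- The Euclidean scalar product, as a continuous bilinear map. -/
def dotCLM (n : ℕ) : (Fin n → ℝ) →L[ℝ] (Fin n → ℝ) →L[ℝ] ℝ :=
  (dotProductBilin ℝ ℝ).toContinuousBilinearMap

variable {n : ℕ} {E : Type*} [NormedAddCommGroup E] [NormedSpace ℝ E]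

@[simp] theorem dotCLM_apply (x y : Fin n → ℝ) : dotCLM n x y = x ⬝ᵥ y := rfl

theorem hasFDerivAt_dotProduct {f g : E → Fin n → ℝ} {f' g' : E →L[ℝ] Fin n → ℝ} {p : E}
    (hf : HasFDerivAt f f' p) (hg : HasFDerivAt g g' p) :
    HasFDerivAt (fun q => f q ⬝ᵥ g q)
      ((dotCLM n (f p)).comp g' + ((dotCLM n).flip (g p)).comp f') p :=
  (((dotCLM n).hasFDerivAt.comp p hf).clm_apply hg).congr_fderiv <| by
    ext
    simp

end DotProductCalculus

section Similitude

variable {n : ℕ} {A : Matrix (Fin n) (Fin n) ℝ} {c : ℝ}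

theorem transpose_mul_of_mul_transpose (hc : c ≠ 0) (hA : A * Aᵀ = c • 1) : Aᵀ * A = c • 1 := by
  have hinv : A * (c⁻¹ • Aᵀ) = 1 := by
    rw [Matrix.mul_smul, hA, smul_smul, inv_mul_cancel₀ hc, one_smul]
  have hinv' := mul_eq_one_comm.1 hinv
  rw [Matrix.smul_mul, inv_smul_eq_iff₀ hc] at hinv'
  exact hinv'

theorem eq_zero_of_transpose_mulVec (hc : c ≠ 0) (hA : A * Aᵀ = c • 1) {y : Fin n → ℝ}
    (hy : Aᵀ *ᵥ y = 0) : y = 0 := by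
  have happly := congrArg (A *ᵥ ·) hy
  simpa [Matrix.mulVec_mulVec, hA, Matrix.smul_mulVec, hc] using happly

end Similitude

section SpatialJacobian

variable {n : ℕ} {L : Vars n →L[ℝ] Vars n} {Q : Vars n →L[ℝ] Vars n →L[ℝ] Vars n}

/-- The derivative of the transformed `x` with respect to `x`. -/
def spatialJacobian (L : Vars n →L[ℝ] Vars n) : Matrix (Fin n) (Fin n) ℝ :=
  Matrix.of fun b a => (L (ex a, 0)).1.2 b

theorem transpose_spatialJacobian_mulVec (y : Fin n → ℝ) (a : Fin n) :
    ((spatialJacobian L)ᵀ *ᵥ y) a = (L (ex a, 0)).1.2 ⬝ᵥ y := rfl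

theorem Reduced.spatialJacobian_mul_transpose (h : Reduced L Q) :
    spatialJacobian L * (spatialJacobian L)ᵀ = |timeRate L| • 1 := by
  ext b c
  simpa [Matrix.mul_apply, spatialJacobian, Matrix.one_apply] using h.orth b c

theorem Reduced.dotProduct_columns (h : Reduced L Q) (a c : Fin n) :
    (L (ex a, 0)).1.2 ⬝ᵥ (L (ex c, 0)).1.2 = if a = c then |timeRate L| else 0 := by
  have hentry := congrFun (congrFun (transpose_mul_of_mul_transpose (abs_ne_zero.2 h.rate)
    h.spatialJacobian_mul_transpose) a) c
  simpa [Matrix.mul_apply, spatialJacobian, Matrix.one_apply, dotProduct] using hentry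

theorem Reduced.eq_zero_of_columns (h : Reduced L Q) {y : Fin n → ℝ}
    (hy : ∀ c, (L (ex c, 0)).1.2 ⬝ᵥ y = 0) : y = 0 :=
  eq_zero_of_transpose_mulVec (abs_ne_zero.2 h.rate) h.spatialJacobian_mul_transpose (funext hy)

theorem drift_eq_of_spatial_second_eq_zero (hrate : timeRate L ≠ 0)
    (hQ : ∀ c, (Q (ex c, 0) (ex c, 0)).1 = 0) (a : Fin n) :
    drift L Q a
      = 2 * (Complex.I * ((L (ex a, 0)).1.2 ⬝ᵥ (L (et, 0)).1.2 / (2 * timeRate L) : ℝ)) := by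
  have hsign : ((SignType.sign (timeRate L) : ℝ) : ℂ) * timeRate L = (|timeRate L| : ℝ) := by
    rw [← Complex.ofReal_mul, sign_mul_self]
  have habs : ((|timeRate L| : ℝ) : ℂ) ≠ 0 := by simpa using hrate
  have hrate' : (timeRate L : ℂ) ≠ 0 := by simpa using hrate
  simp only [drift, Prod.fst_sum, hQ, Finset.sum_const_zero, Prod.snd_zero, Pi.zero_apply,
    Complex.ofReal_zero, add_zero, mul_left_comm _ (_ * _ : ℂ), ← Finset.mul_sum, dotProduct,
    Complex.ofReal_div, Complex.ofReal_sum, Complex.ofReal_mul, Complex.ofReal_ofNat]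
  rw [div_eq_iff habs, ← hsign]
  field_simp

end SpatialJacobian

section Rigidity

theorem eq_zero_of_symm_of_antisymm {ι : Type*} {S : ι → ι → ι → ℝ}
    (hsymm : ∀ a b c, S a b c = S b a c) (hanti : ∀ a b c, S a b c = -S a c b) (a b c : ι) :
    S a b c = 0 := by
  linarith [hanti a b c, hsymm a c b, hanti c a b, hsymm c b a, hanti b c a, hsymm b a c]

theorem phase_derivative_symm {E : Type*} [NormedAddCommGroup E] [NormedSpace ℝ E] {Ψ : E → ℂ}
    {g h : E → ℝ} {g' h' : E →L[ℝ] ℝ} {p u v : E} (hΨ : ContDiffAt ℝ 2 Ψ p) (hne : Ψ p ≠ 0)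
    (hg : HasFDerivAt g g' p) (hh : HasFDerivAt h h' p)
    (hu : ∀ᶠ q in 𝓝 p, fderiv ℝ Ψ q u = Complex.I * g q * Ψ q)
    (hv : ∀ᶠ q in 𝓝 p, fderiv ℝ Ψ q v = Complex.I * h q * Ψ q) : g' v = h' u := by
  have hsecond : ∀ {f : E → ℝ} {f' : E →L[ℝ] ℝ} {w : E}, HasFDerivAt f f' p →
      (∀ᶠ q in 𝓝 p, fderiv ℝ Ψ q w = Complex.I * f q * Ψ q) → ∀ y, D2 Ψ p y w
        = Complex.I * f p * fderiv ℝ Ψ p y + Ψ p * (Complex.I * f' y) := by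
    intro f f' w hf hw y
    have hprod := ((Complex.ofRealCLM.hasFDerivAt.comp p hf).const_mul Complex.I).mul
      (hΨ.differentiableAt two_ne_zero).hasFDerivAt
    exact DFunLike.congr_fun ((hasFDerivAt_fderiv_apply hΨ w).unique
      (hprod.congr_of_eventuallyEq hw)) y
  have hcross := (hsecond hg hu v).symm.trans ((D2_comm hΨ v u).trans (hsecond hh hv u))
  rw [hu.self_of_nhds, hv.self_of_nhds] at hcross
  have hcoeff : Ψ p * Complex.I ≠ 0 := mul_ne_zero hne Complex.I_ne_zero
  refine Complex.ofReal_injective (mul_left_cancel₀ hcoeff ?_)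
  linear_combination hcross

variable {n : ℕ} {φ : Vars n → Vars n} {U : Set (Vars n)} {δ δ' : ℂ} {V V' : Base n → ℂ}
  {z : Vars n}

theorem hasFDerivAt_fderiv_space (hφ : ContDiffAt ℝ 2 φ z) (c : Vars n) :
    HasFDerivAt (fun y => (fderiv ℝ φ y c).1.2)
      ((ContinuousLinearMap.snd ℝ ℝ (Fin n → ℝ)).comp
        ((ContinuousLinearMap.fst ℝ (Base n) ℂ).comp ((D2 φ z).flip c))) z :=
  (hasFDerivAt_fderiv_apply hφ c).fst.snd

theorem norm_hat (s : ℝ) (β : ℂ) : ‖hat s β‖ = ‖β‖ := by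
  unfold hat
  split_ifs <;> simp

theorem MapsEquation.delta_ne_zero [NeZero n] (h : MapsEquation φ U δ V δ' V')
    (hφ : IsPointTransformation φ U) (hδ : δ ≠ 0) (hz : z ∈ U) : δ' ≠ 0 :=
  right_ne_zero_of_mul (h.hat_delta_eq hφ hδ hz ▸ hat_ne_zero hδ)

theorem MapsEquation.abs_timeRate [NeZero n] (h : MapsEquation φ U δ V δ' V')
    (hφ : IsPointTransformation φ U) (hδ : δ ≠ 0) (hz : z ∈ U) :
    |timeRate (fderiv ℝ φ z)| = ‖δ‖ / ‖δ'‖ := by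
  have hnorm := congrArg norm (h.hat_delta_eq hφ hδ hz)
  rw [norm_hat, norm_mul, Complex.norm_real, Real.norm_eq_abs, abs_abs] at hnorm
  rw [hnorm, mul_div_cancel_right₀ _ (norm_ne_zero_iff.2 (h.delta_ne_zero hφ hδ hz))]

theorem MapsEquation.hasFDerivAt_timeRate [NeZero n] (h : MapsEquation φ U δ V δ' V')
    (hφ : IsPointTransformation φ U) (hδ : δ ≠ 0) (hz : z ∈ U) :
    HasFDerivAt (fun y => timeRate (fderiv ℝ φ y)) (0 : Vars n →L[ℝ] ℝ) z := by
  have hrate : HasFDerivAt (fun y => timeRate (fderiv ℝ φ y)) _ z :=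
    (hasFDerivAt_fderiv_apply (contDiffAt_two (hφ.1.contDiffAt hz)) (et, 0)).fst.fst
  refine hrate.congr_fderiv ?_
  have hconst : (fun y => timeRate (fderiv ℝ φ y) ^ 2) =ᶠ[𝓝 z] fun _ => (‖δ‖ / ‖δ'‖) ^ 2 := by
    filter_upwards [hφ.1.1.mem_nhds hz] with y hy
    rw [← h.abs_timeRate hφ hδ hy, sq_abs]
  have hzero := (hrate.pow 2).unique
    ((hasFDerivAt_const _ z).congr_of_eventuallyEq hconst)
  exact (smul_eq_zero.1 hzero).resolve_left (by simpa using (h.reduced hφ.1 hz).rate)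

theorem MapsEquation.second_dotProduct_antisymm [NeZero n] (h : MapsEquation φ U δ V δ' V')
    (hφ : IsPointTransformation φ U) (hδ : δ ≠ 0) (hz : z ∈ U) (u : Vars n) (a c : Fin n) :
    (fderiv ℝ φ z (ex c, 0)).1.2 ⬝ᵥ (D2 φ z u (ex a, 0)).1.2
      = -((fderiv ℝ φ z (ex a, 0)).1.2 ⬝ᵥ (D2 φ z u (ex c, 0)).1.2) := by
  have hC2 := contDiffAt_two (hφ.1.contDiffAt hz)
  have hconst : (fun y => (fderiv ℝ φ y (ex a, 0)).1.2 ⬝ᵥ (fderiv ℝ φ y (ex c, 0)).1.2)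
      =ᶠ[𝓝 z] fun _ => if a = c then ‖δ‖ / ‖δ'‖ else 0 := by
    filter_upwards [hφ.1.1.mem_nhds hz] with y hy
    rw [(h.reduced hφ.1 hy).dotProduct_columns, h.abs_timeRate hφ hδ hy]
  have hzero := DFunLike.congr_fun ((hasFDerivAt_dotProduct
    (hasFDerivAt_fderiv_space hC2 (ex a, 0)) (hasFDerivAt_fderiv_space hC2 (ex c, 0))).unique
    ((hasFDerivAt_const _ z).congr_of_eventuallyEq hconst)) u
  rw [eq_neg_iff_add_eq_zero, add_comm, dotProduct_comm (fderiv ℝ φ z (ex c, 0)).1.2]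
  exact hzero

theorem MapsEquation.spatial_second_eq_zero [NeZero n] (h : MapsEquation φ U δ V δ' V')
    (hφ : IsPointTransformation φ U) (hδ : δ ≠ 0) (hz : z ∈ U) (a b : Fin n) :
    (D2 φ z (ex a, 0) (ex b, 0)).1 = 0 := by
  have hL := h.reduced hφ.1 hz
  refine Prod.ext (hL.second _ _ rfl rfl) (hL.eq_zero_of_columns fun c => ?_)
  exact eq_zero_of_symm_of_antisymm
    (S := fun a b c => (fderiv ℝ φ z (ex c, 0)).1.2 ⬝ᵥ (D2 φ z (ex a, 0) (ex b, 0)).1.2)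
    (fun a b c => by rw [hL.symm])
    (fun a b c => h.second_dotProduct_antisymm hφ hδ hz (ex a, 0) b c) a b c

theorem MapsEquation.drift_eq [NeZero n] (h : MapsEquation φ U δ V δ' V')
    (hφ : IsPointTransformation φ U) (hδ : δ ≠ 0) (hz : z ∈ U) (a : Fin n) :
    drift (fderiv ℝ φ z) (D2 φ z) a
      = 2 * (Complex.I * ((fderiv ℝ φ z (ex a, 0)).1.2 ⬝ᵥ (fderiv ℝ φ z (et, 0)).1.2
        / (2 * timeRate (fderiv ℝ φ z)) : ℝ)) :=
  drift_eq_of_spatial_second_eq_zero (h.reduced hφ.1 hz).rate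
    (fun c => h.spatial_second_eq_zero hφ hδ hz c c) a

theorem MapsEquation.phase_gradient [NeZero n] (h : MapsEquation φ U δ V δ' V')
    (hφ : IsPointTransformation φ U) (hδ : δ ≠ 0) (hz : z ∈ U) (a : Fin n) :
    (fderiv ℝ φ z (ex a, 0)).2
      = Complex.I * ((fderiv ℝ φ z (ex a, 0)).1.2 ⬝ᵥ (fderiv ℝ φ z (et, 0)).1.2
        / (2 * timeRate (fderiv ℝ φ z)) : ℝ) * (φ z).2 := by
  have hC2 := contDiffAt_two (hφ.1.contDiffAt hz)
  have hvalue : HasFDerivAt (fun y => (φ y).2) _ z :=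
    (hC2.differentiableAt two_ne_zero).hasFDerivAt.snd
  have hfiber : HasFDerivAt (fun y : Vars n => (fderiv ℝ φ y (0, y.2)).2) _ z :=
    ((hasFDerivAt_fderiv hC2).clm_apply
      ((hasFDerivAt_const (0 : Base n) z).prodMk hasFDerivAt_snd)).snd
  have heq : (fun y => (φ y).2) =ᶠ[𝓝 z] fun y => (fderiv ℝ φ y (0, y.2)).2 := by
    filter_upwards [hφ.1.1.mem_nhds hz] with y hy using h.snd_eq_fiber hφ hδ hy
  have hslope : (fderiv ℝ φ z (ex a, 0)).2 = (D2 φ z (ex a, 0) (0, z.2)).2 := by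
    simpa [map_fiber_zero] using
      DFunLike.congr_fun (hvalue.unique (hfiber.congr_of_eventuallyEq heq)) (ex a, 0)
  have hlinear := (h.determining hφ.1 hz).linear a z.2
  rw [← h.snd_eq_fiber hφ hδ hz, ← hslope, h.drift_eq hφ hδ hz] at hlinear
  linear_combination hlinear / 2

theorem MapsEquation.exists_hasFDerivAt_phase [NeZero n] (h : MapsEquation φ U δ V δ' V')
    (hφ : IsPointTransformation φ U) (hδ : δ ≠ 0) (hz : z ∈ U) (a : Fin n) :
    ∃ g' : Vars n →L[ℝ] ℝ,
      HasFDerivAt (fun y => (fderiv ℝ φ y (ex a, 0)).1.2 ⬝ᵥ (fderiv ℝ φ y (et, 0)).1.2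
        / (2 * timeRate (fderiv ℝ φ y))) g' z ∧
      ∀ c, g' (ex c, 0) = (fderiv ℝ φ z (ex a, 0)).1.2 ⬝ᵥ (D2 φ z (et, 0) (ex c, 0)).1.2
        / (2 * timeRate (fderiv ℝ φ z)) := by
  have hL := h.reduced hφ.1 hz
  have hC2 := contDiffAt_two (hφ.1.contDiffAt hz)
  have hdot := hasFDerivAt_dotProduct (hasFDerivAt_fderiv_space hC2 (ex a, 0))
    (hasFDerivAt_fderiv_space hC2 (et, 0))
  have hrate : HasFDerivAt (fun y => (2 * timeRate (fderiv ℝ φ y))⁻¹) (0 : Vars n →L[ℝ] ℝ) z :=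
    ((hasDerivAt_inv (mul_ne_zero two_ne_zero hL.rate)).comp_hasFDerivAt z
      ((h.hasFDerivAt_timeRate hφ hδ hz).const_mul 2)).congr_fderiv (by simp)
  refine ⟨_, hdot.mul hrate, fun c => ?_⟩
  simp [h.spatial_second_eq_zero hφ hδ hz, hL.symm (ex c, 0), div_eq_inv_mul]

theorem MapsEquation.mixed_second_eq_zero [NeZero n] (h : MapsEquation φ U δ V δ' V')
    (hφ : IsPointTransformation φ U) (hδ : δ ≠ 0) (hz : z ∈ U) (a : Fin n) :
    (D2 φ z (et, 0) (ex a, 0)).1 = 0 := by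
  have hL := h.reduced hφ.1 hz
  have hC2 := contDiffAt_two (hφ.1.contDiffAt hz)
  have hgradient : ∀ a, ∀ᶠ y in 𝓝 z, fderiv ℝ (fun y => (φ y).2) y (ex a, 0) = Complex.I
      * ((fderiv ℝ φ y (ex a, 0)).1.2 ⬝ᵥ (fderiv ℝ φ y (et, 0)).1.2
        / (2 * timeRate (fderiv ℝ φ y)) : ℝ) * (φ y).2 := fun a => by
    filter_upwards [hφ.1.1.mem_nhds hz] with y hy
    rw [← h.phase_gradient hφ hδ hy,
      ((hφ.1.contDiffAt hy).differentiableAt (by simp)).hasFDerivAt.snd.fderiv]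
    rfl
  have hsymm : ∀ c, (fderiv ℝ φ z (ex a, 0)).1.2 ⬝ᵥ (D2 φ z (et, 0) (ex c, 0)).1.2
      = (fderiv ℝ φ z (ex c, 0)).1.2 ⬝ᵥ (D2 φ z (et, 0) (ex a, 0)).1.2 := fun c => by
    obtain ⟨g', hg, hg'⟩ := h.exists_hasFDerivAt_phase hφ hδ hz a
    obtain ⟨h', hh, hh'⟩ := h.exists_hasFDerivAt_phase hφ hδ hz c
    have hcross := phase_derivative_symm hC2.snd (hφ.2.2 hz) hg hh (hgradient a) (hgradient c)
    rw [hg', hh'] at hcross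
    exact (div_left_inj' (mul_ne_zero two_ne_zero hL.rate)).1 hcross
  refine Prod.ext ?_ (hL.eq_zero_of_columns fun c => ?_)
  · have hrate : HasFDerivAt (fun y => timeRate (fderiv ℝ φ y)) _ z :=
      (hasFDerivAt_fderiv_apply hC2 (et, 0)).fst.fst
    rw [hL.symm]
    exact DFunLike.congr_fun (hrate.unique (h.hasFDerivAt_timeRate hφ hδ hz)) (ex a, 0)
  · linarith [hsymm c, h.second_dotProduct_antisymm hφ hδ hz (et, 0) a c]

theorem MapsEquation.second_spatial_eq_zero [NeZero n] (h : MapsEquation φ U δ V δ' V')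
    (hφ : IsPointTransformation φ U) (hδ : δ ≠ 0) (hz : z ∈ U) (u : Vars n) (a : Fin n) :
    (D2 φ z u (ex a, 0)).1 = 0 := by
  have hL := h.reduced hφ.1 hz
  have hsplit : u = u.1.1 • (et, 0) + ∑ b, u.1.2 b • (ex b, 0) + (0, u.2) := by
    refine Prod.ext ?_ (by simp [Prod.snd_sum])
    conv_lhs => rw [base_eq_sum u.1]
    simp [Prod.fst_sum]
  rw [hsplit]
  simp only [map_add, map_sum, map_smul, add_apply, sum_apply, smul_apply, Prod.fst_add,
    Prod.fst_sum, Prod.smul_fst, h.mixed_second_eq_zero hφ hδ hz,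
    h.spatial_second_eq_zero hφ hδ hz, hL.symm (0, u.2), hL.base_second, smul_zero,
    Finset.sum_const_zero, add_zero]

end Rigidity

section Intervals

variable {F : Type*} [NormedAddCommGroup F] [NormedSpace ℝ F] {I : Set ℝ}

theorem exists_contDiffOn_primitive [CompleteSpace F] (hI : IsOpen I) (hconn : IsPreconnected I)
    {f : ℝ → F} (hf : ContDiffOn ℝ ∞ f I) :
    ∃ l : ℝ → F, ContDiffOn ℝ ∞ l I ∧ ∀ t ∈ I, HasDerivAt l (f t) t := by
  rcases I.eq_empty_or_nonempty with rfl | ⟨t₀, ht₀⟩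
  · exact ⟨0, by simp, by simp⟩
  have hderiv : ∀ t ∈ I, HasDerivAt (fun t => ∫ s in t₀..t, f s) (f t) t := fun t ht =>
    intervalIntegral.integral_hasDerivAt_right
      (hf.continuousOn.mono (hconn.ordConnected.uIcc_subset ht₀ ht)).intervalIntegrable
      (hf.continuousOn.stronglyMeasurableAtFilter hI t ht)
      (hf.continuousOn.continuousAt (hI.mem_nhds ht))
  refine ⟨_, (contDiffOn_infty_iff_deriv_of_isOpen hI).2 ⟨fun t ht => ?_, ?_⟩, hderiv⟩
  · exact (hderiv t ht).differentiableAt.differentiableWithinAt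
  · exact hf.congr fun t ht => (hderiv t ht).deriv

theorem exists_smooth_log (hI : IsOpen I) (hconn : IsPreconnected I) {G : ℝ → ℂ}
    (hG : ContDiffOn ℝ ∞ G I) (hne : ∀ t ∈ I, G t ≠ 0) :
    ∃ γ : ℝ → ℂ, ContDiffOn ℝ ∞ γ I ∧ ∀ t ∈ I, G t = Complex.exp (γ t) := by
  rcases I.eq_empty_or_nonempty with rfl | ⟨t₀, ht₀⟩
  · exact ⟨0, by simp, by simp⟩
  have hlogDeriv : ContDiffOn ℝ ∞ (fun t => deriv G t / G t) I := by
    simpa only [div_eq_mul_inv, Pi.inv_apply] using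
      (hG.deriv_of_isOpen hI (by simp)).mul (hG.inv hne)
  obtain ⟨l, hl, hderiv⟩ := exists_contDiffOn_primitive hI hconn hlogDeriv
  have hquotient : ∀ t ∈ I, HasDerivAt (fun t => G t * Complex.exp (-l t)) 0 t := fun t ht =>
    ((((hG.contDiffAt (hI.mem_nhds ht)).differentiableAt (by simp)).hasDerivAt.mul
      (hderiv t ht).neg.cexp)).congr_deriv <| by
        rw [Pi.neg_apply]
        field_simp [hne t ht]
        ring
  have hconst : ∀ t ∈ I, G t * Complex.exp (-l t) = G t₀ * Complex.exp (-l t₀) := fun t ht =>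
    hI.is_const_of_deriv_eq_zero hconn
      (fun s hs => (hquotient s hs).differentiableAt.differentiableWithinAt)
      (fun s hs => (hquotient s hs).deriv) ht ht₀
  refine ⟨fun t => Complex.log (G t₀) - l t₀ + l t, contDiffOn_const.add hl, fun t ht => ?_⟩
  rw [Complex.exp_add, Complex.exp_sub, Complex.exp_log (hne t₀ ht₀), div_eq_mul_inv,
    ← Complex.exp_neg, ← hconst t ht, mul_assoc, ← Complex.exp_add]
  simp

end Intervals

section Patches

variable {n : ℕ} {F : Type*} [NormedAddCommGroup F] [NormedSpace ℝ F] {U : Set (Vars n)}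
  {f : Vars n → F}

theorem isOpen_times (hU : IsOpen U) : IsOpen (times U) :=
  (isOpenMap_fst.comp isOpenMap_fst) U hU

theorem mem_times {z : Vars n} (hz : z ∈ U) : z.1.1 ∈ times U := ⟨z, hz, rfl⟩

theorem IsPatch.eq_of_time_eq (hU : IsPatch U) (hf : DifferentiableOn ℝ f U)
    (hzero : ∀ z ∈ U, ∀ v w, fderiv ℝ f z ((0, v), w) = 0) {y z : Vars n} (hy : y ∈ U)
    (hz : z ∈ U) (htime : y.1.1 = z.1.1) : f y = f z := by
  obtain ⟨⟨t, x⟩, w⟩ := y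
  obtain ⟨⟨t', x'⟩, w'⟩ := z
  obtain rfl : t = t' := htime
  let slice : (Fin n → ℝ) × ℂ → Vars n := fun p => ((t, p.1), p.2)
  have hslice (p) : HasFDerivAt slice (((0 : (Fin n → ℝ) × ℂ →L[ℝ] ℝ).prod
      (ContinuousLinearMap.fst ℝ _ _)).prod (ContinuousLinearMap.snd ℝ _ _)) p :=
    ((hasFDerivAt_const t p).prodMk hasFDerivAt_fst).prodMk hasFDerivAt_snd
  have hopen : IsOpen (slice ⁻¹' U) :=
    hU.isOpen.preimage (Differentiable.continuous fun p => (hslice p).differentiableAt)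
  have hderiv (p) (hp : p ∈ slice ⁻¹' U) : HasFDerivAt (f ∘ slice) _ p :=
    (hf.differentiableAt (hU.isOpen.mem_nhds hp)).hasFDerivAt.comp p (hslice p)
  refine hopen.is_const_of_fderiv_eq_zero (𝕜 := ℝ) (x := (x, w)) (y := (x', w'))
    (hU.section_conn t)
    (fun p hp => (hderiv p hp).differentiableAt.differentiableWithinAt)
    (fun p hp => (hderiv p hp).fderiv.trans ?_) hy hz
  exact ContinuousLinearMap.ext fun u => hzero _ hp u.1 u.2

theorem exists_time_function_of_eq (hU : IsOpen U) (hf : ContDiffOn ℝ ∞ f U)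
    (heq : ∀ y ∈ U, ∀ z ∈ U, y.1.1 = z.1.1 → f y = f z) :
    ∃ g : ℝ → F, ContDiffOn ℝ ∞ g (times U) ∧
      ∀ z ∈ U, f z = g z.1.1 ∧ HasDerivAt g (fderiv ℝ f z (et, 0)) z.1.1 := by
  have hchoice (t : ℝ) : ∃ c : F, ∀ z ∈ U, z.1.1 = t → f z = c := by
    by_cases ht : t ∈ times U
    · obtain ⟨y, hy, rfl⟩ := ht
      exact ⟨f y, fun z hz => heq z hz y hy⟩
    · exact ⟨0, fun z hz hzt => (ht ⟨z, hz, hzt⟩).elim⟩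
  choose g hg using hchoice
  have hline (z : Vars n) : HasDerivAt (fun t : ℝ => (((t, z.1.2), z.2) : Vars n)) (et, 0) z.1.1 :=
    ((hasDerivAt_id z.1.1).prodMk (hasDerivAt_const _ _)).prodMk (hasDerivAt_const _ _)
  have hlocal (z) (hz : z ∈ U) : g =ᶠ[𝓝 z.1.1] fun t => f ((t, z.1.2), z.2) := by
    filter_upwards [(hline z).continuousAt.preimage_mem_nhds (hU.mem_nhds hz)] with t ht
    exact (hg t _ ht rfl).symm
  refine ⟨g, ?_, fun z hz => ⟨hg _ z hz rfl, ?_⟩⟩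
  · rintro _ ⟨z, hz, rfl⟩
    have hsmooth : ContDiffAt ℝ ∞ f ((z.1.1, z.1.2), z.2) := hf.contDiffAt (hU.mem_nhds hz)
    exact ((hsmooth.comp (f := fun t : ℝ => (((t, z.1.2), z.2) : Vars n)) z.1.1 (by fun_prop)
      ).congr_of_eventuallyEq (hlocal z hz)).contDiffWithinAt
  · have hdiff : HasFDerivAt f (fderiv ℝ f z) ((z.1.1, z.1.2), z.2) :=
      ((hf.contDiffAt (hU.mem_nhds hz)).differentiableAt (by simp)).hasFDerivAt
    exact (hdiff.comp_hasDerivAt z.1.1 (hline z)).congr_of_eventuallyEq (hlocal z hz)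

theorem IsPatch.exists_time_function (hU : IsPatch U) (hf : ContDiffOn ℝ ∞ f U)
    (hzero : ∀ z ∈ U, ∀ v w, fderiv ℝ f z ((0, v), w) = 0) :
    ∃ g : ℝ → F, ContDiffOn ℝ ∞ g (times U) ∧
      ∀ z ∈ U, f z = g z.1.1 ∧ HasDerivAt g (fderiv ℝ f z (et, 0)) z.1.1 :=
  exists_time_function_of_eq hU.isOpen hf fun _ hy _ hz =>
    hU.eq_of_time_eq (hf.differentiableOn (by simp)) hzero hy hz

theorem IsPatch.eq_of_hasDerivAt_zero (hU : IsPatch U) {g : ℝ → F}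
    (hg : ∀ t ∈ times U, HasDerivAt g 0 t) {s t : ℝ} (hs : s ∈ times U) (ht : t ∈ times U) :
    g s = g t :=
  (isOpen_times hU.isOpen).is_const_of_deriv_eq_zero hU.times_conn
    (fun s hs => (hg s hs).differentiableAt.differentiableWithinAt) (fun s hs => (hg s hs).deriv)
    hs ht

theorem IsPatch.eq_of_fderiv_eq_zero (hU : IsPatch U) (hf : ContDiffOn ℝ ∞ f U)
    (hzero : ∀ z ∈ U, fderiv ℝ f z = 0) {y z : Vars n} (hy : y ∈ U) (hz : z ∈ U) : f y = f z := by
  obtain ⟨g, -, hg⟩ := hU.exists_time_function hf fun z hz v w => by simp [hzero z hz]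
  rw [(hg y hy).1, (hg z hz).1]
  refine hU.eq_of_hasDerivAt_zero ?_ (mem_times hy) (mem_times hz)
  rintro _ ⟨x, hx, rfl⟩
  simpa [hzero x hx] using (hg x hx).2

end Patches

/-! ### Transformations in standard form -/

section StandardForm

variable {n : ℕ}

/-- Parameters of the transformations `t̃ = θt + τ`, `x̃ = Ax + 𝒳(t)`,
`ψ̃ = exp(iξ(t)·x + γ(t)) ψ̂`. In the notation of the theorem `θ = T_t`, `A = |T_t|^{1/2} O` and
`γ = iΣ + Z`; the covector `ξ` is determined by `θ`, `A` and `𝒳`. -/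
structure Params (n : ℕ) where
  /-- The number `θ`. -/
  rate : ℝ
  /-- The number `τ`. -/
  shift : ℝ
  /-- The matrix `A`. -/
  linear : Matrix (Fin n) (Fin n) ℝ
  /-- The curve `𝒳`. -/
  translation : ℝ → Fin n → ℝ
  /-- The function `γ`. -/
  gauge : ℝ → ℂ

namespace Params

/-- Validity of the parameters over the set `I` of values of `t`. -/
structure Regular (P : Params n) (I : Set ℝ) : Prop where
  isOpen : IsOpen I
  rate_ne_zero : P.rate ≠ 0
  linear_mul_transpose : P.linear * P.linearᵀ = |P.rate| • 1
  translation : ContDiffOn ℝ ∞ P.translation I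
  gauge : ContDiffOn ℝ ∞ P.gauge I

/-- The gradient `ξ` of the phase, `ξ = Aᵀ 𝒳_t / (2θ)`. -/
def covector (P : Params n) (t : ℝ) : Fin n → ℝ :=
  (2 * P.rate)⁻¹ • (P.linearᵀ *ᵥ deriv P.translation t)

/-- The exponent `iξ(t)·x + γ(t)`. -/
def exponent (P : Params n) (z : Vars n) : ℂ :=
  Complex.I * ((P.covector z.1.1 ⬝ᵥ z.1.2 : ℝ) : ℂ) + P.gauge z.1.1

/-- The action of the transformation on the variables. -/
def map (P : Params n) (z : Vars n) : Vars n :=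
  ((P.rate * z.1.1 + P.shift, P.linear *ᵥ z.1.2 + P.translation z.1.1),
    Complex.exp (P.exponent z) * hat P.rate z.2)

end Params

end StandardForm

section Differential

variable {n : ℕ} {F : Type*} [NormedAddCommGroup F] [NormedSpace ℝ F] {f : ℝ → F} {z : Vars n}

theorem hasFDerivAt_comp_time (hf : DifferentiableAt ℝ f z.1.1) :
    HasFDerivAt (fun y : Vars n => f y.1.1)
      ((timeCoord.comp (ContinuousLinearMap.fst ℝ (Base n) ℂ)).smulRight (deriv f z.1.1)) z :=
  (hf.hasFDerivAt.comp z
    (timeCoord.comp (ContinuousLinearMap.fst ℝ (Base n) ℂ)).hasFDerivAt).congr_fderiv <| by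
      ext <;> simp

theorem contDiffAt_comp_time (hf : ContDiffAt ℝ ∞ f z.1.1) :
    ContDiffAt ℝ ∞ (fun y : Vars n => f y.1.1) z :=
  ContDiffAt.comp z hf (by fun_prop : ContDiffAt ℝ ∞ (fun y : Vars n => y.1.1) z)

theorem hasFDerivAt_hat (s : ℝ) (w : ℂ) : HasFDerivAt (hat s) (hatCLE s : ℂ →L[ℝ] ℂ) w :=
  (hatCLE s).hasFDerivAt.congr_of_eventuallyEq (.of_forall fun β => (hatCLE_apply s β).symm)

theorem contDiff_hat (s : ℝ) : ContDiff ℝ ∞ (hat s) :=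
  funext (hatCLE_apply s) ▸ (hatCLE s).contDiff

theorem hasFDerivAt_mulVec {E : Type*} [NormedAddCommGroup E] [NormedSpace ℝ E]
    (A : Matrix (Fin n) (Fin n) ℝ) {g : E → Fin n → ℝ} {g' : E →L[ℝ] Fin n → ℝ} {p : E}
    (hg : HasFDerivAt g g' p) :
    HasFDerivAt (fun q => A *ᵥ g q) (A.mulVecLin.toContinuousLinearMap.comp g') p :=
  A.mulVecLin.toContinuousLinearMap.hasFDerivAt.comp p hg

namespace Params.Regular

variable {P : Params n} {I : Set ℝ}

theorem contDiffOn_deriv_translation (h : P.Regular I) :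
    ContDiffOn ℝ ∞ (deriv P.translation) I :=
  h.translation.deriv_of_isOpen h.isOpen (by simp)

theorem contDiffOn_covector (h : P.Regular I) : ContDiffOn ℝ ∞ P.covector I :=
  (P.linearᵀ.mulVecLin.toContinuousLinearMap.contDiff.comp_contDiffOn
    h.contDiffOn_deriv_translation).const_smul _

theorem differentiableAt_of_contDiffOn (h : P.Regular I) {t : ℝ} (ht : t ∈ I)
    (hf : ContDiffOn ℝ ∞ f I) : DifferentiableAt ℝ f t :=
  (hf.contDiffAt (h.isOpen.mem_nhds ht)).differentiableAt (by simp)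

theorem contDiffAt_exponent (h : P.Regular I) (hz : z.1.1 ∈ I) :
    ContDiffAt ℝ ∞ P.exponent z := by
  have hcovector := contDiffAt_comp_time (h.contDiffOn_covector.contDiffAt (h.isOpen.mem_nhds hz))
  have hgauge := contDiffAt_comp_time (h.gauge.contDiffAt (h.isOpen.mem_nhds hz))
  have hphase : ContDiffAt ℝ ∞ (fun y : Vars n => dotCLM n (P.covector y.1.1) y.1.2) z :=
    ((dotCLM n).contDiff.contDiffAt.comp z hcovector).clm_apply (by fun_prop)
  exact (contDiffAt_const.mul (Complex.ofRealCLM.contDiff.contDiffAt.comp z hphase)).add hgauge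

theorem contDiffAt_map (h : P.Regular I) (hz : z.1.1 ∈ I) : ContDiffAt ℝ ∞ P.map z := by
  have hlinear : ContDiff ℝ ∞ fun y : Vars n => P.linear *ᵥ y.1.2 :=
    P.linear.mulVecLin.toContinuousLinearMap.contDiff.comp (by fun_prop)
  have htranslation := contDiffAt_comp_time (h.translation.contDiffAt (h.isOpen.mem_nhds hz))
  exact (ContDiffAt.prodMk (by fun_prop) (hlinear.contDiffAt.add htranslation)).prodMk
    ((h.contDiffAt_exponent hz).cexp.mul ((contDiff_hat P.rate).comp contDiff_snd).contDiffAt)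

theorem fderiv_exponent (h : P.Regular I) (hz : z.1.1 ∈ I) (u : Vars n) :
    fderiv ℝ P.exponent z u
      = Complex.I
          * ((P.covector z.1.1 ⬝ᵥ u.1.2 + u.1.1 * (deriv P.covector z.1.1 ⬝ᵥ z.1.2) : ℝ) : ℂ)
        + u.1.1 * deriv P.gauge z.1.1 := by
  have hphase := hasFDerivAt_dotProduct (n := n)
    (hasFDerivAt_comp_time (h.differentiableAt_of_contDiffOn hz h.contDiffOn_covector))
    ((ContinuousLinearMap.snd ℝ ℝ (Fin n → ℝ)).comp
      (ContinuousLinearMap.fst ℝ (Base n) ℂ)).hasFDerivAt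
  have hexponent : HasFDerivAt P.exponent _ z :=
    ((Complex.ofRealCLM.hasFDerivAt.comp z hphase).const_mul Complex.I).fun_add
      (hasFDerivAt_comp_time (h.differentiableAt_of_contDiffOn hz h.gauge))
  rw [hexponent.fderiv]
  simp [mul_add]

theorem fderiv_map (h : P.Regular I) (hz : z.1.1 ∈ I) (u : Vars n) :
    fderiv ℝ P.map z u
      = ((P.rate * u.1.1, P.linear *ᵥ u.1.2 + u.1.1 • deriv P.translation z.1.1),
        (P.map z).2 * fderiv ℝ P.exponent z u + Complex.exp (P.exponent z) * hat P.rate u.2) := by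
  have htime := ((timeCoord.comp
    (ContinuousLinearMap.fst ℝ (Base n) ℂ)).hasFDerivAt (x := z)).const_mul P.rate
  have hspace := hasFDerivAt_mulVec P.linear ((ContinuousLinearMap.snd ℝ ℝ (Fin n → ℝ)).comp
    (ContinuousLinearMap.fst ℝ (Base n) ℂ)).hasFDerivAt (p := z)
  have htranslation := hasFDerivAt_comp_time (h.differentiableAt_of_contDiffOn hz h.translation)
  have hexponent := ((h.contDiffAt_exponent hz).differentiableAt (by simp)).hasFDerivAt.cexp
  have hhat := (hasFDerivAt_hat P.rate z.2).comp z (hasFDerivAt_snd (E := Base n) (𝕜 := ℝ))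
  have hmap : HasFDerivAt P.map _ z :=
    ((htime.add_const P.shift).prodMk (hspace.fun_add htranslation)).prodMk (hexponent.mul hhat)
  rw [hmap.fderiv]
  simp [map, mul_assoc, mul_comm, add_comm]

end Params.Regular

end Differential

section StandardFormJets

variable {n : ℕ} {P : Params n} {I : Set ℝ} {z : Vars n}

namespace Params.Regular

theorem eventually_time_mem (h : P.Regular I) (hz : z.1.1 ∈ I) : ∀ᶠ y in 𝓝 z, y.1.1 ∈ I :=
  (continuous_fst.fst.tendsto z).eventually (h.isOpen.mem_nhds hz)

theorem transpose_mul_linear (h : P.Regular I) : P.linearᵀ * P.linear = |P.rate| • 1 :=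
  transpose_mul_of_mul_transpose (abs_ne_zero.2 h.rate_ne_zero) h.linear_mul_transpose

theorem fderiv_map_fiber (h : P.Regular I) (hz : z.1.1 ∈ I) (w : ℂ) :
    fderiv ℝ P.map z (0, w) = (0, Complex.exp (P.exponent z) * hat P.rate w) := by
  simp [h.fderiv_map hz, h.fderiv_exponent hz]

theorem fderiv_map_ex (h : P.Regular I) (hz : z.1.1 ∈ I) (a : Fin n) :
    fderiv ℝ P.map z (ex a, 0)
      = ((0, P.linearᵀ a), (P.map z).2 * (Complex.I * (P.covector z.1.1 a : ℝ))) := by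
  simp only [ex, h.fderiv_map hz, mul_zero, Matrix.mulVec_single, MulOpposite.op_one, one_smul,
    zero_smul, add_zero, h.fderiv_exponent hz, dotProduct_single, mul_one, zero_mul,
    Complex.ofReal_zero, hat_zero]
  rfl

theorem fderiv_map_et (h : P.Regular I) (hz : z.1.1 ∈ I) :
    fderiv ℝ P.map z (et, 0) = ((P.rate, deriv P.translation z.1.1), (P.map z).2
      * (Complex.I * (deriv P.covector z.1.1 ⬝ᵥ z.1.2 : ℝ) + deriv P.gauge z.1.1)) := by
  simp [h.fderiv_map hz, h.fderiv_exponent hz, et, hat_zero]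

theorem timeRate_map (h : P.Regular I) (hz : z.1.1 ∈ I) :
    timeRate (fderiv ℝ P.map z) = P.rate := by
  rw [timeRate, h.fderiv_map_et hz]

theorem fderiv_map_injective (h : P.Regular I) (hz : z.1.1 ∈ I) :
    Function.Injective (fderiv ℝ P.map z) := by
  rw [injective_iff_map_eq_zero]
  rintro ⟨⟨s, y⟩, w⟩ hu
  have hs : s = 0 := by
    have htime := congrArg (fun y : Vars n => y.1.1) hu
    simpa [h.fderiv_map hz, h.rate_ne_zero] using htime
  subst hs
  have hy : y = 0 := by
    have hspace := congrArg (fun y : Vars n => y.1.2) hu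
    refine eq_zero_of_transpose_mulVec (A := P.linearᵀ) (abs_ne_zero.2 h.rate_ne_zero)
      h.transpose_mul_linear ?_
    simpa [h.fderiv_map hz] using hspace
  subst hy
  have hw : hat P.rate w = 0 := by
    have hfiber := congrArg Prod.snd hu
    rw [Prod.mk_zero_zero, h.fderiv_map_fiber hz] at hfiber
    exact (mul_eq_zero.1 hfiber).resolve_left (Complex.exp_ne_zero _)
  rw [← hatCLE_apply, map_eq_zero_iff _ (hatCLE P.rate).injective] at hw
  rw [hw]
  rfl

theorem D2_map_spatial_fst (h : P.Regular I) (hz : z.1.1 ∈ I) (u : Vars n) {v : Vars n}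
    (hv : v.1.1 = 0) : (D2 P.map z u v).1 = 0 :=
  clm_D2_apply_eq_zero (contDiffAt_two (h.contDiffAt_map hz))
    (ContinuousLinearMap.fst ℝ (Base n) ℂ) (0, P.linear *ᵥ v.1.2) (by
      filter_upwards [h.eventually_time_mem hz] with y hy
      simp [h.fderiv_map hy, hv]) u

theorem D2_map_fiber_snd (h : P.Regular I) (hz : z.1.1 ∈ I) (u : Vars n) (w : ℂ) :
    (D2 P.map z u (0, w)).2
      = Complex.exp (P.exponent z) * fderiv ℝ P.exponent z u * hat P.rate w := by
  have hfiber : (fun y => (fderiv ℝ P.map y (0, w)).2)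
      =ᶠ[𝓝 z] fun y => Complex.exp (P.exponent y) * hat P.rate w := by
    filter_upwards [h.eventually_time_mem hz] with y hy
    rw [h.fderiv_map_fiber hy]
  have hexp := ((h.contDiffAt_exponent hz).differentiableAt (by simp)).hasFDerivAt.cexp
  have hsecond : HasFDerivAt (fun y => (fderiv ℝ P.map y (0, w)).2) _ z :=
    (hasFDerivAt_fderiv_apply (contDiffAt_two (h.contDiffAt_map hz)) (0, w)).snd
  exact (DFunLike.congr_fun (hsecond.unique
    ((hexp.mul_const (hat P.rate w)).congr_of_eventuallyEq hfiber)) u).trans (mul_comm _ _)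

theorem D2_map_ex_snd (h : P.Regular I) (hz : z.1.1 ∈ I) (a : Fin n) :
    (D2 P.map z (ex a, 0) (ex a, 0)).2
      = (P.map z).2 * (Complex.I * (P.covector z.1.1 a : ℝ)) ^ 2 := by
  have hslope : (fun y => (fderiv ℝ P.map y (ex a, 0)).2)
      =ᶠ[𝓝 z] fun y => (P.map y).2 * (Complex.I * (P.covector y.1.1 a : ℝ)) := by
    filter_upwards [h.eventually_time_mem hz] with y hy
    rw [h.fderiv_map_ex hy]
  have hC2 := contDiffAt_two (h.contDiffAt_map hz)
  have hvalue := (hC2.differentiableAt two_ne_zero).hasFDerivAt.snd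
  have hcovector := ((Complex.ofRealCLM.comp (ContinuousLinearMap.proj a)).hasFDerivAt.comp z
    (hasFDerivAt_comp_time
      (h.differentiableAt_of_contDiffOn hz h.contDiffOn_covector))).const_mul Complex.I
  have hsecond : HasFDerivAt (fun y => (fderiv ℝ P.map y (ex a, 0)).2) _ z :=
    (hasFDerivAt_fderiv_apply hC2 (ex a, 0)).snd
  have happly := DFunLike.congr_fun (hsecond.unique
    ((hvalue.mul hcovector).congr_of_eventuallyEq hslope)) (ex a, 0)
  rw [ContinuousLinearMap.comp_apply, ContinuousLinearMap.flip_apply] at happly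
  have htime : (ex a : Base n).1 = 0 := rfl
  simp only [ContinuousLinearMap.coe_snd', Function.comp_apply, ContinuousLinearMap.comp_apply,
    ContinuousLinearMap.proj_apply, Complex.ofRealCLM_apply, add_apply, smul_apply,
    ContinuousLinearMap.smulRight_apply, ContinuousLinearMap.coe_fst', timeCoord_apply, map_smul,
    Complex.real_smul, smul_eq_mul, h.fderiv_map_ex hz, htime, Complex.ofReal_zero] at happly
  exact happly.trans (by ring)

theorem reduced_map (h : P.Regular I) (hz : z.1.1 ∈ I) :
    Reduced (fderiv ℝ P.map z) (D2 P.map z) where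
  map u hu := by simp [h.fderiv_map hz, hu]
  second u v _ hv := by rw [h.D2_map_spatial_fst hz u hv]; rfl
  base w := by rw [h.fderiv_map_fiber hz]
  rate := by rw [h.timeRate_map hz]; exact h.rate_ne_zero
  orth b c := by
    have hentry := congrFun (congrFun h.linear_mul_transpose b) c
    simpa [h.fderiv_map_ex hz, h.timeRate_map hz, Matrix.mul_apply, Matrix.one_apply] using hentry
  conj s := by
    rw [h.timeRate_map hz, h.fderiv_map_fiber hz, h.fderiv_map_fiber hz, hat_mul,
      hat_I h.rate_ne_zero]
    ring
  base_second u w := h.D2_map_spatial_fst hz u rfl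
  symm := D2_comm (contDiffAt_two (h.contDiffAt_map hz))

theorem drift_map (h : P.Regular I) (hz : z.1.1 ∈ I) (a : Fin n) :
    drift (fderiv ℝ P.map z) (D2 P.map z) a = 2 * (Complex.I * (P.covector z.1.1 a : ℝ)) := by
  rw [drift_eq_of_spatial_second_eq_zero (h.reduced_map hz).rate
    fun c => h.D2_map_spatial_fst hz (ex c, 0) rfl]
  rw [h.fderiv_map_ex hz, h.fderiv_map_et hz, h.timeRate_map hz, div_eq_inv_mul]
  rfl

end Params.Regular

end StandardFormJets

section ArbitraryElements

variable {n : ℕ} {P : Params n} {I : Set ℝ} {z : Vars n} {δ v : ℂ}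

namespace Params

/-- The transformed constant `δ̃`. -/
def coupling (P : Params n) (δ : ℂ) : ℂ := hat P.rate δ / (|P.rate| : ℝ)

/-- The transformed value `Ṽ` at the image of a point `(t, x)`, as a function of `(t, x)` and of
the values `δ` and `v` of the original arbitrary elements. -/
def potential (P : Params n) (p : Base n) (δ v : ℂ) : ℂ :=
  (hat P.rate v - (P.covector p.1 ⬝ᵥ P.covector p.1 : ℝ) - hat P.rate δ * (P.gauge p.1).re)
      / (|P.rate| : ℝ)
    + ((deriv P.covector p.1 ⬝ᵥ p.2 : ℝ) - Complex.I * deriv P.gauge p.1) / P.rate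

theorem Regular.abs_mul_coupling (h : P.Regular I) (δ : ℂ) :
    (|P.rate| : ℝ) * P.coupling δ = hat P.rate δ :=
  mul_div_cancel₀ _ (by simpa using h.rate_ne_zero)

theorem Regular.abs_mul_potential (h : P.Regular I) (p : Base n) (δ v : ℂ) :
    (|P.rate| : ℝ) * P.potential p δ v
      = hat P.rate v - (P.covector p.1 ⬝ᵥ P.covector p.1 : ℝ) - hat P.rate δ * (P.gauge p.1).re
        + (SignType.sign P.rate : ℝ)
          * ((deriv P.covector p.1 ⬝ᵥ p.2 : ℝ) - Complex.I * deriv P.gauge p.1) := by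
  have habs : ((|P.rate| : ℝ) : ℂ) ≠ 0 := by simpa using h.rate_ne_zero
  have hrate : (P.rate : ℂ) ≠ 0 := by simpa using h.rate_ne_zero
  have hsign : ((|P.rate| : ℝ) : ℂ) = (SignType.sign P.rate : ℝ) * (P.rate : ℂ) := by
    exact_mod_cast (sign_mul_self P.rate).symm
  rw [potential, mul_add, mul_div_cancel₀ _ habs, hsign]
  field_simp

theorem log_norm_map (P : Params n) (hz : z.2 ≠ 0) :
    Real.log ‖(P.map z).2‖ = (P.gauge z.1.1).re + Real.log ‖z.2‖ := by
  have hre : (P.exponent z).re = (P.gauge z.1.1).re := by simp [exponent]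
  rw [map, norm_mul, norm_hat, Complex.norm_exp, hre, Real.log_mul (Real.exp_ne_zero _)
    (norm_ne_zero_iff.2 hz), Real.log_exp]

theorem zeroOrder_map (P : Params n) :
    Complex.exp (P.exponent z) * hat P.rate (zeroOrder δ v z.2)
      = (P.map z).2 * (hat P.rate δ * (Real.log ‖z.2‖ : ℝ) + hat P.rate v) := by
  simp only [zeroOrder, hat_add, hat_mul, hat_ofReal, map]
  ring

theorem Regular.determining_map (h : P.Regular I) (hz : z.1.1 ∈ I) (hψ : z.2 ≠ 0) (δ v : ℂ) :
    Determining (fderiv ℝ P.map z) (D2 P.map z) (zeroOrder δ v z.2)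
      (zeroOrder (P.coupling δ) (P.potential z.1 δ v) (P.map z).2) where
  quadratic w := by simp [h.D2_map_fiber_snd hz, h.fderiv_exponent hz]
  linear a w := by
    simp only [ex, h.D2_map_fiber_snd hz, h.fderiv_exponent hz, dotProduct_single, mul_one,
      zero_mul, add_zero, Complex.ofReal_zero, h.drift_map hz, h.fderiv_map_fiber hz]
    ring
  free := by
    have hsum (c : ℂ) : ∑ a, c * (Complex.I * (P.covector z.1.1 a : ℝ)) ^ 2
        = -c * (P.covector z.1.1 ⬝ᵥ P.covector z.1.1 : ℝ) := by
      simp only [dotProduct, Complex.ofReal_sum, Complex.ofReal_mul, Finset.mul_sum]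
      refine Finset.sum_congr rfl fun a _ => ?_
      linear_combination c * (P.covector z.1.1 a : ℂ) ^ 2 * Complex.I_sq
    have hdrift (a : Fin n) : 2 * (Complex.I * (P.covector z.1.1 a : ℂ))
          * ((P.map z).2 * (Complex.I * (P.covector z.1.1 a : ℂ)))
        = 2 * (P.map z).2 * (Complex.I * (P.covector z.1.1 a : ℂ)) ^ 2 := by ring
    simp only [defect, Pi.zero_apply, h.timeRate_map hz, h.drift_map hz, h.fderiv_map_et hz,
      h.fderiv_map_ex hz, h.D2_map_ex_snd hz, h.fderiv_map_fiber hz, P.zeroOrder_map,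
      hat_zero, mul_zero, add_zero, hdrift, hsum]
    rw [zeroOrder, P.log_norm_map hψ, Complex.ofReal_add]
    linear_combination (P.map z).2 * ((P.gauge z.1.1).re + Real.log ‖z.2‖) * h.abs_mul_coupling δ
      + (P.map z).2 * h.abs_mul_potential z.1 δ v
      + (SignType.sign P.rate : ℝ) * (P.map z).2 * (deriv P.covector z.1.1 ⬝ᵥ z.1.2 : ℝ)
        * Complex.I_sq

end Params

end ArbitraryElements

section DeterminingSuffices

variable {n : ℕ} {φ : Vars n → Vars n} {U : Set (Vars n)} {δ δ' : ℂ} {V V' : Base n → ℂ}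

theorem mapsEquation_of_determining (hφ : IsDiffeoOn φ U)
    (hL : ∀ z ∈ U, Reduced (fderiv ℝ φ z) (D2 φ z))
    (hd : ∀ z ∈ U, Determining (fderiv ℝ φ z) (D2 φ z) (zeroOrder δ (V z.1) z.2)
      (zeroOrder δ' (V' (φ z).1) (φ z).2)) :
    MapsEquation φ U δ V δ' V' := by
  intro p ψ ψ' hz hψ hψ' hgraph
  have hφ' := hφ.contDiffAt hz
  have hP : Prolongs (fderiv ℝ φ (p, ψ p)) (D2 φ (p, ψ p)) (fderiv ℝ ψ p) (D2 ψ p)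
      (fderiv ℝ ψ' (φ (p, ψ p)).1) (D2 ψ' (φ (p, ψ p)).1) :=
    ⟨fderiv_transformed (hφ'.differentiableAt (by simp)) (hψ.differentiableAt (by simp))
      (hψ'.differentiableAt (by simp)) hgraph,
      D2_transformed (contDiffAt_two hφ') (contDiffAt_two hψ) (contDiffAt_two hψ') hgraph⟩
  have hL' := hL _ hz
  have hjet := hL'.jetOp_eq hP (zeroOrder δ (V p) (ψ p))
    (zeroOrder δ' (V' (φ (p, ψ p)).1) (φ (p, ψ p)).2)
  rw [hL'.defect_eq_zero (hd _ hz), add_zero] at hjet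
  rw [satisfiesAt_iff (contDiffAt_two hψ), satisfiesAt_iff (contDiffAt_two hψ'),
    hgraph.self_of_nhds]
  have habs : ((|timeRate (fderiv ℝ φ (p, ψ p))| : ℝ) : ℂ) ≠ 0 := by
    simpa using hL'.rate
  constructor
  · intro hsol
    rw [hsol, map_fiber_zero] at hjet
    exact (mul_eq_zero.1 hjet).resolve_left habs
  · intro hsol
    rw [hsol, mul_zero] at hjet
    by_contra hne
    exact hL'.fiber_ne_zero (hφ.bijective hz).1 hne hjet.symm

end DeterminingSuffices

section Diffeomorphisms

variable {E F : Type*} [NormedAddCommGroup E] [NormedSpace ℝ E] [NormedAddCommGroup F]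
  [NormedSpace ℝ F] {f g : E → E} {G : E × F → F} {U : Set E} {s : Set F}

theorem IsDiffeoOn.congr (hf : IsDiffeoOn f U) (hfg : Set.EqOn g f U) : IsDiffeoOn g U := by
  obtain ⟨hU, hsmooth, hinj, hinv⟩ := hf
  refine ⟨hU, hsmooth.congr hfg, hinj.congr hfg.symm, fun z hz => ?_⟩
  rw [(hfg.eventuallyEq_of_mem (hU.mem_nhds hz)).fderiv_eq]
  exact hinv z hz

theorem isDiffeoOn_affine (A : E ≃L[ℝ] E) (b : E) (hU : IsOpen U) :
    IsDiffeoOn (fun w => A w + b) U := by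
  refine ⟨hU, (A.contDiff.add contDiff_const).contDiffOn,
    ((add_left_injective b).comp A.injective).injOn, fun z _ => ⟨A, ?_⟩⟩
  rw [fderiv_add_const, A.fderiv]

/- A block triangular Jacobian with invertible diagonal blocks is invertible. -/
theorem IsDiffeoOn.triangular (hf : IsDiffeoOn f U) (hs : IsOpen s)
    (hG : ContDiffOn ℝ ∞ G (U ×ˢ s)) (hfiber : ∀ z ∈ U, IsDiffeoOn (fun w => G (z, w)) s) :
    IsDiffeoOn (fun e => (f e.1, G e)) (U ×ˢ s) := by
  obtain ⟨hU, hsmooth, hinj, hinv⟩ := hf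
  have hopen := hU.prod hs
  refine ⟨hopen, (hsmooth.comp contDiffOn_fst fun e he => he.1).prodMk hG, ?_, ?_⟩
  · rintro ⟨z, w⟩ ⟨hz, hw⟩ ⟨z', w'⟩ ⟨hz', hw'⟩ heq
    obtain rfl : z = z' := hinj hz hz' (congrArg Prod.fst heq)
    obtain rfl : w = w' := (hfiber z hz).2.2.1 hw hw' (congrArg Prod.snd heq)
    rfl
  · rintro ⟨z, w⟩ ⟨hz, hw⟩
    obtain ⟨A, hA⟩ := hinv z hz
    obtain ⟨B, hB⟩ := (hfiber z hz).2.2.2 w hw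
    have hdf : HasFDerivAt f (A : E →L[ℝ] E) z := hA ▸
      ((hsmooth.contDiffAt (hU.mem_nhds hz)).differentiableAt (by simp)).hasFDerivAt
    have hdG := ((hG.contDiffAt (hopen.mem_nhds ⟨hz, hw⟩)).differentiableAt (by simp)).hasFDerivAt
    have hslice := hdG.comp w (hasFDerivAt_prodMk_right z w)
    refine ⟨A.skewProd B ((fderiv ℝ G (z, w)).comp (ContinuousLinearMap.inl ℝ E F)), ?_⟩
    have hF : HasFDerivAt (fun e => (f e.1, G e)) _ (z, w) :=
      (HasFDerivAt.comp (z, w) hdf hasFDerivAt_fst).prodMk hdG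
    rw [hF.fderiv]
    refine ContinuousLinearMap.ext fun u => Prod.ext rfl ?_
    calc B u.2 + fderiv ℝ G (z, w) (u.1, 0)
        = fderiv ℝ G (z, w) (0, u.2) + fderiv ℝ G (z, w) (u.1, 0) :=
          congrArg (· + _) (DFunLike.congr_fun (hB.trans hslice.fderiv) u.2)
      _ = fderiv ℝ G (z, w) u := by rw [← map_add, Prod.mk_add_mk, zero_add, add_zero]

end Diffeomorphisms

section StandardFormInverse

variable {n : ℕ} {P : Params n} {U : Set (Vars n)} {δ : ℂ} {V : Base n → ℂ}

theorem contDiffOn_comp_time_fst (n : ℕ) {F : Type*} [NormedAddCommGroup F] [NormedSpace ℝ F]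
    (G : Type*) [NormedAddCommGroup G] [NormedSpace ℝ G] {f : ℝ → F} {I : Set ℝ}
    (hf : ContDiffOn ℝ ∞ f I) :
    ContDiffOn ℝ ∞ (fun e : Base n × G => f e.1.1) {e | e.1.1 ∈ I} :=
  hf.comp (f := fun e : Base n × G => e.1.1) (by fun_prop) fun _ he => he

namespace Params

/-- The inverse of the action of the transformation on `(t, x)`. -/
def baseInv (P : Params n) (y : Base n) : Base n :=
  ((y.1 - P.shift) / P.rate,
    |P.rate|⁻¹ • P.linearᵀ *ᵥ (y.2 - P.translation ((y.1 - P.shift) / P.rate)))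

/-- The function `Ṽ` of the transformed equation. -/
def newPotential (P : Params n) (δ : ℂ) (V : Base n → ℂ) (y : Base n) : ℂ :=
  P.potential (P.baseInv y) δ (V (P.baseInv y))

namespace Regular

theorem baseInv_map {I : Set ℝ} (h : P.Regular I) (z : Vars n) : P.baseInv (P.map z).1 = z.1 := by
  have htime : (P.rate * z.1.1 + P.shift - P.shift) / P.rate = z.1.1 := by
    rw [add_sub_cancel_right, mul_div_cancel_left₀ _ h.rate_ne_zero]
  refine Prod.ext htime ?_
  rw [baseInv, map, htime, add_sub_cancel_right, Matrix.mulVec_mulVec, h.transpose_mul_linear,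
    Matrix.smul_mulVec, Matrix.one_mulVec, inv_smul_smul₀ (abs_ne_zero.2 h.rate_ne_zero)]

theorem newPotential_map {I : Set ℝ} (h : P.Regular I) (δ : ℂ) (V : Base n → ℂ) (z : Vars n) :
    P.newPotential δ V (P.map z).1 = P.potential z.1 δ (V z.1) := by
  rw [newPotential, h.baseInv_map]

theorem map_injective {I : Set ℝ} (h : P.Regular I) : Function.Injective P.map := by
  intro z y hzy
  have hbase : z.1 = y.1 := by rw [← h.baseInv_map z, hzy, h.baseInv_map]
  have hexponent : P.exponent z = P.exponent y := by simp only [exponent, hbase]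
  have hfiber := congrArg Prod.snd hzy
  simp only [map, hexponent, mul_right_inj' (Complex.exp_ne_zero _), ← hatCLE_apply] at hfiber
  exact Prod.ext hbase ((hatCLE P.rate).injective hfiber)

theorem isPointTransformation_map (h : P.Regular (times U)) (hU : IsOpen U)
    (hreg : U ⊆ regular n) : IsPointTransformation P.map U :=
  ⟨⟨hU, fun _ hz => (h.contDiffAt_map (mem_times hz)).contDiffWithinAt, h.map_injective.injOn,
    fun _ hz => isInvertible_of_bijective
      ⟨h.fderiv_map_injective (mem_times hz),
        LinearMap.injective_iff_surjective.1 (h.fderiv_map_injective (mem_times hz))⟩⟩,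
    hreg, fun _ hz => mul_ne_zero (Complex.exp_ne_zero _) (hat_ne_zero (hreg hz))⟩

theorem contDiffOn_potential {I : Set ℝ} (h : P.Regular I) :
    ContDiffOn ℝ ∞ (fun e : Base n × (ℂ × ℂ) => P.potential e.1 e.2.1 e.2.2)
      {e | e.1.1 ∈ I} := by
  have hdot {f g : Base n × (ℂ × ℂ) → Fin n → ℝ} {s : Set (Base n × (ℂ × ℂ))}
      (hf : ContDiffOn ℝ ∞ f s) (hg : ContDiffOn ℝ ∞ g s) :
      ContDiffOn ℝ ∞ (fun e => ((f e ⬝ᵥ g e : ℝ) : ℂ)) s :=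
    Complex.ofRealCLM.contDiff.comp_contDiffOn
      (((dotCLM n).contDiff.comp_contDiffOn hf).clm_apply hg)
  have hhat {f : Base n × (ℂ × ℂ) → ℂ} {s : Set (Base n × (ℂ × ℂ))} (hf : ContDiff ℝ ∞ f) :
      ContDiffOn ℝ ∞ (fun e => hat P.rate (f e)) s :=
    ((contDiff_hat P.rate).comp hf).contDiffOn
  have hderiv {F : Type} [NormedAddCommGroup F] [NormedSpace ℝ F] {f : ℝ → F}
      (hf : ContDiffOn ℝ ∞ f I) : ContDiffOn ℝ ∞ (deriv f) I :=
    hf.deriv_of_isOpen h.isOpen (by simp)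
  have hcovector := contDiffOn_comp_time_fst n (ℂ × ℂ) h.contDiffOn_covector
  have hgauge : ContDiffOn ℝ ∞ (fun t => ((P.gauge t).re : ℂ)) I :=
    (Complex.ofRealCLM.comp Complex.reCLM).contDiff.comp_contDiffOn h.gauge
  have hquotient := (((hhat (f := fun e => e.2.2) (by fun_prop)).sub (hdot hcovector hcovector)).sub
    ((hhat (f := fun e => e.2.1) (by fun_prop)).mul
      (contDiffOn_comp_time_fst n (ℂ × ℂ) hgauge))).div_const ((|P.rate| : ℝ) : ℂ)
  have hrest := ((hdot (g := fun e => e.1.2)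
    (contDiffOn_comp_time_fst n (ℂ × ℂ) (hderiv h.contDiffOn_covector)) (by fun_prop)).sub
      ((contDiffOn_const (c := Complex.I)).mul
        (contDiffOn_comp_time_fst n (ℂ × ℂ) (hderiv h.gauge)))).div_const (P.rate : ℂ)
  exact hquotient.add hrest

theorem contDiffOn_baseInv {I : Set ℝ} (h : P.Regular I) :
    ContDiffOn ℝ ∞ P.baseInv {y | (P.baseInv y).1 ∈ I} := by
  have htime : ContDiff ℝ ∞ fun y : Base n => (y.1 - P.shift) / P.rate := by fun_prop
  have htranslation := h.translation.comp htime.contDiffOn (s := {y | (P.baseInv y).1 ∈ I})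
    fun _ hy => hy
  exact htime.contDiffOn.prodMk ((P.linearᵀ.mulVecLin.toContinuousLinearMap.contDiff.comp_contDiffOn
    (contDiffOn_snd.sub htranslation)).const_smul _)

theorem contDiffOn_newPotential (h : P.Regular (times U)) (δ : ℂ)
    (hV : ContDiffOn ℝ ∞ V (Prod.fst '' U)) :
    ContDiffOn ℝ ∞ (P.newPotential δ V) (Prod.fst '' (P.map '' U)) := by
  have hmaps : Set.MapsTo P.baseInv (Prod.fst '' (P.map '' U)) (Prod.fst '' U) := by
    rintro _ ⟨_, ⟨z, hz, rfl⟩, rfl⟩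
    exact ⟨z, hz, (h.baseInv_map z).symm⟩
  have htime : Set.MapsTo (fun p : Base n => p.1) (Prod.fst '' U) (times U) := by
    rintro _ ⟨z, hz, rfl⟩
    exact mem_times hz
  have hinv := h.contDiffOn_baseInv.mono fun y hy => htime (hmaps hy)
  have hpoint : ContDiffOn ℝ ∞ (fun y => (P.baseInv y, (δ, V (P.baseInv y))))
      (Prod.fst '' (P.map '' U)) :=
    hinv.prodMk (contDiffOn_const.prodMk (hV.comp hinv hmaps))
  refine (h.contDiffOn_potential.comp hpoint fun y hy => htime (hmaps hy)).congr fun y _ => ?_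
  rw [newPotential, Function.comp_apply]

theorem isAdmissible_map (h : P.Regular (times U)) (hU : IsOpen U) (hreg : U ⊆ regular n)
    (hV : InClass (Prod.fst '' U) δ V) :
    IsAdmissible U δ V P.map (P.coupling δ) (P.newPotential δ V) := by
  have hmap := h.isPointTransformation_map hU hreg
  refine ⟨hmap, hV, ⟨div_ne_zero (hat_ne_zero hV.1) (by simpa using h.rate_ne_zero),
    h.contDiffOn_newPotential δ hV.2⟩, ?_⟩
  refine mapsEquation_of_determining hmap.1 (fun z hz => h.reduced_map (mem_times hz))
    fun z hz => ?_
  rw [h.newPotential_map]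
  exact h.determining_map (mem_times hz) (hreg hz) δ (V z.1)

end Regular

end Params

end StandardFormInverse

section EquivalenceTransformation

variable {n : ℕ} {P : Params n} {U : Set (Vars n)}

namespace Params

/-- The transformation with parameters `P` of the joint space of the variables and of the values of
the arbitrary elements. -/
def extMap (P : Params n) (e : Ext n) : Ext n :=
  (P.map e.1, (P.coupling e.2.1, P.potential e.1.1 e.2.1 e.2.2))

namespace Regular

/-- The linear isomorphism `β ↦ β̂ / |θ|`. -/
def scaledHat {I : Set ℝ} (h : P.Regular I) : ℂ ≃L[ℝ] ℂ :=
  (hatCLE P.rate).trans (ContinuousLinearEquiv.smulLeft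
    (Units.mk0 |P.rate|⁻¹ (inv_ne_zero (abs_ne_zero.2 h.rate_ne_zero))))

theorem scaledHat_apply {I : Set ℝ} (h : P.Regular I) (β : ℂ) :
    h.scaledHat β = hat P.rate β / (|P.rate| : ℝ) := by
  simp [scaledHat, div_eq_inv_mul, Units.smul_def]

theorem isDiffeoOn_elements {I : Set ℝ} (h : P.Regular I) {p : Base n} (hp : p.1 ∈ I) :
    IsDiffeoOn (fun c : ℂ × ℂ => (P.coupling c.1, P.potential p c.1 c.2))
      ({0}ᶜ ×ˢ Set.univ) := by
  have hcoupling : IsDiffeoOn P.coupling {0}ᶜ :=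
    (isDiffeoOn_affine h.scaledHat 0 isOpen_compl_singleton).congr fun β _ => by
      simp only [add_zero, h.scaledHat_apply, coupling]
  refine hcoupling.triangular (G := fun c => P.potential p c.1 c.2) isOpen_univ
    (h.contDiffOn_potential.comp (f := fun c => (p, c)) (by fun_prop) fun _ _ => hp)
    fun δ _ => (isDiffeoOn_affine h.scaledHat (P.potential p δ 0) isOpen_univ).congr fun v _ => ?_
  simp only [h.scaledHat_apply, potential, hat_zero]
  ring

theorem isDiffeoOn_extMap (h : P.Regular (times U)) (hU : IsOpen U) (hreg : U ⊆ regular n) :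
    IsDiffeoOn P.extMap (U ×ˢ ({0}ᶜ ×ˢ Set.univ)) := by
  have hcoupling : ContDiff ℝ ∞ fun e : Ext n => P.coupling e.2.1 :=
    ((contDiff_hat P.rate).comp (by fun_prop : ContDiff ℝ ∞ fun e : Ext n => e.2.1)).div_const _
  have hpotential : ContDiffOn ℝ ∞ (fun e : Ext n => P.potential e.1.1 e.2.1 e.2.2)
      (U ×ˢ ({0}ᶜ ×ˢ Set.univ)) :=
    h.contDiffOn_potential.comp (f := fun e : Ext n => (e.1.1, e.2)) (by fun_prop)
      fun e he => mem_times he.1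
  have helements : ContDiffOn ℝ ∞
      (fun e : Ext n => (P.coupling e.2.1, P.potential e.1.1 e.2.1 e.2.2))
      (U ×ˢ ({0}ᶜ ×ˢ Set.univ)) := hcoupling.contDiffOn.prodMk hpotential
  have hfiber : ∀ z ∈ U, IsDiffeoOn
      (fun c : ℂ × ℂ => (P.coupling c.1, P.potential z.1 c.1 c.2)) ({0}ᶜ ×ˢ Set.univ) :=
    fun z hz => h.isDiffeoOn_elements (mem_times hz)
  have hmap := (h.isPointTransformation_map hU hreg).1
  exact hmap.triangular (isOpen_compl_singleton.prod isOpen_univ) helements hfiber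

theorem mapsElements_extMap {I : Set ℝ} (h : P.Regular I) (δ : ℂ) (V : Base n → ℂ) :
    MapsElements P.extMap P.map U δ V (P.coupling δ) (P.newPotential δ V) := fun z _ => by
  rw [h.newPotential_map, extMap]

theorem isEquivalenceTransformation (h : P.Regular (times U)) (hU : IsOpen U)
    (hreg : U ⊆ regular n) {Φ : Ext n → Ext n}
    (hΦ : Set.EqOn Φ P.extMap (U ×ˢ ({0}ᶜ ×ˢ Set.univ))) : IsEquivalenceTransformation U Φ := by
  refine ⟨(h.isDiffeoOn_extMap hU hreg).congr hΦ, P.map, h.isPointTransformation_map hU hreg,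
    fun e he => by rw [hΦ he, extMap], fun δ V hV => ⟨_, _, fun z hz => ?_,
      h.isAdmissible_map hU hreg hV⟩⟩
  have hmem : ((z, (δ, V z.1)) : Ext n) ∈ U ×ˢ (({0}ᶜ : Set ℂ) ×ˢ (Set.univ : Set ℂ)) :=
    ⟨hz, hV.1, Set.mem_univ _⟩
  rw [hΦ hmem]
  exact h.mapsElements_extMap δ V z hz

end Regular

end Params

end EquivalenceTransformation

/-! ### Reduction of admissible transformations to standard form -/

section SpatialDirections

variable {n : ℕ} {L : Vars n →L[ℝ] Vars n} {Q : Vars n →L[ℝ] Vars n →L[ℝ] Vars n}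

theorem Reduced.spatial_apply (h : Reduced L Q) (v : Fin n → ℝ) (w : ℂ) :
    L ((0, v), w) = ((0, spatialJacobian L *ᵥ v),
      ∑ a, v a * (L (ex a, 0)).2 + (L (0, 1)).2 * hat (timeRate L) w) := by
  have hsplit : (((0, v), w) : Vars n) = ∑ a, v a • (ex a, 0) + (0, w) := by
    refine Prod.ext ?_ (by simp [Prod.snd_sum])
    conv_lhs => rw [spatial_eq_sum (v := (0, v)) rfl]
    simp [Prod.fst_sum]
  refine Prod.ext (Prod.ext (h.map _ rfl) ?_) ?_
  · ext b
    rw [hsplit, map_add, map_sum, Prod.fst_add, h.base]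
    simp only [map_smul, Prod.fst_sum, Prod.snd_sum, Prod.smul_fst, Prod.smul_snd, add_zero,
      Finset.sum_apply, Pi.smul_apply, smul_eq_mul, mul_comm, spatialJacobian, Matrix.mulVec,
      dotProduct, Matrix.of_apply]
  · rw [hsplit, map_add, map_sum, Prod.snd_add, h.fiber_apply]
    simp only [map_smul, Prod.snd_sum, Prod.smul_snd, Complex.real_smul]

theorem IsDiffeoOn.contDiffOn_fderiv_apply {φ : Vars n → Vars n} {U : Set (Vars n)}
    (hφ : IsDiffeoOn φ U) (u : Vars n) : ContDiffOn ℝ ∞ (fun y => fderiv ℝ φ y u) U :=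
  (hφ.2.1.fderiv_of_isOpen hφ.1 (by simp)).clm_apply contDiffOn_const

end SpatialDirections

section LogarithmicDerivative

variable {E : Type*} [NormedAddCommGroup E] [NormedSpace ℝ E] {f g : E → ℂ} {p u : E}

theorem fderiv_mul_inv_apply_eq_zero (hf : DifferentiableAt ℝ f p) (hg : DifferentiableAt ℝ g p)
    (hne : g p ≠ 0) (h : fderiv ℝ f p u * g p = f p * fderiv ℝ g p u) :
    fderiv ℝ (fun q => f q * (g q)⁻¹) p u = 0 := by
  have hquotient : HasFDerivAt (fun q => f q * (g q)⁻¹) _ p :=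
    hf.hasFDerivAt.fun_mul ((hasFDerivAt_inv' (𝕜 := ℝ) hne).comp p hg.hasFDerivAt)
  rw [hquotient.fderiv]
  simp only [add_apply, smul_apply, ContinuousLinearMap.comp_apply, neg_apply,
    ContinuousLinearMap.mulLeftRight_apply, smul_eq_mul]
  field_simp
  linear_combination h

end LogarithmicDerivative

section StandardFormOfAdmissible

variable {n : ℕ} [NeZero n] {φ : Vars n → Vars n} {U : Set (Vars n)} {δ δ' : ℂ}
  {V V' : Base n → ℂ} {y z : Vars n}

theorem MapsEquation.timeRate_eq (h : MapsEquation φ U δ V δ' V')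
    (hφ : IsPointTransformation φ U) (hδ : δ ≠ 0) (hU : IsPatch U) (hy : y ∈ U) (hz : z ∈ U) :
    timeRate (fderiv ℝ φ y) = timeRate (fderiv ℝ φ z) :=
  hU.eq_of_fderiv_eq_zero (f := fun y => timeRate (fderiv ℝ φ y))
    (hφ.1.contDiffOn_fderiv_apply (et, 0)).fst.fst
    (fun _ hx => (h.hasFDerivAt_timeRate hφ hδ hx).fderiv) hy hz

theorem MapsEquation.spatialJacobian_eq (h : MapsEquation φ U δ V δ' V')
    (hφ : IsPointTransformation φ U) (hδ : δ ≠ 0) (hU : IsPatch U) (hy : y ∈ U) (hz : z ∈ U) :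
    spatialJacobian (fderiv ℝ φ y) = spatialJacobian (fderiv ℝ φ z) := by
  ext b a
  refine congrFun (hU.eq_of_fderiv_eq_zero (f := fun y => (fderiv ℝ φ y (ex a, 0)).1.2)
    (hφ.1.contDiffOn_fderiv_apply (ex a, 0)).fst.snd (fun x hx => ?_) hy hz) b
  rw [(hasFDerivAt_fderiv_apply (contDiffAt_two (hφ.1.contDiffAt hx)) (ex a, 0)).fst.snd.fderiv]
  refine ContinuousLinearMap.ext fun u => ?_
  exact congrArg Prod.snd (h.second_spatial_eq_zero hφ hδ hx u a)

theorem MapsEquation.exists_shift (h : MapsEquation φ U δ V δ' V')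
    (hφ : IsPointTransformation φ U) (hδ : δ ≠ 0) (hU : IsPatch U) (hz : z ∈ U) :
    ∃ τ, ∀ y ∈ U, (φ y).1.1 = timeRate (fderiv ℝ φ z) * y.1.1 + τ := by
  set θ := timeRate (fderiv ℝ φ z)
  have hsmooth : ContDiffOn ℝ ∞ (fun y : Vars n => (φ y).1.1 - θ * y.1.1) U :=
    hφ.1.2.1.fst.fst.sub (by fun_prop)
  have hderiv : ∀ x ∈ U, fderiv ℝ (fun y : Vars n => (φ y).1.1 - θ * y.1.1) x = 0 := by
    intro x hx
    have hφx := ((hφ.1.contDiffAt hx).differentiableAt (by simp)).hasFDerivAt.fst.fst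
    rw [(hφx.fun_sub (hasFDerivAt_fst.fst.const_mul θ)).fderiv]
    refine ContinuousLinearMap.ext fun u => ?_
    have htime : (fderiv ℝ φ x u).1.1 = θ * u.1.1 := by
      rw [fst_time_eq (h.reduced hφ.1 hx).map, h.timeRate_eq hφ hδ hU hx hz]
    simpa [sub_eq_zero] using htime
  refine ⟨(φ z).1.1 - θ * z.1.1, fun y hy => ?_⟩
  have hconst := hU.eq_of_fderiv_eq_zero hsmooth hderiv hy hz
  linarith

theorem MapsEquation.exists_translation (h : MapsEquation φ U δ V δ' V')
    (hφ : IsPointTransformation φ U) (hδ : δ ≠ 0) (hU : IsPatch U) (hz : z ∈ U) :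
    ∃ X : ℝ → Fin n → ℝ, ContDiffOn ℝ ∞ X (times U) ∧ ∀ y ∈ U,
      (φ y).1.2 = spatialJacobian (fderiv ℝ φ z) *ᵥ y.1.2 + X y.1.1 ∧
        deriv X y.1.1 = (fderiv ℝ φ y (et, 0)).1.2 := by
  set A := spatialJacobian (fderiv ℝ φ z)
  have hfderiv : ∀ x ∈ U, ∀ u, fderiv ℝ (fun y : Vars n => (φ y).1.2 - A *ᵥ y.1.2) x u
      = (fderiv ℝ φ x u).1.2 - A *ᵥ u.1.2 := by
    intro x hx u
    have hφx := ((hφ.1.contDiffAt hx).differentiableAt (by simp)).hasFDerivAt.fst.snd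
    rw [(hφx.fun_sub (hasFDerivAt_mulVec A hasFDerivAt_fst.snd)).fderiv]
    rfl
  have hsmooth : ContDiffOn ℝ ∞ (fun y : Vars n => (φ y).1.2 - A *ᵥ y.1.2) U :=
    hφ.1.2.1.fst.snd.sub
      (A.mulVecLin.toContinuousLinearMap.contDiff.comp (by fun_prop)).contDiffOn
  obtain ⟨X, hX, hvalue⟩ := hU.exists_time_function hsmooth fun x hx v w => by
    rw [hfderiv x hx, (h.reduced hφ.1 hx).spatial_apply, h.spatialJacobian_eq hφ hδ hU hx hz,
      sub_self]
  refine ⟨X, hX, fun y hy => ⟨?_, ?_⟩⟩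
  · rw [← (hvalue y hy).1, add_sub_cancel]
  · rw [(hvalue y hy).2.deriv, hfderiv y hy, et, Matrix.mulVec_zero, sub_zero]

end StandardFormOfAdmissible

section PhaseOfAdmissible

variable {n : ℕ} [NeZero n] {φ : Vars n → Vars n} {U : Set (Vars n)} {δ δ' : ℂ}
  {V V' : Base n → ℂ} {z : Vars n} {P : Params n}

theorem MapsEquation.snd_fderiv_mul_eq (h : MapsEquation φ U δ V δ' V')
    (hφ : IsPointTransformation φ U) (hδ : δ ≠ 0) (hP : P.Regular (times U)) (hz : z ∈ U)
    (hrate : timeRate (fderiv ℝ φ z) = P.rate) (hlinear : spatialJacobian (fderiv ℝ φ z) = P.linear)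
    (htranslation : deriv P.translation z.1.1 = (fderiv ℝ φ z (et, 0)).1.2)
    (v : Fin n → ℝ) (w : ℂ) :
    (fderiv ℝ φ z ((0, v), w)).2 * (P.map z).2
      = (φ z).2 * (fderiv ℝ P.map z ((0, v), w)).2 := by
  have hred := h.reduced hφ.1 hz
  have hslope (a : Fin n) :
      (fderiv ℝ φ z (ex a, 0)).2 = (φ z).2 * (Complex.I * (P.covector z.1.1 a : ℝ)) := by
    rw [h.phase_gradient hφ hδ hz, mul_comm, hrate, ← htranslation,
      ← transpose_spatialJacobian_mulVec, hlinear, div_eq_inv_mul]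
    rfl
  have hvalue : (φ z).2 = (fderiv ℝ φ z (0, 1)).2 * hat P.rate z.2 := by
    rw [h.snd_eq_fiber hφ hδ hz, hred.fiber_apply, hrate]
  have hfiber : (P.map z).2 = Complex.exp (P.exponent z) * hat P.rate z.2 := rfl
  rw [hred.spatial_apply, hrate, (hP.reduced_map (mem_times hz)).spatial_apply,
    hP.timeRate_map (mem_times hz)]
  simp only [hslope, hP.fderiv_map_ex (mem_times hz), hP.fderiv_map_fiber (mem_times hz),
    mul_left_comm _ (φ z).2, mul_left_comm _ (P.map z).2, ← Finset.mul_sum]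
  rw [← hatAlg_apply _ 1, map_one, hfiber]
  linear_combination -(Complex.exp (P.exponent z) * hat P.rate w) * hvalue

theorem MapsEquation.exists_gauge (h : MapsEquation φ U δ V δ' V')
    (hφ : IsPointTransformation φ U) (hδ : δ ≠ 0) (hU : IsPatch U) (hP : P.Regular (times U))
    (hrate : ∀ z ∈ U, timeRate (fderiv ℝ φ z) = P.rate)
    (hlinear : ∀ z ∈ U, spatialJacobian (fderiv ℝ φ z) = P.linear)
    (htranslation : ∀ z ∈ U, deriv P.translation z.1.1 = (fderiv ℝ φ z (et, 0)).1.2) :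
    ∃ γ : ℝ → ℂ, ContDiffOn ℝ ∞ γ (times U) ∧
      ∀ z ∈ U, (φ z).2 = Complex.exp (γ z.1.1) * (P.map z).2 := by
  have hmap := hP.isPointTransformation_map hU.isOpen hU.subset_regular
  have hsmooth : ContDiffOn ℝ ∞ (fun z => (φ z).2 * ((P.map z).2)⁻¹) U :=
    hφ.1.2.1.snd.mul (hmap.1.2.1.snd.inv hmap.2.2)
  obtain ⟨G, hG, hquotient⟩ := hU.exists_time_function hsmooth fun z hz v w => by
    have hφz := (hφ.1.contDiffAt hz).differentiableAt (by simp)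
    have hmapz := (hmap.1.contDiffAt hz).differentiableAt (by simp)
    refine fderiv_mul_inv_apply_eq_zero hφz.snd hmapz.snd (hmap.2.2 hz) ?_
    rw [hφz.hasFDerivAt.snd.fderiv, hmapz.hasFDerivAt.snd.fderiv]
    exact h.snd_fderiv_mul_eq hφ hδ hP hz (hrate z hz) (hlinear z hz) (htranslation z hz) v w
  have hne : ∀ t ∈ times U, G t ≠ 0 := by
    rintro _ ⟨z, hz, rfl⟩
    rw [← (hquotient z hz).1]
    exact mul_ne_zero (hφ.2.2 hz) (inv_ne_zero (hmap.2.2 hz))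
  obtain ⟨γ, hγ, hexp⟩ := exists_smooth_log (isOpen_times hU.isOpen) hU.times_conn hG hne
  refine ⟨γ, hγ, fun z hz => ?_⟩
  rw [← hexp _ (mem_times hz), ← (hquotient z hz).1, inv_mul_cancel_right₀ (hmap.2.2 hz)]

theorem MapsEquation.exists_eqOn_map (h : MapsEquation φ U δ V δ' V')
    (hφ : IsPointTransformation φ U) (hδ : δ ≠ 0) (hU : IsPatch U) :
    ∃ P : Params n, P.Regular (times U) ∧ Set.EqOn φ P.map U := by
  have hopen := isOpen_times hU.isOpen
  rcases U.eq_empty_or_nonempty with rfl | ⟨z₀, hz₀⟩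
  · exact ⟨⟨1, 0, 1, 0, 0⟩, ⟨hopen, one_ne_zero, by simp, contDiffOn_const, contDiffOn_const⟩,
      Set.eqOn_empty _ _⟩
  have hred := h.reduced hφ.1 hz₀
  obtain ⟨τ, hτ⟩ := h.exists_shift hφ hδ hU hz₀
  obtain ⟨X, hX, hspace⟩ := h.exists_translation hφ hδ hU hz₀
  set θ := timeRate (fderiv ℝ φ z₀)
  set A := spatialJacobian (fderiv ℝ φ z₀)
  have hP : (⟨θ, τ, A, X, 0⟩ : Params n).Regular (times U) :=
    ⟨hopen, hred.rate, hred.spatialJacobian_mul_transpose, hX, contDiffOn_const⟩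
  obtain ⟨γ, hγ, hfiber⟩ := h.exists_gauge hφ hδ hU hP
    (fun z hz => h.timeRate_eq hφ hδ hU hz hz₀) (fun z hz => h.spatialJacobian_eq hφ hδ hU hz hz₀)
    fun z hz => (hspace z hz).2
  refine ⟨⟨θ, τ, A, X, γ⟩, ⟨hopen, hP.rate_ne_zero, hP.linear_mul_transpose, hX, hγ⟩,
    fun z hz => Prod.ext (Prod.ext (hτ z hz) (hspace z hz).1) ?_⟩
  rw [hfiber z hz]
  simp only [Params.map, Params.exponent, Params.covector, Pi.zero_apply, add_zero,
    Complex.exp_add]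
  ring

end PhaseOfAdmissible

section Normalization

variable {n : ℕ} {φ : Vars n → Vars n} {U W : Set (Vars n)} {δ δ' : ℂ}
  {V V' : Base n → ℂ} {z : Vars n} {P : Params n}

theorem IsPointTransformation.mono (hφ : IsPointTransformation φ U) (hWU : W ⊆ U)
    (hW : IsOpen W) : IsPointTransformation φ W :=
  ⟨⟨hW, hφ.1.2.1.mono hWU, hφ.1.2.2.1.mono hWU, fun z hz => hφ.1.2.2.2 z (hWU hz)⟩,
    hWU.trans hφ.2.1, hφ.2.2.mono_left hWU⟩

theorem MapsEquation.mono (h : MapsEquation φ U δ V δ' V') (hWU : W ⊆ U) :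
    MapsEquation φ W δ V δ' V' := fun p ψ ψ' hp => h p ψ ψ' (hWU hp)

theorem zeroOrder_injective {w : ℂ} (hw : w ≠ 0) (δ : ℂ) :
    Function.Injective fun v => zeroOrder δ v w := fun _ _ h =>
  mul_right_cancel₀ hw (add_left_cancel h)

theorem MapsEquation.elements_eq [NeZero n] (h : MapsEquation φ U δ V δ' V')
    (hφ : IsPointTransformation φ U) (hδ : δ ≠ 0) (hP : P.Regular (times U))
    (heq : Set.EqOn φ P.map U) (hz : z ∈ U) :
    δ' = P.coupling δ ∧ V' (φ z).1 = P.potential z.1 δ (V z.1) := by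
  have htime := mem_times hz
  have hnear := heq.eventuallyEq_of_mem (hφ.1.1.mem_nhds hz)
  have habs : ((|P.rate| : ℝ) : ℂ) ≠ 0 := by simpa using hP.rate_ne_zero
  have hcoupling : δ' = P.coupling δ := by
    have hhat := h.hat_delta_eq hφ hδ hz
    rw [hnear.fderiv_eq, hP.timeRate_map htime] at hhat
    exact mul_left_cancel₀ habs (hhat.symm.trans (hP.abs_mul_coupling δ).symm)
  refine ⟨hcoupling, ?_⟩
  have hfree := (h.determining hφ.1 hz).free
  rw [hnear.fderiv_eq, D2, hnear.fderiv.fderiv_eq, heq hz, hcoupling] at hfree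
  have hdefect := hfree.trans (hP.determining_map htime (hφ.2.1 hz) δ (V z.1)).free.symm
  simp only [defect, hP.timeRate_map htime] at hdefect
  rw [heq hz]
  exact zeroOrder_injective (heq hz ▸ hφ.2.2 hz) _
    (mul_left_cancel₀ habs (add_left_cancel hdefect))

theorem isNormalized [NeZero n] : IsNormalized n := by
  rintro U δ V φ δ' V' ⟨hφ, ⟨hδ, -⟩, -, hmaps⟩ W hWU hW
  replace hφ := hφ.mono hWU hW.isOpen
  replace hmaps := hmaps.mono hWU
  obtain ⟨P, hP, heq⟩ := hmaps.exists_eqOn_map hφ hδ hW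
  refine ⟨P.extMap, hP.isEquivalenceTransformation hW.isOpen hW.subset_regular
    (Set.eqOn_refl _ _), fun z hz => ?_⟩
  obtain ⟨hcoupling, hpotential⟩ := hmaps.elements_eq hφ hδ hP heq hz
  rw [hpotential, hcoupling, heq hz, Params.extMap]

theorem IsEquivalenceTransformation.exists_eqOn_extMap [NeZero n] {Φ : Ext n → Ext n}
    (hΦ : IsEquivalenceTransformation U Φ) (hU : IsPatch U) :
    ∃ P : Params n, P.Regular (times U) ∧ Set.EqOn Φ P.extMap (U ×ˢ ({0}ᶜ ×ˢ Set.univ)) := by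
  obtain ⟨-, φ, hφ, -, hmaps⟩ := hΦ
  obtain ⟨_, _, -, hunit⟩ := hmaps 1 0 ⟨one_ne_zero, contDiffOn_const⟩
  obtain ⟨P, hP, heq⟩ := hunit.2.2.2.exists_eqOn_map hφ one_ne_zero hU
  refine ⟨P, hP, ?_⟩
  rintro ⟨z, δ, v⟩ ⟨hz, hδ, -⟩
  obtain ⟨δ', V', helements, hadm⟩ := hmaps δ (fun _ => v) ⟨hδ, contDiffOn_const⟩
  obtain ⟨hcoupling, hpotential⟩ := hadm.2.2.2.elements_eq hφ hδ hP heq hz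
  rw [helements z hz, hpotential, hcoupling, heq hz, Params.extMap]

end Normalization

/-! ### Parametrization by functions of time -/

section AffineTime

variable {I : Set ℝ} {T : ℝ → ℝ}

theorem exists_affine_of_deriv_deriv_eq_zero (hI : IsOpen I) (hconn : IsPreconnected I)
    (hT : ContDiffOn ℝ ∞ T I) (hrate : ∀ t ∈ I, deriv T t ≠ 0 ∧ deriv (deriv T) t = 0) :
    ∃ θ τ : ℝ, θ ≠ 0 ∧ ∀ t ∈ I, T t = θ * t + τ ∧ deriv T t = θ := by
  rcases I.eq_empty_or_nonempty with rfl | ⟨t₀, ht₀⟩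
  · exact ⟨1, 0, one_ne_zero, by simp⟩
  have hdiff := hT.differentiableOn (by simp)
  have hdiff' := (hT.deriv_of_isOpen hI (m := ∞) (by simp)).differentiableOn (by simp)
  have hconst : ∀ t ∈ I, deriv T t = deriv T t₀ := fun t ht =>
    hI.is_const_of_deriv_eq_zero hconn hdiff' (fun s hs => (hrate s hs).2) ht ht₀
  have hzero : ∀ t ∈ I, deriv (fun s => T s - deriv T t₀ * s) t = 0 := fun t ht => by
    have hsub := (hdiff.differentiableAt (hI.mem_nhds ht)).hasDerivAt.fun_sub
      ((hasDerivAt_id' t).const_mul (deriv T t₀))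
    rw [hsub.deriv, hconst t ht, mul_one, sub_self]
  refine ⟨deriv T t₀, T t₀ - deriv T t₀ * t₀, (hrate t₀ ht₀).1, fun t ht => ⟨?_, hconst t ht⟩⟩
  have hvalue := hI.is_const_of_deriv_eq_zero hconn
    (hdiff.fun_sub (by fun_prop)) hzero ht ht₀
  linarith

end AffineTime

section Parameters

variable {n : ℕ} {θ τ : ℝ} {X : Fin n → ℝ → ℝ} {O : Matrix (Fin n) (Fin n) ℝ} {S Z : ℝ → ℝ}
  {I : Set ℝ} {P : Params n} {t : ℝ}

theorem rpow_half_mul_self {s : ℝ} (hs : 0 ≤ s) : s ^ (1 / 2 : ℝ) * s ^ (1 / 2 : ℝ) = s := by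
  rw [← Real.sqrt_eq_rpow, Real.mul_self_sqrt hs]

theorem deriv_pi_of_contDiffOn (hI : IsOpen I) (hX : ∀ a, ContDiffOn ℝ ∞ (X a) I) (ht : t ∈ I) :
    deriv (fun s a => X a s) t = fun a => deriv (X a) t :=
  deriv_pi fun a => ((hX a).contDiffAt (hI.mem_nhds ht)).differentiableAt (by simp)

theorem deriv_deriv_pi_of_contDiffOn (hI : IsOpen I) (hX : ∀ a, ContDiffOn ℝ ∞ (X a) I)
    (ht : t ∈ I) : deriv (deriv fun s a => X a s) t = fun a => deriv (deriv (X a)) t := by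
  have hnear : deriv (fun s a => X a s) =ᶠ[𝓝 t] fun s a => deriv (X a) s :=
    Filter.eventually_of_mem (hI.mem_nhds ht) fun _ hs => deriv_pi_of_contDiffOn hI hX hs
  rw [hnear.deriv_eq, deriv_pi_of_contDiffOn hI (fun a => (hX a).deriv_of_isOpen hI (by simp)) ht]

theorem smul_transpose_mulVec_dotProduct (c : ℝ) (y x : Fin n → ℝ) :
    (c • (Oᵀ *ᵥ y)) ⬝ᵥ x = ∑ b, ∑ a, c * y b * O b a * x a := by
  rw [Finset.sum_comm, dotProduct]
  refine Finset.sum_congr rfl fun a _ => ?_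
  rw [Pi.smul_apply, smul_eq_mul, Matrix.mulVec, dotProduct, Finset.mul_sum, Finset.sum_mul]
  exact Finset.sum_congr rfl fun b _ => by rw [Matrix.transpose_apply]; ring

namespace Params

theorem Regular.covector_dotProduct_self (h : P.Regular I) (t : ℝ) :
    P.covector t ⬝ᵥ P.covector t
      = |P.rate| * (1 / 4 * (deriv P.translation t ⬝ᵥ deriv P.translation t) / P.rate ^ 2) := by
  rw [covector, smul_dotProduct, dotProduct_smul, Matrix.dotProduct_mulVec, Matrix.vecMul_transpose,
    Matrix.mulVec_mulVec, h.linear_mul_transpose, Matrix.smul_mulVec, Matrix.one_mulVec,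
    smul_dotProduct]
  simp only [smul_eq_mul]
  ring

theorem Regular.deriv_covector (h : P.Regular I) (ht : t ∈ I) :
    deriv P.covector t
      = (2 * P.rate)⁻¹ • (P.linearᵀ *ᵥ deriv (deriv P.translation) t) := by
  have hdiff := h.differentiableAt_of_contDiffOn ht h.contDiffOn_deriv_translation
  have hcovector : HasDerivAt P.covector _ t :=
    (P.linearᵀ.mulVecLin.toContinuousLinearMap.hasFDerivAt.comp_hasDerivAt t
      hdiff.hasDerivAt).const_smul (2 * P.rate)⁻¹
  exact hcovector.deriv

/-- The parameters of the transformation given by `T = θt + τ`, `𝒳`, `O`, `Σ` and `Z`. -/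
def ofFunctions (θ τ : ℝ) (X : Fin n → ℝ → ℝ) (O : Matrix (Fin n) (Fin n) ℝ) (S Z : ℝ → ℝ) :
    Params n where
  rate := θ
  shift := τ
  linear := |θ| ^ (1 / 2 : ℝ) • O
  translation t a := X a t
  gauge t := Complex.I * S t + Z t

theorem regular_ofFunctions (hI : IsOpen I) (hθ : θ ≠ 0) (hX : ∀ a, ContDiffOn ℝ ∞ (X a) I)
    (hO : O ∈ Matrix.orthogonalGroup (Fin n) ℝ) (hS : ContDiffOn ℝ ∞ S I)
    (hZ : ContDiffOn ℝ ∞ Z I) : (ofFunctions θ τ X O S Z).Regular I where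
  isOpen := hI
  rate_ne_zero := hθ
  linear_mul_transpose := by
    rw [ofFunctions, Matrix.transpose_smul, Matrix.smul_mul, Matrix.mul_smul, smul_smul,
      rpow_half_mul_self (abs_nonneg θ), (Matrix.mem_orthogonalGroup_iff (Fin n) ℝ).1 hO]
  translation := contDiffOn_pi.2 hX
  gauge := (contDiffOn_const.mul (Complex.ofRealCLM.contDiff.comp_contDiffOn hS)).add
    (Complex.ofRealCLM.contDiff.comp_contDiffOn hZ)

theorem Regular.exists_eq_ofFunctions (h : P.Regular I) :
    ∃ (θ τ : ℝ) (X : Fin n → ℝ → ℝ) (O : Matrix (Fin n) (Fin n) ℝ) (S Z : ℝ → ℝ),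
      (∀ a, ContDiffOn ℝ ∞ (X a) I) ∧ O ∈ Matrix.orthogonalGroup (Fin n) ℝ ∧
      ContDiffOn ℝ ∞ S I ∧ ContDiffOn ℝ ∞ Z I ∧ P = ofFunctions θ τ X O S Z := by
  have habs : 0 < |P.rate| := abs_pos.2 h.rate_ne_zero
  have hroot : |P.rate| ^ (1 / 2 : ℝ) ≠ 0 := (Real.rpow_pos_of_pos habs _).ne'
  refine ⟨P.rate, P.shift, fun a t => P.translation t a,
    (|P.rate| ^ (1 / 2 : ℝ))⁻¹ • P.linear, fun t => (P.gauge t).im, fun t => (P.gauge t).re,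
    contDiffOn_pi.1 h.translation, ?_, Complex.imCLM.contDiff.comp_contDiffOn h.gauge,
    Complex.reCLM.contDiff.comp_contDiffOn h.gauge, ?_⟩
  · rw [Matrix.mem_orthogonalGroup_iff, Matrix.transpose_smul, Matrix.smul_mul,
      Matrix.mul_smul, smul_smul, h.linear_mul_transpose, smul_smul, ← mul_inv,
      rpow_half_mul_self habs.le, inv_mul_cancel₀ habs.ne', one_smul]
  · have hgauge : P.gauge = fun t => Complex.I * (P.gauge t).im + (P.gauge t).re :=
      funext fun t => by rw [add_comm, mul_comm, Complex.re_add_im]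
    rw [ofFunctions, smul_inv_smul₀ hroot, ← hgauge]

theorem deriv_gauge_ofFunctions (hS : DifferentiableAt ℝ S t)
    (hZ : DifferentiableAt ℝ Z t) :
    deriv (ofFunctions θ τ X O S Z).gauge t = Complex.I * deriv S t + deriv Z t :=
  ((hS.hasDerivAt.ofReal_comp.const_mul Complex.I).add hZ.hasDerivAt.ofReal_comp).deriv

section Formulas

variable (hI : IsOpen I) (hX : ∀ a, ContDiffOn ℝ ∞ (X a) I) (ht : t ∈ I)
include hI hX ht

theorem covector_ofFunctions_dotProduct (hθ : θ ≠ 0) (x : Fin n → ℝ) :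
    (ofFunctions θ τ X O S Z).covector t ⬝ᵥ x
      = 1 / 2 * ∑ b, ∑ a, Real.sign θ * deriv (X b) t / |θ| ^ (1 / 2 : ℝ) * O b a * x a := by
  have hroot : |θ| ^ (1 / 2 : ℝ) ≠ 0 := (Real.rpow_pos_of_pos (abs_pos.2 hθ) _).ne'
  have hcoefficient : (2 * θ)⁻¹ * |θ| ^ (1 / 2 : ℝ)
      = 1 / 2 * (Real.sign θ / |θ| ^ (1 / 2 : ℝ)) := by
    have hsign : Real.sign θ * θ = |θ| := by
      rcases hθ.lt_or_gt with hneg | hpos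
      · rw [Real.sign_of_neg hneg, abs_of_neg hneg, neg_one_mul]
      · rw [Real.sign_of_pos hpos, abs_of_pos hpos, one_mul]
    field_simp
    rw [pow_two, rpow_half_mul_self (abs_nonneg θ), ← hsign]
    ring
  simp only [covector, ofFunctions, Matrix.transpose_smul, Matrix.smul_mulVec, smul_smul,
    deriv_pi_of_contDiffOn hI hX ht]
  rw [smul_transpose_mulVec_dotProduct, hcoefficient]
  simp only [Finset.mul_sum]
  exact Finset.sum_congr rfl fun b _ => Finset.sum_congr rfl fun a _ => by ring

theorem Regular.deriv_covector_ofFunctions_dotProduct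
    (h : (ofFunctions θ τ X O S Z).Regular I) (x : Fin n → ℝ) :
    deriv (ofFunctions θ τ X O S Z).covector t ⬝ᵥ x / θ
      = ∑ b, ∑ a, deriv (deriv (X b)) t / (2 * |θ| ^ (3 / 2 : ℝ)) * O b a * x a := by
  have habs : 0 < |θ| := abs_pos.2 h.rate_ne_zero
  have hθ : θ ≠ 0 := h.rate_ne_zero
  have hroot : |θ| ^ (1 / 2 : ℝ) ≠ 0 := (Real.rpow_pos_of_pos habs _).ne'
  have hthree : |θ| ^ (3 / 2 : ℝ) = |θ| * |θ| ^ (1 / 2 : ℝ) := by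
    rw [← Real.rpow_one_add' habs.le (by norm_num)]
    norm_num
  have hcoefficient : (2 * θ)⁻¹ * |θ| ^ (1 / 2 : ℝ) / θ = (2 * |θ| ^ (3 / 2 : ℝ))⁻¹ := by
    rw [hthree]
    field_simp
    rw [pow_two, rpow_half_mul_self habs.le, ← sq_abs θ, pow_two]
  rw [h.deriv_covector ht]
  simp only [ofFunctions, Matrix.transpose_smul, Matrix.smul_mulVec, smul_smul,
    deriv_deriv_pi_of_contDiffOn hI hX ht]
  rw [smul_transpose_mulVec_dotProduct]
  simp only [Finset.sum_div]
  refine Finset.sum_congr rfl fun b _ => Finset.sum_congr rfl fun a _ => ?_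
  linear_combination deriv (deriv (X b)) t * O b a * x a * hcoefficient

theorem Regular.covector_ofFunctions_dotProduct_self
    (h : (ofFunctions θ τ X O S Z).Regular I) :
    (ofFunctions θ τ X O S Z).covector t ⬝ᵥ (ofFunctions θ τ X O S Z).covector t / |θ|
      = 1 / 4 * ∑ a, deriv (X a) t * deriv (X a) t / θ ^ 2 := by
  rw [h.covector_dotProduct_self]
  simp only [ofFunctions, deriv_pi_of_contDiffOn hI hX ht, ← Finset.sum_div, dotProduct]
  rw [mul_div_cancel_left₀ _ (abs_ne_zero.2 (show θ ≠ 0 from h.rate_ne_zero)), mul_div_assoc]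

theorem exponent_ofFunctions (hθ : θ ≠ 0) {T : ℝ → ℝ} (hrate : deriv T t = θ)
    (hrate' : deriv (deriv T) t = 0) (x : Fin n → ℝ) (ψ : ℂ) :
    (ofFunctions θ τ X O S Z).exponent ((t, x), ψ)
      = Complex.I * ((1 / 8 * (deriv (deriv T) t / |deriv T t|) * ∑ a, x a * x a
          + 1 / 2 * ∑ b, ∑ a,
            Real.sign (deriv T t) * deriv (X b) t / |deriv T t| ^ (1 / 2 : ℝ) * O b a * x a
          + S t : ℝ) : ℂ) + (Z t : ℂ) := by
  rw [exponent, covector_ofFunctions_dotProduct hI hX ht hθ, ofFunctions, hrate', hrate, zero_div,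
    mul_zero, zero_mul, zero_add, Complex.ofReal_add, mul_add, add_assoc]

theorem map_ofFunctions (hθ : θ ≠ 0) {T : ℝ → ℝ} (hT : T t = θ * t + τ) (hrate : deriv T t = θ)
    (hrate' : deriv (deriv T) t = 0) (x : Fin n → ℝ) (ψ : ℂ) :
    (ofFunctions θ τ X O S Z).map ((t, x), ψ)
      = ((T t, newX T X O t x), newPsi T X O S Z t x ψ) := by
  rw [map, exponent_ofFunctions hI hX ht hθ hrate hrate', hT, newPsi, hrate]
  refine Prod.ext (Prod.ext rfl (funext fun a => ?_)) rfl
  simp only [newX, hrate, ofFunctions, Matrix.smul_mulVec]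
  rfl

theorem Regular.potential_ofFunctions (h : (ofFunctions θ τ X O S Z).Regular I)
    (hS : ContDiffOn ℝ ∞ S I) (hZ : ContDiffOn ℝ ∞ Z I) {T : ℝ → ℝ} (hrate : deriv T t = θ)
    (x : Fin n → ℝ) (δ v : ℂ) :
    (ofFunctions θ τ X O S Z).potential (t, x) δ v = newV T X O S Z t x δ v := by
  have hgauge := deriv_gauge_ofFunctions (θ := θ) (τ := τ) (X := X) (O := O)
    ((hS.contDiffAt (hI.mem_nhds ht)).differentiableAt (by simp))
    ((hZ.contDiffAt (hI.mem_nhds ht)).differentiableAt (by simp))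
  have hre : ((ofFunctions θ τ X O S Z).gauge t).re = Z t := by simp [ofFunctions]
  rw [potential, newV, hrate, hgauge, hre, ← h.covector_ofFunctions_dotProduct_self hI hX ht,
    ← h.deriv_covector_ofFunctions_dotProduct hI hX ht]
  simp only [ofFunctions, Complex.ofReal_div]
  linear_combination (-((deriv S t : ℝ) : ℂ) / θ) * Complex.I_sq

theorem Regular.extMap_ofFunctions (h : (ofFunctions θ τ X O S Z).Regular I)
    (hS : ContDiffOn ℝ ∞ S I) (hZ : ContDiffOn ℝ ∞ Z I) {T : ℝ → ℝ} (hT : T t = θ * t + τ)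
    (hrate : deriv T t = θ) (hrate' : deriv (deriv T) t = 0) (x : Fin n → ℝ) (ψ δ v : ℂ) :
    (ofFunctions θ τ X O S Z).extMap (((t, x), ψ), (δ, v))
      = (((T t, newX T X O t x), newPsi T X O S Z t x ψ),
          (newDelta T t δ, newV T X O S Z t x δ v)) := by
  refine Prod.ext (map_ofFunctions hI hX ht h.rate_ne_zero hT hrate hrate' x ψ)
    (Prod.ext ?_ (h.potential_ofFunctions hI hX ht hS hZ hrate x δ v))
  rw [newDelta, hrate]
  rfl

end Formulas

end Params

end Parameters

end LogNLS

end

open LogNLS in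
theorem mainTheorem8 (n : ℕ) (hn : 1 ≤ n) :
    IsNormalized n ∧
    ∀ (U : Set (Vars n)), IsPatch U → ∀ Φ : Ext n → Ext n,
      IsEquivalenceTransformation U Φ ↔
        ∃ (T : ℝ → ℝ) (X : Fin n → ℝ → ℝ) (O : Matrix (Fin n) (Fin n) ℝ) (S Z : ℝ → ℝ),
          ContDiffOn ℝ ∞ T (times U) ∧ (∀ a, ContDiffOn ℝ ∞ (X a) (times U)) ∧
          ContDiffOn ℝ ∞ S (times U) ∧ ContDiffOn ℝ ∞ Z (times U) ∧
          O ∈ Matrix.orthogonalGroup (Fin n) ℝ ∧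
          (∀ t ∈ times U, deriv T t ≠ 0 ∧ deriv (deriv T) t = 0) ∧
          ∀ (t : ℝ) (x : Fin n → ℝ) (ψ δ v : ℂ), ((t, x), ψ) ∈ U → δ ≠ 0 →
            Φ (((t, x), ψ), (δ, v)) =
              (((T t, newX T X O t x), newPsi T X O S Z t x ψ),
                (newDelta T t δ, newV T X O S Z t x δ v)) := by
  have : NeZero n := ⟨by omega⟩
  refine ⟨isNormalized, fun U hU Φ => ⟨fun hΦ => ?_, ?_⟩⟩
  · obtain ⟨P, hP, hmap⟩ := hΦ.exists_eqOn_extMap hU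
    obtain ⟨θ, τ, X, O, S, Z, hX, hO, hS, hZ, rfl⟩ := hP.exists_eq_ofFunctions
    have hrate : deriv (fun t => θ * t + τ) = fun _ => θ := funext fun t => by simp
    have hrate' : ∀ t, deriv (deriv fun t => θ * t + τ) t = 0 := fun t => by simp [hrate]
    refine ⟨fun t => θ * t + τ, X, O, S, Z, by fun_prop, hX, hS, hZ, hO,
      fun t _ => ⟨hrate ▸ hP.rate_ne_zero, hrate' t⟩, fun t x ψ δ v hz hδ => ?_⟩
    exact (hmap (by exact ⟨hz, hδ, trivial⟩)).trans <|
      hP.extMap_ofFunctions hP.isOpen hX (mem_times hz) hS hZ rfl (congrFun hrate t) (hrate' t) ..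
  · rintro ⟨T, X, O, S, Z, hT, hX, hS, hZ, hO, hrate, hΦ⟩
    have hI := isOpen_times hU.isOpen
    obtain ⟨θ, τ, hθ, haffine⟩ := exists_affine_of_deriv_deriv_eq_zero hI hU.times_conn hT hrate
    have hP := Params.regular_ofFunctions (τ := τ) hI hθ hX hO hS hZ
    refine hP.isEquivalenceTransformation hU.isOpen hU.subset_regular ?_
    rintro ⟨⟨⟨t, x⟩, ψ⟩, δ, v⟩ ⟨hz, hδ, -⟩
    have ht : t ∈ times U := mem_times hz
    rw [hΦ t x ψ δ v hz hδ, hP.extMap_ofFunctions hI hX ht hS hZ (haffine t ht).1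
      (haffine t ht).2 (hrate t ht).2]
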